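/- Let $n\ge 2$ and $m\ge 0$ be integers and put $N=2m$. Let $\sigma_1,\dots,\sigma_n\in\mathbb C^{m\times m}$ be such that the Hermitian $N\times N$ matrices $$\alpha_j=\begin{pmatrix}0&\sigma_j\\ \sigma_j^*&0\end{pmatrix},\qquad 1\le j\le n,$$ satisfy $\alpha_j\alpha_k+\alpha_k\alpha_j=2\delta_{jk}I_N$ for all $1\le j,k\le n$. (Typical cases are $N=2^{\lfloor (n+1)/2\rfloor}$ with Hermitian, pairwise anticommuting $\sigma_j$ with $\sigma_j^2=I_m$ when $n\ge 3$ is odd, and $m=1$, $\sigma_1=1$, $\sigma_2=-i$ when $n=2$.) Let $\mathcal D=-i\sum_{j=1}^n\alpha_j\partial_{x_j}$ and, for $0\ne x\in\mathbb R^n$, let $$\mathcal U(x)=\begin{pmatrix}0&-i\sum_j\frac{x_j}{|x|}\sigma_j\\ i\sum_j\frac{x_j}{|x|}\sigma_j^*&0\end{pmatrix}.$$ Let $2^\sharp=\frac{2n}{n-1}$. Let $H$ be a function from $\{z\in\mathbb C^N:|z|=1\}$ to $\mathbb C^{N\times N}$ that is Hölder continuous of order $\min\{2/(n-1),1\}$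 and satisfies $$H(z)=\mathcal U(\omega)\,H(\mathcal U(\omega)^*z)\,\mathcal U(\omega)^*\qquad\text{for all } z\in\mathbb C^N,\ \omega\in\mathbb R^n,\ |z|=|\omega|=1,$$ and put $h(z)=|z|^{2^\sharp-2}H(z/|z|)$ for $z\neq0$ and $h(0)=0$. Let $\psi\in L^{2^\sharp}(\mathbb R^n,\mathbb C^N)$ be a weak solution of $\mathcal D\psi=h(\psi)\psi$ on $\mathbb R^n$, that is, $$\int_{\mathbb R^n}\langle\mathcal D\phi,\psi\rangle\,dx=\int_{\mathbb R^n}\langle\phi,h(\psi)\psi\rangle\,dx\qquad\text{for all }\phi\in C_c^\infty(\mathbb R^n,\mathbb C^N).$$ Then $\psi$ has a continuous representative, again denoted by $\psi$, and there are $\Psi,\Phi_1,\dots,\Phi_n\in\mathbb C^N$ such that for every real $\alpha<\min\{2/(n-1),1\}$ there is a $C_\alpha<\infty$ with $$\left|\psi(x)-|x|^{-n+1}\,\mathcal U(x)\Psi+|x|^{-n}\sum_{j=1}^n\frac{x_j}{|x|}\,\mathcal U(x)\Phi_j\right|\le C_\alpha|x|^{-n-\alpha}\qquad\text{for all }|x|\ge1.$$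 -/

import Mathlib

open MeasureTheory Matrix
open scoped ContDiff

noncomputable section

namespace CriticalDirac

/-- The Euclidean space `ℝⁿ`. -/
abbrev Space (n : ℕ) : Type := EuclideanSpace ℝ (Fin n)

/-- The spinor space `ℂᴺ` with `N = 2m`, written as `ℂᵐ × ℂᵐ`, with its Hermitian norm. -/
abbrev Spinor (m : ℕ) : Type := EuclideanSpace ℂ (Fin m ⊕ Fin m)

/-- Complex `N × N` matrices, `N = 2m`. -/
abbrev SpinorMatrix (m : ℕ) : Type := Matrix (Fin m ⊕ Fin m) (Fin m ⊕ Fin m) ℂ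

/-- The action of an `N × N` matrix on a spinor. -/
def act {m : ℕ} (A : SpinorMatrix m) (z : Spinor m) : Spinor m :=
  WithLp.toLp 2 (A *ᵥ WithLp.ofLp z)

/-- The operator norm of an `N × N` matrix with respect to the Hermitian norm of `ℂᴺ`. -/
def opNorm {m : ℕ} (A : SpinorMatrix m) : ℝ :=
  ‖Matrix.toEuclideanCLM (n := Fin m ⊕ Fin m) (𝕜 := ℂ) A‖

/-- The Dirac matrix with block `σ` in the upper right corner and `σ*` in the lower left corner.
For Hermitian `σ` this is the matrix with two blocks `σ`; for `n = 2` the standard choice is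
`m = 1`, `σ₁ = 1`, `σ₂ = -i`, which gives the first two Pauli matrices. -/
def diracMatrix {m : ℕ} (σ : Matrix (Fin m) (Fin m) ℂ) : SpinorMatrix m :=
  Matrix.fromBlocks 0 σ σᴴ 0

/-- The anticommutation relations `α_j α_k + α_k α_j = 2 δ_{jk}` for the Dirac matrices `α_j`
built from `σ_1, …, σ_n`. -/
def IsCliffordFamily {n m : ℕ} (σ : Fin n → Matrix (Fin m) (Fin m) ℂ) : Prop :=
  ∀ j k : Fin n,
    diracMatrix (σ j) * diracMatrix (σ k) + diracMatrix (σ k) * diracMatrix (σ j) =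
      (if j = k then (2 : ℂ) else 0) • (1 : SpinorMatrix m)

/-- The matrix `(x / |x|) · σ`. -/
def unitSigma {n m : ℕ} (σ : Fin n → Matrix (Fin m) (Fin m) ℂ) (x : Space n) :
    Matrix (Fin m) (Fin m) ℂ :=
  ∑ j, ((x j / ‖x‖ : ℝ) : ℂ) • σ j

/-- The unitary matrix `𝒰(x)`, for `x ≠ 0`. -/
def inversionMatrix {n m : ℕ} (σ : Fin n → Matrix (Fin m) (Fin m) ℂ) (x : Space n) :
    SpinorMatrix m :=
  Matrix.fromBlocks 0 ((-Complex.I) • unitSigma σ x) (Complex.I • (unitSigma σ x)ᴴ) 0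

/-- The Dirac operator `𝒟 φ = -i ∑ⱼ αⱼ ∂ⱼ φ`. -/
def diracOp {n m : ℕ} (σ : Fin n → Matrix (Fin m) (Fin m) ℂ) (φ : Space n → Spinor m)
    (x : Space n) : Spinor m :=
  (-Complex.I) • ∑ j, act (diracMatrix (σ j)) (fderiv ℝ φ x (EuclideanSpace.single j 1))

/-- The critical exponent `2^♯ = 2n / (n - 1)`. -/
def critExp (n : ℕ) : ℝ := 2 * (n : ℝ) / ((n : ℝ) - 1)

/-- `ψ ∈ L^{2^♯}(ℝⁿ, ℂᴺ)` is a weak solution of `𝒟 ψ = h(x, ψ) ψ`. -/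
def IsWeakSolution {n m : ℕ} (σ : Fin n → Matrix (Fin m) (Fin m) ℂ)
    (h : Space n → Spinor m → SpinorMatrix m) (ψ : Space n → Spinor m) : Prop :=
  MemLp ψ (ENNReal.ofReal (critExp n)) volume ∧
    ∀ φ : Space n → Spinor m, ContDiff ℝ ∞ φ → HasCompactSupport φ →
      ∫ x, inner ℂ (diracOp σ φ x) (ψ x) = ∫ x, inner ℂ (φ x) (act (h x (ψ x)) (ψ x))

/-- The exponent `min {2 / (n - 1), 1}`. -/
def holderExp (n : ℕ) : ℝ := min (2 / ((n : ℝ) - 1)) 1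

/-- The admissible functions `H` on the unit sphere of `ℂᴺ` (only the values there are used):
Hölder continuous of order `min {2 / (n - 1), 1}` and equivariant under all `𝒰(w)`, `|w| = 1`. -/
structure IsAdmissible {n m : ℕ} (σ : Fin n → Matrix (Fin m) (Fin m) ℂ)
    (H : Spinor m → SpinorMatrix m) : Prop where
  holder : ∃ C : ℝ, ∀ z z' : Spinor m, ‖z‖ = 1 → ‖z'‖ = 1 →
    opNorm (H z - H z') ≤ C * ‖z - z'‖ ^ holderExp n
  equivariant : ∀ (z : Spinor m) (w : Space n), ‖z‖ = 1 → ‖w‖ = 1 →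
    H z = inversionMatrix σ w * H (act (inversionMatrix σ w)ᴴ z) * (inversionMatrix σ w)ᴴ

/-- The nonlinearity `h(z) = |z|^{2^♯ - 2} H(z / |z|)` (it vanishes at `z = 0`). -/
def homogeneousNonlinearity (n : ℕ) {m : ℕ} (H : Spinor m → SpinorMatrix m) (z : Spinor m) :
    SpinorMatrix m :=
  (((‖z‖ ^ (critExp n - 2) : ℝ)) : ℂ) • H (((‖z‖⁻¹ : ℝ) : ℂ) • z)

end CriticalDirac

end

/-! ### Polar coordinates: radial powers on balls and on their complements. -/

noncomputable section

namespace CriticalDirac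

open Set Metric
open scoped ENNReal

/-! The equation is conformally invariant. The Kelvin transform `kelvin`, `u ↦ |x|^{1-n} 𝒰(x)
u(x/|x|²)`, preserves the `L^{2^♯}` norm and, by the equivariance of `H`, the equation. The
expansion at infinity is therefore the first order expansion at the origin of the transformed
solution, multiplied by `|x|^{1-n} 𝒰(x)`.

The argument runs on the integral equation `ψ = c K * (h(ψ)ψ)`, where `K(x) = |x|^{-n} ∑ x_j α_j`.
Testing the weak equation with smoothly truncated copies of `K` gives this form at almost every
point (`ae_eq_potential`): the small-scale mollifiers recover `ψ` at Lebesgue points, and the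
large-scale ones vanish in the limit because `ψ ∈ L^{2^♯}`. The kernel is covariant under inversion
(`kern_unitInversion_sub`), so the integral equation can be transformed pointwise away from the
origin. A single point is null, hence no removable singularity theorem is needed.

Regularity starts from `|u| ≤ C I₁(|u|^{2^♯-1})`, where `I₁` is the Riesz potential with kernel
`|x|^{1-n}`. The potential `V = |u|^{2^♯-2}` lies in `Lⁿ`, which is critical. Restricting `V` to a
high level set makes `w ↦ I₁(V w)` a contraction on two Lebesgue spaces at once
(`riesz_mul_strong_type`, from a weak type bound and Marcinkiewicz interpolation). Regularity
lifting (`lintegral_rpow_ne_top_of_le_contraction`) then yields enough integrability for boundedness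
(`bounded_of_le_riesz`), and `holder_potential` gives Hölder continuity of every order below one.

With `γ = min(2/(n-1), 1)`, the map `z ↦ h(z)z` is locally `γ`-Hölder, so `h(u)u` is Hölder of every
order `α < γ`. Its value at the origin is removed by subtracting `𝒟 w` for an explicit compactly
supported `w` that is linear near the origin. What remains is `O(|y|^α)`, and `potential_expansion`
turns this into an expansion with error `O(|x|^{1+α})`. The coefficients do not depend on `α`. -/

lemma nontrivial_space {n : ℕ} (hn : 1 ≤ n) : Nontrivial (Space n) := by
  have : NeZero n := ⟨by omega⟩
  infer_instance

lemma enorm_rpow_neg {E : Type*} [NormedAddCommGroup E] {z : E} (hz : z ≠ 0) (a : ℝ) :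
    ‖z‖ₑ ^ (-a) = ENNReal.ofReal (‖z‖ ^ (-a)) := by
  rw [← ofReal_norm, ENNReal.ofReal_rpow_of_pos (norm_pos_iff.2 hz)]

lemma ae_ne_zero {n : ℕ} (hn : 1 ≤ n) : ∀ᵐ z : Space n, z ≠ 0 := by
  have := nontrivial_space hn
  exact Measure.ae_ne volume 0

/-- The integral of a radial power over a radial set, in polar coordinates. -/
lemma setLIntegral_radial {n : ℕ} (hn : 1 ≤ n) (a : ℝ) (s : Set ℝ) (hs : MeasurableSet s)
    (hs0 : s ⊆ Ioi 0) (hint : IntegrableOn (fun r : ℝ => r ^ ((n : ℝ) - 1 - a)) s) :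
    ∫⁻ z in {z : Space n | ‖z‖ ∈ s}, ‖z‖ₑ ^ (-a) =
      ENNReal.ofReal (n * volume.real (ball (0 : Space n) 1) *
        ∫ r in s, r ^ ((n : ℝ) - 1 - a)) := by
  have := nontrivial_space hn
  have hm : MeasurableSet {z : Space n | ‖z‖ ∈ s} := measurable_norm hs
  set f : ℝ → ℝ := s.indicator (fun r => r ^ (-a)) with hf
  have hfin : Module.finrank ℝ (Space n) = n := by simp
  have key : ∀ r ∈ Ioi (0 : ℝ), r ^ (n - 1) • f r =
      s.indicator (fun r : ℝ => r ^ ((n : ℝ) - 1 - a)) r := by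
    intro r hr
    by_cases h : r ∈ s
    · simp only [hf, indicator_of_mem h, smul_eq_mul]
      rw [← Real.rpow_natCast, ← Real.rpow_add hr, Nat.cast_sub hn]
      simp [sub_eq_add_neg]
    · simp [hf, indicator_of_notMem h]
  have hi : Integrable (fun z : Space n => f ‖z‖) volume := by
    rw [integrable_fun_norm_addHaar, hfin]
    refine IntegrableOn.congr_fun ?_ (fun r hr => (key r hr).symm) measurableSet_Ioi
    exact (hint.integrable_indicator hs).integrableOn
  have hval := integral_fun_norm_addHaar (volume : Measure (Space n)) f
  rw [hfin, setIntegral_congr_fun measurableSet_Ioi key, setIntegral_indicator hs,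
    inter_eq_self_of_subset_right hs0] at hval
  have hnn : ∀ z : Space n, 0 ≤ f ‖z‖ := fun z => by
    refine indicator_nonneg (fun r hr => Real.rpow_nonneg (hs0 hr).le _) _
  rw [← lintegral_indicator hm]
  have : n * volume.real (ball (0 : Space n) 1) * ∫ r in s, r ^ ((n : ℝ) - 1 - a)
      = ∫ z : Space n, f ‖z‖ := by
    rw [hval]; simp [mul_assoc]
  rw [this, ofReal_integral_eq_lintegral_ofReal hi (Filter.Eventually.of_forall hnn)]
  refine lintegral_congr fun z => ?_
  by_cases h : ‖z‖ ∈ s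
  · have hz : z ≠ 0 := norm_pos_iff.1 (hs0 h)
    rw [indicator_of_mem (by exact h), hf, indicator_of_mem h, enorm_rpow_neg hz]
  · rw [indicator_of_notMem (by exact h), hf, indicator_of_notMem h, ENNReal.ofReal_zero]

/-- The constant is independent of `R`, so that the radius can later be chosen in terms of the level
`t` or of `‖x‖`. -/
lemma lintegral_ball_rpow {n : ℕ} (hn : 1 ≤ n) {a : ℝ} (ha : a < n) :
    ∃ C : ℝ, 0 < C ∧ ∀ R : ℝ, 0 < R →
      ∫⁻ z in ball (0 : Space n) R, ‖z‖ₑ ^ (-a) ≤ ENNReal.ofReal (C * R ^ ((n : ℝ) - a)) := by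
  have := nontrivial_space hn
  have hv : 0 < volume.real (ball (0 : Space n) 1) :=
    ENNReal.toReal_pos (measure_ball_pos _ _ one_pos).ne' measure_ball_lt_top.ne
  have hn' : (0 : ℝ) < n := by exact_mod_cast hn
  have hna : 0 < (n : ℝ) - a := by linarith
  refine ⟨n * volume.real (ball (0 : Space n) 1) * (1 / ((n : ℝ) - a)), by positivity,
    fun R hR => ?_⟩
  have hi : IntervalIntegrable (fun r : ℝ => r ^ ((n : ℝ) - 1 - a)) volume 0 R :=
    intervalIntegral.intervalIntegrable_rpow' (by linarith)
  -- Sphere and centre are null; this gives the half-open interval of radii used by the interval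
  -- integral.
  have hset : (ball (0 : Space n) R : Set (Space n)) =ᵐ[volume] {z : Space n | ‖z‖ ∈ Ioc 0 R} := by
    have h1 : ({0}ᶜ : Set (Space n)) =ᵐ[volume] univ := by
      rw [ae_eq_univ]; simp
    have h2 : (ball (0 : Space n) R : Set (Space n)) =ᵐ[volume] closedBall 0 R := by
      refine (ae_eq_of_subset_of_measure_ge ball_subset_closedBall ?_ measurableSet_ball.nullMeasurableSet measure_closedBall_lt_top.ne)
      rw [Measure.addHaar_closedBall_eq_addHaar_ball]
    have h3 := h2.inter h1.symm
    have e1 : {z : Space n | ‖z‖ ∈ Ioc 0 R} = closedBall 0 R ∩ {0}ᶜ := by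
      ext z; simp [and_comm]
    rw [e1]; simpa using h3
  rw [setLIntegral_congr hset, setLIntegral_radial hn a _ measurableSet_Ioc Ioc_subset_Ioi_self
    ((intervalIntegrable_iff_integrableOn_Ioc_of_le hR.le).1 hi),
    ← intervalIntegral.integral_of_le hR.le, integral_rpow (Or.inl (by linarith))]
  refine ENNReal.ofReal_le_ofReal (le_of_eq ?_)
  have : (n : ℝ) - 1 - a + 1 = n - a := by ring
  rw [this, Real.zero_rpow hna.ne']
  ring

lemma lintegral_compl_ball_rpow {n : ℕ} (hn : 1 ≤ n) {a : ℝ} (ha : (n : ℝ) < a) :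
    ∃ C : ℝ, 0 < C ∧ ∀ R : ℝ, 0 < R →
      ∫⁻ z in (ball (0 : Space n) R)ᶜ, ‖z‖ₑ ^ (-a) ≤ ENNReal.ofReal (C * R ^ ((n : ℝ) - a)) := by
  have := nontrivial_space hn
  have hv : 0 < volume.real (ball (0 : Space n) 1) :=
    ENNReal.toReal_pos (measure_ball_pos _ _ one_pos).ne' measure_ball_lt_top.ne
  have hn' : (0 : ℝ) < n := by exact_mod_cast hn
  have hna : 0 < a - n := by linarith
  refine ⟨n * volume.real (ball (0 : Space n) 1) * (1 / (a - n)), by positivity,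
    fun R hR => ?_⟩
  have hi : IntegrableOn (fun r : ℝ => r ^ ((n : ℝ) - 1 - a)) (Ioi R) :=
    integrableOn_Ioi_rpow_of_lt (by linarith) hR
  have hset : ((ball (0 : Space n) R)ᶜ : Set (Space n)) = {z : Space n | ‖z‖ ∈ Ici R} := by
    ext z; simp
  rw [hset, setLIntegral_radial hn a _ measurableSet_Ici (fun r hr => lt_of_lt_of_le hR hr)
    ((integrableOn_Ici_iff_integrableOn_Ioi (by simp)).2 hi), integral_Ici_eq_integral_Ioi,
    integral_Ioi_rpow_of_lt (by linarith) hR]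
  refine ENNReal.ofReal_le_ofReal (le_of_eq ?_)
  have : (n : ℝ) - 1 - a + 1 = n - a := by ring
  have h2 : (n : ℝ) - a ≠ 0 := by linarith
  have h3 : a - (n : ℝ) ≠ 0 := hna.ne'
  rw [this]
  field_simp
  ring

end CriticalDirac

end

/-! ### Marcinkiewicz interpolation. -/

noncomputable section

namespace CriticalDirac

open Set Metric
open scoped ENNReal

section Marcinkiewicz

/-- The layer-cake integral in the level `t`. Infinite `y` is included because the functions to be
interpolated may take the value `⊤`. -/
lemma lintegral_rpow_below {c : ℝ} (hc : 0 < c) (y : ℝ≥0∞) :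
    ∫⁻ t in Ioi (0 : ℝ), (if ENNReal.ofReal t < y then ENNReal.ofReal (t ^ (c - 1)) else 0) =
      ENNReal.ofReal (1 / c) * y ^ c := by
  have fin : ∀ a : ℝ, 0 ≤ a → ∫⁻ t in Ioo (0 : ℝ) a, ENNReal.ofReal (t ^ (c - 1)) =
      ENNReal.ofReal (1 / c) * ENNReal.ofReal a ^ c := by
    intro a ha
    have hi : IntervalIntegrable (fun t : ℝ => t ^ (c - 1)) volume 0 a :=
      intervalIntegral.intervalIntegrable_rpow' (by linarith)
    rw [setLIntegral_congr Ioo_ae_eq_Ioc, ← ofReal_integral_eq_lintegral_ofReal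
      ((intervalIntegrable_iff_integrableOn_Ioc_of_le ha).1 hi),
      ← intervalIntegral.integral_of_le ha, integral_rpow (Or.inl (by linarith)),
      ENNReal.ofReal_rpow_of_nonneg ha hc.le, ← ENNReal.ofReal_mul (by positivity)]
    · congr 1
      rw [sub_add_cancel, Real.zero_rpow hc.ne']
      ring
    · filter_upwards [ae_restrict_mem measurableSet_Ioc] with t ht
      exact Real.rpow_nonneg ht.1.le _
  have ind : ∀ s : Set ℝ, MeasurableSet s → s ⊆ Ioi 0 → ∫⁻ t in Ioi (0 : ℝ),
      s.indicator (fun t => ENNReal.ofReal (t ^ (c - 1))) t =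
      ∫⁻ t in s, ENNReal.ofReal (t ^ (c - 1)) := by
    intro s hs hs0
    rw [setLIntegral_indicator hs, inter_eq_self_of_subset_left hs0]
  rcases eq_or_ne y ⊤ with rfl | hy
  · rw [ENNReal.top_rpow_of_pos hc, ENNReal.mul_top (by simpa using hc)]
    simp only [ENNReal.ofReal_lt_top, if_true]
    refine ENNReal.eq_top_of_forall_nnreal_le fun r => ?_
    -- Chosen so that the integral over `(0, a)` is exactly `r`; hence the full integral exceeds
    -- every `r`.
    set a : ℝ := (c * r) ^ (1 / c) with ha
    have ha0 : 0 ≤ a := Real.rpow_nonneg (by positivity) _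
    calc (r : ℝ≥0∞) = ENNReal.ofReal (1 / c) * ENNReal.ofReal a ^ c := by
          rw [ENNReal.ofReal_rpow_of_nonneg ha0 hc.le, ← ENNReal.ofReal_mul (by positivity), ha,
            ← Real.rpow_mul (by positivity), one_div_mul_cancel hc.ne', Real.rpow_one]
          rw [← mul_assoc, one_div_mul_cancel hc.ne', one_mul]
          simp
      _ = _ := (fin a ha0).symm
      _ ≤ _ := lintegral_mono_set Ioo_subset_Ioi_self
  · lift y to NNReal using hy
    have := fin y y.2
    rw [ENNReal.ofReal_coe_nnreal] at this
    rw [← this, ← ind _ measurableSet_Ioo Ioo_subset_Ioi_self]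
    refine setLIntegral_congr_fun measurableSet_Ioi fun t ht => ?_
    have ht' : (0 : ℝ) < t := ht
    simp only [indicator, mem_Ioo, ht', true_and]
    congr 1
    rw [← ENNReal.ofReal_coe_nnreal, ENNReal.ofReal_lt_ofReal_iff_of_nonneg ht'.le]

lemma lintegral_rpow_above {c : ℝ} (hc : 0 < c) {y : ℝ≥0∞} (hy0 : y ≠ 0) :
    ∫⁻ t in Ioi (0 : ℝ), (if y ≤ ENNReal.ofReal t then ENNReal.ofReal (t ^ (-c - 1)) else 0) ≤
      ENNReal.ofReal (1 / c) * y ^ (-c) := by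
  rcases eq_or_ne y ⊤ with rfl | hy
  · simp
  lift y to NNReal using hy
  have hy' : (0 : ℝ) < y := by simpa [pos_iff_ne_zero] using hy0
  have hi : IntegrableOn (fun t : ℝ => t ^ (-c - 1)) (Ioi (y : ℝ)) :=
    integrableOn_Ioi_rpow_of_lt (by linarith) hy'
  calc _ ≤ ∫⁻ t in Ioi (0 : ℝ), (Ici (y : ℝ)).indicator
        (fun t => ENNReal.ofReal (t ^ (-c - 1))) t := by
        refine setLIntegral_mono_ae' measurableSet_Ioi (Filter.Eventually.of_forall fun t ht => ?_)
        have ht' : (0 : ℝ) < t := ht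
        have hiff : (y : ℝ≥0∞) ≤ ENNReal.ofReal t ↔ t ∈ Ici (y : ℝ) := by
          rw [← ENNReal.ofReal_coe_nnreal, ENNReal.ofReal_le_ofReal_iff ht'.le, mem_Ici]
        simp only [hiff, indicator]
        exact le_rfl
    _ = ∫⁻ t in Ioi (y : ℝ), ENNReal.ofReal (t ^ (-c - 1)) := by
        rw [setLIntegral_indicator measurableSet_Ici, inter_eq_self_of_subset_left
          (Ici_subset_Ioi.2 hy'), setLIntegral_congr Ioi_ae_eq_Ici.symm]
    _ = ENNReal.ofReal (1 / c) * (y : ℝ≥0∞) ^ (-c) := by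
        rw [← ofReal_integral_eq_lintegral_ofReal hi, integral_Ioi_rpow_of_lt (by linarith) hy',
          ← ENNReal.ofReal_coe_nnreal, ENNReal.ofReal_rpow_of_pos hy',
          ← ENNReal.ofReal_mul (by positivity)]
        · congr 1
          have : -c - 1 + 1 = -c := by ring
          rw [this]
          field_simp
        · filter_upwards [ae_restrict_mem measurableSet_Ioi] with t ht
          exact Real.rpow_nonneg (hy'.trans ht).le _

/-- The Marcinkiewicz interpolation theorem on the diagonal. -/
theorem marcinkiewicz {Ω : Type*} [MeasurableSpace Ω] {μ : Measure Ω} [SFinite μ]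
    {T : (Ω → ℝ≥0∞) → Ω → ℝ≥0∞} (hTm : ∀ f, Measurable f → Measurable (T f))
    (hT : ∀ f g, Measurable f → Measurable g → ∀ x, T (fun y => f y + g y) x ≤ T f x + T g x)
    {q₀ q q₁ : ℝ} (h0 : 0 < q₀) (h01 : q₀ < q) (h12 : q < q₁) {B₀ B₁ : ℝ≥0∞}
    (w0 : ∀ f, Measurable f → ∀ t : ℝ, 0 < t →
      μ {x | ENNReal.ofReal t < T f x} ≤ ENNReal.ofReal (t ^ (-q₀)) * (B₀ * ∫⁻ x, f x ^ q₀ ∂μ))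
    (w1 : ∀ f, Measurable f → ∀ t : ℝ, 0 < t →
      μ {x | ENNReal.ofReal t < T f x} ≤ ENNReal.ofReal (t ^ (-q₁)) * (B₁ * ∫⁻ x, f x ^ q₁ ∂μ))
    {f : Ω → ℝ≥0∞} (hf : Measurable f) :
    ∫⁻ x, T f x ^ q ∂μ ≤ ENNReal.ofReal q *
      (ENNReal.ofReal (2 ^ q₀) * B₀ * ENNReal.ofReal (1 / (q - q₀)) +
        ENNReal.ofReal (2 ^ q₁) * B₁ * ENNReal.ofReal (1 / (q₁ - q))) * ∫⁻ x, f x ^ q ∂μ := by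
  have hq : 0 < q := h0.trans h01
  set ν : Measure ℝ := volume.restrict (Ioi 0) with hν
  -- Layer-cake formula and Tonelli: the `q`-th moment is expressed by the measures of the level
  -- sets.
  have e1 : ∫⁻ x, T f x ^ q ∂μ = ENNReal.ofReal q *
      ∫⁻ t, ENNReal.ofReal (t ^ (q - 1)) * μ {x | ENNReal.ofReal t < T f x} ∂ν := by
    have hm : Measurable (Function.uncurry fun (x : Ω) (t : ℝ) =>
        if ENNReal.ofReal t < T f x then ENNReal.ofReal (t ^ (q - 1)) else 0) := by
      refine Measurable.ite (measurableSet_lt ?_ ?_) ?_ measurable_const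
      · exact ENNReal.measurable_ofReal.comp measurable_snd
      · exact (hTm f hf).comp measurable_fst
      · exact ENNReal.measurable_ofReal.comp (measurable_snd.pow_const _)
    calc ∫⁻ x, T f x ^ q ∂μ = ENNReal.ofReal q * ∫⁻ x, ∫⁻ t,
          (if ENNReal.ofReal t < T f x then ENNReal.ofReal (t ^ (q - 1)) else 0) ∂ν ∂μ := by
          rw [← lintegral_const_mul' _ _ ENNReal.ofReal_ne_top]
          refine lintegral_congr fun x => ?_
          rw [hν, lintegral_rpow_below hq, ← mul_assoc, ← ENNReal.ofReal_mul hq.le,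
            mul_one_div_cancel hq.ne', ENNReal.ofReal_one, one_mul]
      _ = _ := by
          rw [lintegral_lintegral_swap hm.aemeasurable]
          congr 1
          refine lintegral_congr fun t => ?_
          have : MeasurableSet {x | ENNReal.ofReal t < T f x} :=
            measurableSet_lt measurable_const (hTm f hf)
          rw [← setLIntegral_one, ← lintegral_const_mul' _ _ ENNReal.ofReal_ne_top,
            ← lintegral_indicator this]
          refine lintegral_congr fun x => ?_
          simp [indicator]
  have e2 : ∀ t ∈ Ioi (0 : ℝ), ENNReal.ofReal (t ^ (q - 1)) * μ {x | ENNReal.ofReal t < T f x} ≤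
      ENNReal.ofReal (2 ^ q₀) * B₀ * ∫⁻ x, f x ^ q₀ *
        (if ENNReal.ofReal t < f x then ENNReal.ofReal (t ^ (q - q₀ - 1)) else 0) ∂μ +
      ENNReal.ofReal (2 ^ q₁) * B₁ * ∫⁻ x, f x ^ q₁ *
        (if f x ≤ ENNReal.ofReal t then ENNReal.ofReal (t ^ (-(q₁ - q) - 1)) else 0) ∂μ := by
    intro t ht
    have ht : 0 < t := ht
    -- The splitting height is the level `t` itself: the large values of `f` are fed to the `q₀`
    -- bound, the small ones to the `q₁` bound.
    set s : Set Ω := {x | ENNReal.ofReal t < f x} with hs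
    have hsm : MeasurableSet s := measurableSet_lt measurable_const hf
    set f₁ := s.indicator f
    set f₂ := sᶜ.indicator f
    have hf1 : Measurable f₁ := hf.indicator hsm
    have hf2 : Measurable f₂ := hf.indicator hsm.compl
    have hsum : f = fun y => f₁ y + f₂ y := by
      ext y; exact (congrFun (indicator_self_add_compl s f) y).symm
    -- By subadditivity one of the two parts must exceed `t / 2`; this is the source of the factors
    -- `2 ^ q₀` and `2 ^ q₁`.
    have hsub : {x | ENNReal.ofReal t < T f x} ⊆ {x | ENNReal.ofReal (t / 2) < T f₁ x} ∪
        {x | ENNReal.ofReal (t / 2) < T f₂ x} := by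
      intro x hx
      by_contra hcon
      simp only [mem_union, mem_ofPred_eq, not_or, not_lt] at hcon hx
      have h3 := hT f₁ f₂ hf1 hf2 x
      rw [← hsum] at h3
      have h4 := h3.trans (add_le_add hcon.1 hcon.2)
      rw [← ENNReal.ofReal_add (by positivity) (by positivity), add_halves] at h4
      exact absurd hx (not_lt.2 h4)
    have powers : ∀ r : ℝ, t ^ (q - 1) * (t / 2) ^ (-r) = 2 ^ r * t ^ (q - r - 1) := by
      intro r
      rw [Real.div_rpow ht.le (by norm_num), Real.rpow_neg (by norm_num : (0:ℝ) ≤ 2), div_inv_eq_mul,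
        ← mul_assoc, ← Real.rpow_add ht, mul_comm]
      congr 2; ring
    have i1 : ∫⁻ x, f₁ x ^ q₀ ∂μ = ∫⁻ x, f x ^ q₀ * (if ENNReal.ofReal t < f x then 1 else 0) ∂μ := by
      refine lintegral_congr fun x => ?_
      by_cases hx : x ∈ s
      · simp only [f₁, indicator_of_mem hx]; rw [if_pos (show ENNReal.ofReal t < f x from hx), mul_one]
      · simp only [f₁, indicator_of_notMem hx]; rw [if_neg (show ¬ ENNReal.ofReal t < f x from hx), mul_zero, ENNReal.zero_rpow_of_pos h0]
    have i2 : ∫⁻ x, f₂ x ^ q₁ ∂μ = ∫⁻ x, f x ^ q₁ * (if f x ≤ ENNReal.ofReal t then 1 else 0) ∂μ := by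
      refine lintegral_congr fun x => ?_
      by_cases hx : x ∈ s
      · simp only [f₂, indicator_of_notMem (notMem_compl_iff.2 hx)]
        rw [if_neg (not_le.2 hx), mul_zero, ENNReal.zero_rpow_of_pos (hq.trans h12)]
      · simp only [f₂, indicator_of_mem (mem_compl hx)]; rw [if_pos (not_lt.1 hx), mul_one]
    have pull : ∀ (r c : ℝ) (p : Ω → Prop) [DecidablePred p],
        ENNReal.ofReal c * ∫⁻ x, f x ^ r * (if p x then 1 else 0) ∂μ =
          ∫⁻ x, f x ^ r * (if p x then ENNReal.ofReal c else 0) ∂μ := by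
      intro r c p _
      rw [← lintegral_const_mul' _ _ ENNReal.ofReal_ne_top]
      refine lintegral_congr fun x => ?_
      split_ifs <;> ring
    calc _ ≤ ENNReal.ofReal (t ^ (q - 1)) *
          (ENNReal.ofReal ((t / 2) ^ (-q₀)) * (B₀ * ∫⁻ x, f₁ x ^ q₀ ∂μ) +
          ENNReal.ofReal ((t / 2) ^ (-q₁)) * (B₁ * ∫⁻ x, f₂ x ^ q₁ ∂μ)) := by
          gcongr
          exact (measure_mono hsub).trans ((measure_union_le _ _).trans
            (add_le_add (w0 f₁ hf1 _ (by positivity)) (w1 f₂ hf2 _ (by positivity))))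
      _ = ENNReal.ofReal (t ^ (q - 1) * (t / 2) ^ (-q₀)) * (B₀ * ∫⁻ x, f₁ x ^ q₀ ∂μ) +
          ENNReal.ofReal (t ^ (q - 1) * (t / 2) ^ (-q₁)) * (B₁ * ∫⁻ x, f₂ x ^ q₁ ∂μ) := by
          rw [ENNReal.ofReal_mul (by positivity), ENNReal.ofReal_mul (by positivity)]; ring
      _ = _ := by
          rw [powers, powers, i1, i2, ENNReal.ofReal_mul (by positivity),
            ENNReal.ofReal_mul (by positivity), ← pull, ← pull,
            show -(q₁ - q) - 1 = q - q₁ - 1 by ring]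
          ring
  have m0 : Measurable (Function.uncurry fun (t : ℝ) (x : Ω) => f x ^ q₀ *
        (if ENNReal.ofReal t < f x then ENNReal.ofReal (t ^ (q - q₀ - 1)) else 0)) := by
    refine ((hf.comp measurable_snd).pow_const _).mul (Measurable.ite (measurableSet_lt ?_ ?_) ?_ measurable_const)
    · exact ENNReal.measurable_ofReal.comp measurable_fst
    · exact hf.comp measurable_snd
    · exact ENNReal.measurable_ofReal.comp (measurable_fst.pow_const _)
  have m1 : Measurable (Function.uncurry fun (t : ℝ) (x : Ω) => f x ^ q₁ *
        (if f x ≤ ENNReal.ofReal t then ENNReal.ofReal (t ^ (-(q₁ - q) - 1)) else 0)) := by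
    refine ((hf.comp measurable_snd).pow_const _).mul (Measurable.ite (measurableSet_le ?_ ?_) ?_ measurable_const)
    · exact hf.comp measurable_snd
    · exact ENNReal.measurable_ofReal.comp measurable_fst
    · exact ENNReal.measurable_ofReal.comp (measurable_fst.pow_const _)
  -- After exchanging the integrals the `t`-integral runs over `t < f x` and converges at zero
  -- because `q₀ < q`; `s1` is the mirror image, with convergence at infinity because `q < q₁`.
  have s0 : ∫⁻ t, ∫⁻ x, f x ^ q₀ * (if ENNReal.ofReal t < f x then
      ENNReal.ofReal (t ^ (q - q₀ - 1)) else 0) ∂μ ∂ν ≤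
      ENNReal.ofReal (1 / (q - q₀)) * ∫⁻ x, f x ^ q ∂μ := by
    rw [lintegral_lintegral_swap m0.aemeasurable, ← lintegral_const_mul' _ _ ENNReal.ofReal_ne_top]
    refine lintegral_mono fun x => ?_
    have mm : Measurable fun t : ℝ => (if ENNReal.ofReal t < f x then
        ENNReal.ofReal (t ^ (q - q₀ - 1)) else 0) :=
      Measurable.ite (measurableSet_lt ENNReal.measurable_ofReal measurable_const)
        (ENNReal.measurable_ofReal.comp (measurable_id.pow_const _)) measurable_const
    rw [lintegral_const_mul _ mm, hν, lintegral_rpow_below (by linarith)]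
    rw [mul_left_comm, ← ENNReal.rpow_add_of_nonneg _ _ h0.le (by linarith)]
    simp
  have s1 : ∫⁻ t, ∫⁻ x, f x ^ q₁ * (if f x ≤ ENNReal.ofReal t then
      ENNReal.ofReal (t ^ (-(q₁ - q) - 1)) else 0) ∂μ ∂ν ≤
      ENNReal.ofReal (1 / (q₁ - q)) * ∫⁻ x, f x ^ q ∂μ := by
    rw [lintegral_lintegral_swap m1.aemeasurable, ← lintegral_const_mul' _ _ ENNReal.ofReal_ne_top]
    refine lintegral_mono fun x => ?_
    have mm : Measurable fun t : ℝ => (if f x ≤ ENNReal.ofReal t then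
        ENNReal.ofReal (t ^ (-(q₁ - q) - 1)) else 0) :=
      Measurable.ite (measurableSet_le measurable_const ENNReal.measurable_ofReal)
        (ENNReal.measurable_ofReal.comp (measurable_id.pow_const _)) measurable_const
    rw [lintegral_const_mul _ mm]
    -- The exponents added below have opposite signs, so `0` and `⊤` have to be treated apart.
    rcases eq_or_ne (f x) 0 with h | h
    · rw [h, ENNReal.zero_rpow_of_pos (hq.trans h12)]; simp
    rcases eq_or_ne (f x) ⊤ with h' | h'
    · rw [h', ENNReal.top_rpow_of_pos hq, ENNReal.mul_top (by simpa using h12)]; exact le_top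
    calc _ ≤ f x ^ q₁ * (ENNReal.ofReal (1 / (q₁ - q)) * f x ^ (-(q₁ - q))) := by
          gcongr; exact lintegral_rpow_above (by linarith) h
      _ = _ := by
          rw [mul_left_comm, ← ENNReal.rpow_add _ _ h h']
          congr 2; ring
  calc _ ≤ ENNReal.ofReal q * (ENNReal.ofReal (2 ^ q₀) * B₀ * ∫⁻ t, ∫⁻ x, f x ^ q₀ *
        (if ENNReal.ofReal t < f x then ENNReal.ofReal (t ^ (q - q₀ - 1)) else 0) ∂μ ∂ν +
      ENNReal.ofReal (2 ^ q₁) * B₁ * ∫⁻ t, ∫⁻ x, f x ^ q₁ *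
        (if f x ≤ ENNReal.ofReal t then ENNReal.ofReal (t ^ (-(q₁ - q) - 1)) else 0) ∂μ ∂ν) := by
        rw [e1]
        gcongr
        refine (setLIntegral_mono_ae' measurableSet_Ioi (Filter.Eventually.of_forall e2)).trans ?_
        have n0 := m0.lintegral_prod_right' (ν := μ)
        have n1 := m1.lintegral_prod_right' (ν := μ)
        simp only [Function.uncurry] at n0 n1
        rw [lintegral_add_left (n0.const_mul _), lintegral_const_mul _ n0,
          lintegral_const_mul _ n1]
    _ ≤ ENNReal.ofReal q * (ENNReal.ofReal (2 ^ q₀) * B₀ *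
          (ENNReal.ofReal (1 / (q - q₀)) * ∫⁻ x, f x ^ q ∂μ) + ENNReal.ofReal (2 ^ q₁) * B₁ *
          (ENNReal.ofReal (1 / (q₁ - q)) * ∫⁻ x, f x ^ q ∂μ)) := by gcongr
    _ = _ := by ring

end Marcinkiewicz

end CriticalDirac

end

/-! ### Convolution inequalities and the weak type bound for Riesz potentials. -/

noncomputable section

namespace CriticalDirac

open Set Metric
open scoped ENNReal

variable {n : ℕ}

lemma lintegral_conv_le_holder {K f : Space n → ℝ≥0∞} (hK : Measurable K) (hf : Measurable f)
    {r r' : ℝ} (hr : r.HolderConjugate r') (x : Space n) :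
    ∫⁻ y, K (x - y) * f y ≤ (∫⁻ z, K z ^ r') ^ (1 / r') * (∫⁻ y, f y ^ r) ^ (1 / r) := by
  have h := ENNReal.lintegral_mul_le_Lp_mul_Lq volume hr.symm
    (hK.comp (measurable_const.sub measurable_id) : Measurable fun y => K (x - y)).aemeasurable
    hf.aemeasurable
  refine h.trans (le_of_eq ?_)
  congr 2
  exact lintegral_sub_left_eq_self (fun z => K z ^ r') x

/-- Young's inequality `L¹ * L^r ⊆ L^r`. -/
lemma lintegral_conv_rpow_le {K f : Space n → ℝ≥0∞} (hK : Measurable K) (hf : Measurable f)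
    {r : ℝ} (hr : 1 < r) :
    ∫⁻ x, (∫⁻ y, K (x - y) * f y) ^ r ≤ (∫⁻ z, K z) ^ r * ∫⁻ y, f y ^ r := by
  set r' := r.conjExponent with hr'
  have hc : r.HolderConjugate r' := Real.HolderConjugate.conjExponent hr
  have hr0 : 0 < r := hc.pos
  have hr'0 : 0 < r' := hc.symm.pos
  have hinv : 1 / r' + 1 / r = 1 := by
    have := hc.inv_add_inv_eq_one; simp only [one_div]; linarith
  have hexp : 1 / r' * r = r - 1 := by
    have : 1 / r' = 1 - 1 / r := by linarith
    rw [this]; field_simp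
  have hKx : ∀ x, Measurable fun y => K (x - y) := fun x =>
    hK.comp (measurable_const.sub measurable_id)
  have pt : ∀ x, (∫⁻ y, K (x - y) * f y) ^ r ≤
      (∫⁻ z, K z) ^ (r - 1) * ∫⁻ y, K (x - y) * f y ^ r := by
    intro x
    -- Hölder's inequality with `K = K^{1/r'} K^{1/r}`, that is, with respect to the measure `K(x -
    -- y) dy`.
    have h := ENNReal.lintegral_mul_le_Lp_mul_Lq volume hc.symm
      ((hKx x).pow_const (1 / r')).aemeasurable
      (((hKx x).pow_const (1 / r)).mul hf).aemeasurable
    have e1 : ∀ y, ((fun y => K (x - y) ^ (1 / r')) * fun y => K (x - y) ^ (1 / r) * f y) y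
        = K (x - y) * f y := by
      intro y
      simp only [Pi.mul_apply]
      rw [← mul_assoc, ← ENNReal.rpow_add_of_nonneg _ _ (by positivity) (by positivity), hinv,
        ENNReal.rpow_one]
    have e2 : ∀ y, (K (x - y) ^ (1 / r')) ^ r' = K (x - y) := fun y => by
      rw [← ENNReal.rpow_mul, one_div_mul_cancel hr'0.ne', ENNReal.rpow_one]
    have e3 : ∀ y, (K (x - y) ^ (1 / r) * f y) ^ r = K (x - y) * f y ^ r := fun y => by
      rw [ENNReal.mul_rpow_of_nonneg _ _ hr0.le, ← ENNReal.rpow_mul, one_div_mul_cancel hr0.ne',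
        ENNReal.rpow_one]
    simp only [e2, Pi.mul_apply] at h
    simp only [e3] at h
    rw [lintegral_congr (fun y => (e1 y).symm)]
    calc _ ≤ ((∫⁻ y, K (x - y)) ^ (1 / r') * (∫⁻ y, K (x - y) * f y ^ r) ^ (1 / r)) ^ r := by
          gcongr; exact h
      _ = _ := by
          rw [ENNReal.mul_rpow_of_nonneg _ _ hr0.le, ← ENNReal.rpow_mul, ← ENNReal.rpow_mul,
            one_div_mul_cancel hr0.ne', ENNReal.rpow_one, hexp, lintegral_sub_left_eq_self]
  have hm : Measurable (Function.uncurry fun x y : Space n => K (x - y) * f y ^ r) :=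
    (hK.comp (measurable_fst.sub measurable_snd)).mul ((hf.comp measurable_snd).pow_const _)
  calc _ ≤ ∫⁻ x, (∫⁻ z, K z) ^ (r - 1) * ∫⁻ y, K (x - y) * f y ^ r := lintegral_mono pt
    _ = (∫⁻ z, K z) ^ (r - 1) * ∫⁻ y, ∫⁻ x, K (x - y) * f y ^ r := by
        have hm' := hm.lintegral_prod_right' (ν := volume)
        simp only [Function.uncurry] at hm'
        rw [lintegral_const_mul _ hm', lintegral_lintegral_swap hm.aemeasurable]
    _ = (∫⁻ z, K z) ^ (r - 1) * ((∫⁻ z, K z) * ∫⁻ y, f y ^ r) := by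
        congr 1
        rw [← lintegral_const_mul _ (hf.pow_const _)]
        refine lintegral_congr fun y => ?_
        have hKy : Measurable fun x => K (x - y) := hK.comp (measurable_id.sub measurable_const)
        rw [lintegral_mul_const _ hKy, lintegral_sub_right_eq_self]
    _ = _ := by
        rw [← mul_assoc]
        congr 1
        conv_lhs => rw [← ENNReal.rpow_one (∫⁻ z, K z)]
        rw [← ENNReal.rpow_mul, one_mul, ← ENNReal.rpow_add_of_nonneg _ _ (by linarith) zero_le_one,
          sub_add_cancel]

/-- The Riesz potential of order `n - a`, up to normalization. -/
def riesz (a : ℝ) (f : Space n → ℝ≥0∞) (x : Space n) : ℝ≥0∞ := ∫⁻ y, ‖x - y‖ₑ ^ (-a) * f y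

lemma measurable_enorm_rpow (a : ℝ) : Measurable fun z : Space n => ‖z‖ₑ ^ a :=
  measurable_enorm.pow_const _

lemma measurable_riesz (a : ℝ) {f : Space n → ℝ≥0∞} (hf : Measurable f) :
    Measurable (riesz a f) := by
  have hm : Measurable (Function.uncurry fun x y : Space n => ‖x - y‖ₑ ^ (-a) * f y) :=
    ((measurable_enorm_rpow (-a)).comp (measurable_fst.sub measurable_snd)).mul
      (hf.comp measurable_snd)
  exact hm.lintegral_prod_right'

lemma measurable_riesz_integrand (a : ℝ) {f : Space n → ℝ≥0∞} (hf : Measurable f) (x : Space n) :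
    Measurable fun y : Space n => ‖x - y‖ₑ ^ (-a) * f y :=
  ((measurable_enorm_rpow (-a)).comp (measurable_const.sub measurable_id)).mul hf

lemma riesz_add (a : ℝ) {f g : Space n → ℝ≥0∞} (hf : Measurable f) (x : Space n) :
    riesz a (fun y => f y + g y) x = riesz a f x + riesz a g x := by
  simp only [riesz, mul_add]
  exact lintegral_add_left (measurable_riesz_integrand a hf x) _

lemma riesz_mono_ae (a : ℝ) {f g : Space n → ℝ≥0∞} (h : ∀ᵐ y, f y ≤ g y) (x : Space n) :
    riesz a f x ≤ riesz a g x := by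
  refine lintegral_mono_ae ?_
  filter_upwards [h] with y hy
  gcongr

/-- Splitting of a Riesz potential into a near and a far part, with Hölder's inequality for the
far part. -/
lemma riesz_le_near_add_far (a : ℝ) {f : Space n → ℝ≥0∞} (hf : Measurable f)
    {r r' : ℝ} (hr : r.HolderConjugate r') (R : ℝ) (x : Space n) :
    riesz a f x ≤ (∫⁻ y, (ball (0 : Space n) R).indicator (fun z => ‖z‖ₑ ^ (-a)) (x - y) * f y) +
      (∫⁻ z in (ball (0 : Space n) R)ᶜ, ‖z‖ₑ ^ (-(a * r'))) ^ (1 / r') *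
        (∫⁻ y, f y ^ r) ^ (1 / r) := by
  set K : Space n → ℝ≥0∞ := fun z => ‖z‖ₑ ^ (-a)
  set s := ball (0 : Space n) R
  have hK : Measurable K := measurable_enorm_rpow _
  have hs : MeasurableSet s := measurableSet_ball
  have hm : Measurable fun y => s.indicator K (x - y) * f y :=
    ((hK.indicator hs).comp (measurable_const.sub measurable_id)).mul hf
  have e : riesz a f x = (∫⁻ y, s.indicator K (x - y) * f y) +
      ∫⁻ y, sᶜ.indicator K (x - y) * f y := by
    rw [← lintegral_add_left hm]
    refine lintegral_congr fun y => ?_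
    rw [← add_mul]
    congr 1
    exact (congrFun (indicator_self_add_compl s K) (x - y)).symm
  rw [e]
  gcongr
  refine (lintegral_conv_le_holder (hK.indicator hs.compl) hf hr x).trans (le_of_eq ?_)
  congr 2
  rw [← lintegral_indicator hs.compl]
  refine lintegral_congr fun z => ?_
  by_cases hz : z ∈ sᶜ
  · simp only [indicator_of_mem hz, K]
    rw [← ENNReal.rpow_mul, neg_mul]
  · simp only [indicator_of_notMem hz]
    rw [ENNReal.zero_rpow_of_pos hr.symm.pos]

/-- The weak type estimate `L^r → L^{q,∞}`, `1/q = 1/r - 1/n`, for the Riesz potential of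
order one. -/
lemma riesz_weak_type (hn : 1 ≤ n) {r q : ℝ} (hr : 1 < r) (hrn : r < n)
    (hq : 1 / q = 1 / r - 1 / n) :
    ∃ C : ℝ, 0 < C ∧ ∀ f : Space n → ℝ≥0∞, Measurable f → ∀ t : ℝ, 0 < t →
      volume {x | ENNReal.ofReal t < riesz ((n : ℝ) - 1) f x} ≤
        ENNReal.ofReal (t ^ (-q)) * (ENNReal.ofReal C * (∫⁻ y, f y ^ r) ^ (q / r)) := by
  have hn0 : (0 : ℝ) < n := by exact_mod_cast hn
  have hr0 : 0 < r := by linarith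
  have hq0 : 0 < q := by
    rw [← one_div_pos, hq]; exact sub_pos.2 (one_div_lt_one_div_of_lt hr0 hrn)
  set r' := r.conjExponent with hr'
  have hc : r.HolderConjugate r' := Real.HolderConjugate.conjExponent hr
  have hr'0 : 0 < r' := hc.symm.pos
  have hinv : 1 / r' = 1 - 1 / r := by
    have := hc.inv_add_inv_eq_one; simp only [one_div]; linarith
  -- The assumption `r < n` amounts to `L^{r'}` integrability at infinity of the kernel `|z|^{1-n}`.
  have hfar : (n : ℝ) < ((n : ℝ) - 1) * r' := by
    have h1 : 1 / r' < 1 - 1 / n := by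
      rw [hinv]; have := one_div_lt_one_div_of_lt hr0 hrn; linarith
    have h2 := mul_lt_mul_of_pos_left h1 hr'0
    rw [mul_one_div_cancel hr'0.ne'] at h2
    have h3 := mul_lt_mul_of_pos_left h2 hn0
    calc (n : ℝ) = n * 1 := by ring
      _ < n * (r' * (1 - 1 / n)) := h3
      _ = _ := by field_simp
  obtain ⟨c₁, hc1, near⟩ := lintegral_ball_rpow hn (a := (n : ℝ) - 1) (by linarith)
  obtain ⟨c₂, hc2, far⟩ := lintegral_compl_ball_rpow hn hfar
  set d := c₂ ^ (1 / r') with hd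
  have hd0 : 0 < d := Real.rpow_pos_of_pos hc2 _
  refine ⟨2 ^ r * c₁ ^ r * (2 * d) ^ (q * r / n), by positivity, fun f hf t ht => ?_⟩
  -- The degenerate norms `0` and `⊤` are settled first, since the radius `R` below is built from a
  -- positive real norm.
  rcases eq_or_ne (∫⁻ y, f y ^ r) 0 with h0 | h0
  · have hz : ∀ᵐ y, f y = 0 := by
      rw [lintegral_eq_zero_iff (hf.pow_const _)] at h0
      filter_upwards [h0] with y hy
      simpa [hr0, hr0.le, not_lt.2 hr0.le] using hy
    have : {x | ENNReal.ofReal t < riesz ((n : ℝ) - 1) f x} = ∅ := by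
      ext x
      have : riesz ((n : ℝ) - 1) f x = 0 := by
        rw [riesz, lintegral_eq_zero_iff (measurable_riesz_integrand _ hf x)]
        filter_upwards [hz] with y hy
        simp [hy]
      simp [this]
    rw [this]; simp
  rcases eq_or_ne (∫⁻ y, f y ^ r) ⊤ with htop | htop
  · rw [htop, ENNReal.top_rpow_of_pos (by positivity), ENNReal.mul_top, ENNReal.mul_top]
    · exact le_top
    · simpa using Real.rpow_pos_of_pos ht _
    · have : 0 < 2 ^ r * c₁ ^ r * (2 * d) ^ (q * r / n) := by positivity
      simpa using this
  set A := (∫⁻ y, f y ^ r).toReal with hA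
  have hA0 : 0 < A := ENNReal.toReal_pos h0 htop
  have hAeq : ∫⁻ y, f y ^ r = ENNReal.ofReal A := (ENNReal.ofReal_toReal htop).symm
  set F := A ^ (1 / r) with hF
  have hF0 : 0 < F := Real.rpow_pos_of_pos hA0 _
  -- The far part is at most `d F R^{-n/q}`; this radius makes that bound equal to `t / 2`.
  set R := (2 * d * F / t) ^ (q / n) with hR
  have hR0 : 0 < R := by positivity
  have farb : (∫⁻ z in (ball (0 : Space n) R)ᶜ, ‖z‖ₑ ^ (-(((n : ℝ) - 1) * r'))) ^ (1 / r') *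
        (∫⁻ y, f y ^ r) ^ (1 / r) ≤ ENNReal.ofReal (t / 2) := by
    calc _ ≤ (ENNReal.ofReal (c₂ * R ^ ((n : ℝ) - ((n : ℝ) - 1) * r'))) ^ (1 / r') *
          (ENNReal.ofReal A) ^ (1 / r) := by
          rw [hAeq]; gcongr; exact far R hR0
      _ = ENNReal.ofReal ((c₂ * R ^ ((n : ℝ) - ((n : ℝ) - 1) * r')) ^ (1 / r') * F) := by
          rw [ENNReal.ofReal_rpow_of_pos (by positivity), ENNReal.ofReal_rpow_of_pos hA0,
            ENNReal.ofReal_mul (by positivity)]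
      _ = _ := by
          congr 1
          rw [Real.mul_rpow hc2.le (by positivity), ← hd, hR, ← Real.rpow_mul (by positivity),
            ← Real.rpow_mul (by positivity)]
          have : q / n * (((n : ℝ) - ((n : ℝ) - 1) * r') * (1 / r')) = -1 := by
            have e1 : ((n : ℝ) - ((n : ℝ) - 1) * r') * (1 / r') = n * (1 / r') - ((n : ℝ) - 1) := by
              field_simp
            rw [e1, hinv]
            have e2 : 1 / r = 1 / q + 1 / n := by linarith
            rw [e2]; field_simp; ring
          rw [this, Real.rpow_neg_one]
          field_simp
  set K₁ : Space n → ℝ≥0∞ := (ball (0 : Space n) R).indicator (fun z => ‖z‖ₑ ^ (-((n : ℝ) - 1)))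
  have hK1 : Measurable K₁ := (measurable_enorm_rpow _).indicator measurableSet_ball
  have hK1i : ∫⁻ z, K₁ z ≤ ENNReal.ofReal (c₁ * R) := by
    rw [lintegral_indicator measurableSet_ball]
    have := near R hR0
    rwa [sub_sub_cancel, Real.rpow_one] at this
  -- The far part never exceeds `t / 2`, so only the near part counts; it is estimated by
  -- Chebyshev's inequality in `L^r` and Young's inequality.
  have hsub : {x | ENNReal.ofReal t < riesz ((n : ℝ) - 1) f x} ⊆
      {x | ENNReal.ofReal (t / 2) ^ r ≤ (∫⁻ y, K₁ (x - y) * f y) ^ r} := by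
    intro x hx
    simp only [mem_ofPred_eq] at hx ⊢
    by_contra hcon
    have h1 : ∫⁻ y, K₁ (x - y) * f y ≤ ENNReal.ofReal (t / 2) := by
      by_contra h; exact hcon (ENNReal.rpow_le_rpow (not_le.1 h).le hr0.le)
    have h2 := (riesz_le_near_add_far ((n : ℝ) - 1) hf hc R x).trans (add_le_add h1 farb)
    rw [← ENNReal.ofReal_add (by positivity) (by positivity), add_halves] at h2
    exact absurd hx (not_lt.2 h2)
  have hmc : Measurable fun x => (∫⁻ y, K₁ (x - y) * f y) ^ r := by
    have hm : Measurable (Function.uncurry fun x y : Space n => K₁ (x - y) * f y) :=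
      (hK1.comp (measurable_fst.sub measurable_snd)).mul (hf.comp measurable_snd)
    exact hm.lintegral_prod_right'.pow_const _
  have ht2 : ENNReal.ofReal (t / 2) ^ r = ENNReal.ofReal ((t / 2) ^ r) :=
    ENNReal.ofReal_rpow_of_pos (by positivity)
  calc _ ≤ volume {x | ENNReal.ofReal (t / 2) ^ r ≤ (∫⁻ y, K₁ (x - y) * f y) ^ r} :=
        measure_mono hsub
    _ ≤ (∫⁻ x, (∫⁻ y, K₁ (x - y) * f y) ^ r) / ENNReal.ofReal (t / 2) ^ r := by
        refine meas_ge_le_lintegral_div hmc.aemeasurable ?_ ?_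
        · rw [ht2]; simpa using (by positivity : 0 < (t / 2) ^ r)
        · rw [ht2]; exact ENNReal.ofReal_ne_top
    _ ≤ (ENNReal.ofReal (c₁ * R) ^ r * ENNReal.ofReal A) / ENNReal.ofReal (t / 2) ^ r := by
        gcongr
        refine (lintegral_conv_rpow_le hK1 hf hr).trans ?_
        rw [hAeq]; gcongr
    _ = ENNReal.ofReal ((c₁ * R) ^ r * A / (t / 2) ^ r) := by
        rw [ht2, ENNReal.ofReal_rpow_of_pos (by positivity), ← ENNReal.ofReal_mul (by positivity),
          ENNReal.ofReal_div_of_pos (by positivity)]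
    _ = ENNReal.ofReal (t ^ (-q) * (2 ^ r * c₁ ^ r * (2 * d) ^ (q * r / n) * A ^ (q / r))) := by
        congr 1
        have hexp : r + q * r / n = q := by
          have : 1 / r = 1 / q + 1 / n := by linarith
          field_simp at this ⊢; linarith
        have hFr : F ^ (q * r / n) = A ^ (q / n) := by
          rw [hF, ← Real.rpow_mul hA0.le]; congr 1; field_simp
        have hAe : A ^ (q / r) = A ^ (q / n) * A := by
          rw [← Real.rpow_add_one hA0.ne']; congr 1
          have : 1 / r = 1 / q + 1 / n := by linarith
          rw [div_eq_mul_one_div, this]; field_simp; ring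
        have hte : t ^ (-q) = (t ^ r)⁻¹ * (t ^ (q * r / n))⁻¹ := by
          rw [← Real.rpow_neg ht.le, ← Real.rpow_neg ht.le, ← Real.rpow_add ht]
          congr 1; linarith
        rw [Real.mul_rpow hc1.le hR0.le, hR, ← Real.rpow_mul (by positivity),
          show q / n * r = q * r / n by ring, Real.div_rpow (by positivity) ht.le,
          Real.mul_rpow (by positivity) hF0.le, hFr, hAe, hte, Real.div_rpow ht.le (by norm_num)]
        field_simp
    _ = _ := by
        rw [hAeq, ENNReal.ofReal_rpow_of_pos hA0, ← ENNReal.ofReal_mul (by positivity),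
          ← ENNReal.ofReal_mul (by positivity)]

end CriticalDirac

end

/-! ### Strong type bounds with a potential in `Lⁿ`, and regularity lifting. -/

noncomputable section

namespace CriticalDirac

open Set Metric Filter Topology
open scoped ENNReal

variable {n : ℕ}

/-- Multiplication by `V ∈ Lⁿ` loses exactly the integrability that the Riesz potential gains: `V w
∈ L^r` with `1/r = 1/n + 1/q`. For fixed `V` the operator in `w` is thus of diagonal weak type, as
interpolation requires; the hypothesis on `q` says `r > 1`. -/
lemma riesz_mul_weak_type (hn : 2 ≤ n) {q : ℝ} (hq0 : 0 < q) (hq : 1 / q + 1 / n < 1) :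
    ∃ C : ℝ, 0 < C ∧ ∀ V w : Space n → ℝ≥0∞, Measurable V → Measurable w → ∀ t : ℝ, 0 < t →
      volume {x | ENNReal.ofReal t < riesz ((n : ℝ) - 1) (fun y => V y * w y) x} ≤
        ENNReal.ofReal (t ^ (-q)) *
          (ENNReal.ofReal C * (∫⁻ y, V y ^ (n : ℝ)) ^ (q / n) * ∫⁻ y, w y ^ q) := by
  have hn0 : (0 : ℝ) < n := by exact_mod_cast (by omega : 0 < n)
  set r := (1 / q + 1 / n)⁻¹ with hr
  have hpos : 0 < 1 / q + 1 / (n : ℝ) := by positivity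
  have hr0 : 0 < r := inv_pos.2 hpos
  have hr1 : 1 < r := (one_lt_inv₀ hpos).2 hq
  have hrinv : 1 / r = 1 / n + 1 / q := by rw [hr, one_div, inv_inv, add_comm]
  have hrn : r < n := by
    rw [hr, inv_lt_comm₀ hpos hn0, ← one_div]
    have : 0 < 1 / q := by positivity
    linarith
  obtain ⟨C, hC, H⟩ := riesz_weak_type (by omega) hr1 hrn (q := q) (by linarith)
  refine ⟨C, hC, fun V w hV hw t ht => (H _ (hV.mul hw) t ht).trans ?_⟩
  rw [mul_assoc (ENNReal.ofReal C)]
  gcongr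
  have h := ENNReal.lintegral_Lp_mul_le_Lq_mul_Lr hr0 hrn hrinv volume hV.aemeasurable
    hw.aemeasurable
  simp only [Pi.mul_apply] at h
  calc _ = ((∫⁻ y, (V y * w y) ^ r) ^ (1 / r)) ^ q := by
        rw [← ENNReal.rpow_mul]; congr 1; ring
    _ ≤ ((∫⁻ y, V y ^ (n : ℝ)) ^ (1 / (n : ℝ)) * (∫⁻ y, w y ^ q) ^ (1 / q)) ^ q := by gcongr
    _ = _ := by
        rw [ENNReal.mul_rpow_of_nonneg _ _ hq0.le, ← ENNReal.rpow_mul, ← ENNReal.rpow_mul,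
          one_div_mul_cancel hq0.ne', ENNReal.rpow_one]
        congr 2; ring

/-- The Hardy--Littlewood--Sobolev inequality for `w ↦ I₁ (V w)` with a potential `V ∈ Lⁿ`. -/
theorem riesz_mul_strong_type (hn : 2 ≤ n) {q : ℝ} (hq0 : 0 < q) (hq : 1 / q + 1 / n < 1) :
    ∃ Θ : ℝ≥0∞ → ℝ≥0∞, (∀ a, a ≠ ⊤ → Θ a ≠ ⊤) ∧ Tendsto Θ (𝓝 0) (𝓝 0) ∧
      ∀ V w : Space n → ℝ≥0∞, Measurable V → Measurable w →
        ∫⁻ x, riesz ((n : ℝ) - 1) (fun y => V y * w y) x ^ q ≤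
          Θ (∫⁻ y, V y ^ (n : ℝ)) * ∫⁻ y, w y ^ q := by
  have hn0 : (0 : ℝ) < n := by exact_mod_cast (by omega : 0 < n)
  have hn1 : (0 : ℝ) < 1 - 1 / n := by
    have : 0 < 1 / q := by positivity
    linarith
  -- The weak type bound holds for all exponents above `a`; interpolation uses one exponent between
  -- `a` and `q`, and `q + 1`.
  set a := (1 - 1 / (n : ℝ))⁻¹ with ha
  have ha0 : 0 < a := inv_pos.2 hn1
  have haq : a < q := by
    rw [ha, inv_lt_comm₀ hn1 hq0, ← one_div]; linarith
  set q₀ := (a + q) / 2 with hq0'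
  have h1 : a < q₀ := by rw [hq0']; linarith
  have h2 : q₀ < q := by rw [hq0']; linarith
  have hq00 : 0 < q₀ := ha0.trans h1
  have cond : ∀ b, a < b → 1 / b + 1 / (n : ℝ) < 1 := by
    intro b hb
    have h3 : 1 / b < 1 / a := one_div_lt_one_div_of_lt ha0 hb
    have h4 : 1 / a = 1 - 1 / n := by rw [ha, one_div, inv_inv]
    linarith
  have h3 : q < q + 1 := by linarith
  obtain ⟨C₀, hC0, W0⟩ := riesz_mul_weak_type hn hq00 (cond q₀ h1)
  obtain ⟨C₁, hC1, W1⟩ := riesz_mul_weak_type hn (by linarith : 0 < q + 1) (cond (q + 1) (by linarith))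
  -- The Marcinkiewicz constant as a function of `b = ∫ Vⁿ`: only positive powers of `b` occur, so
  -- it is finite for finite `b` and tends to zero with `b`.
  refine ⟨fun b => ENNReal.ofReal q *
      (ENNReal.ofReal (2 ^ q₀) * (ENNReal.ofReal C₀ * b ^ (q₀ / n)) * ENNReal.ofReal (1 / (q - q₀)) +
        ENNReal.ofReal (2 ^ (q + 1)) * (ENNReal.ofReal C₁ * b ^ ((q + 1) / n)) *
          ENNReal.ofReal (1 / (q + 1 - q))), fun b hb => ?_, ?_, fun V w hV hw => ?_⟩
  · have e0 : b ^ (q₀ / n) ≠ ⊤ := ENNReal.rpow_ne_top_of_nonneg (by positivity) hb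
    have e1 : b ^ ((q + 1) / n) ≠ ⊤ := ENNReal.rpow_ne_top_of_nonneg (by positivity) hb
    finiteness
  · have p : ∀ c : ℝ, 0 < c → Tendsto (fun b : ℝ≥0∞ => b ^ c) (𝓝 0) (𝓝 0) := by
      intro c hc
      have := (ENNReal.continuous_rpow_const (y := c)).tendsto 0
      rwa [ENNReal.zero_rpow_of_pos hc] at this
    have m : ∀ (c : ℝ≥0∞) (f : ℝ≥0∞ → ℝ≥0∞), c ≠ ⊤ → Tendsto f (𝓝 0) (𝓝 0) →
        Tendsto (fun b => c * f b) (𝓝 0) (𝓝 0) := by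
      intro c f hc hf
      have := ENNReal.Tendsto.const_mul hf (Or.inr hc)
      rwa [mul_zero] at this
    have m' : ∀ (c : ℝ≥0∞) (f : ℝ≥0∞ → ℝ≥0∞), c ≠ ⊤ → Tendsto f (𝓝 0) (𝓝 0) →
        Tendsto (fun b => f b * c) (𝓝 0) (𝓝 0) := by
      intro c f hc hf
      simpa only [mul_comm] using m c f hc hf
    refine m _ _ ENNReal.ofReal_ne_top ?_
    rw [← add_zero (0 : ℝ≥0∞)]
    refine Tendsto.add ?_ ?_
    · rw [add_zero]
      exact m' _ _ ENNReal.ofReal_ne_top (m _ _ ENNReal.ofReal_ne_top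
        (m _ _ ENNReal.ofReal_ne_top (p _ (by positivity))))
    · rw [add_zero]
      exact m' _ _ ENNReal.ofReal_ne_top (m _ _ ENNReal.ofReal_ne_top
        (m _ _ ENNReal.ofReal_ne_top (p _ (by positivity))))
  · refine marcinkiewicz (T := fun w => riesz ((n : ℝ) - 1) (fun y => V y * w y))
      (fun f hf => measurable_riesz _ (hV.mul hf)) (fun f g hf hg x => ?_) hq00 h2 h3
      (fun f hf t ht => W0 V f hV hf t ht) (fun f hf t ht => W1 V f hV hf t ht) hw
    simp only [mul_add]
    exact (riesz_add _ (hV.mul hf) x).le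

/-- Regularity lifting: a solution of `u ≤ T u + g` inherits the integrability of `g` if `T` is a
contraction in both of the spaces. -/
lemma lintegral_rpow_ne_top_of_le_contraction {Ω : Type*} [MeasurableSpace Ω] {μ : Measure Ω}
    {T : (Ω → ℝ≥0∞) → Ω → ℝ≥0∞} (hTm : ∀ f, Measurable f → Measurable (T f))
    (hTadd : ∀ f g, Measurable f → Measurable g → ∀ x, T (fun y => f y + g y) x ≤ T f x + T g x)
    (hTmono : ∀ f g, (∀ᵐ y ∂μ, f y ≤ g y) → ∀ x, T f x ≤ T g x)
    {p q : ℝ} (hp : 0 < p) (hq : 1 ≤ q)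
    (hTp : ∀ f, Measurable f → ∫⁻ x, T f x ^ p ∂μ ≤ 2⁻¹ * ∫⁻ x, f x ^ p ∂μ)
    (hTq : ∀ f, Measurable f → ∫⁻ x, T f x ^ q ∂μ ≤ 2⁻¹ ^ q * ∫⁻ x, f x ^ q ∂μ)
    {u g : Ω → ℝ≥0∞} (hu : Measurable u) (hg : Measurable g)
    (hup : ∫⁻ x, u x ^ p ∂μ ≠ ⊤) (hgq : ∫⁻ x, g x ^ q ∂μ ≠ ⊤)
    (hle : ∀ᵐ x ∂μ, u x ≤ T u x + g x) : ∫⁻ x, u x ^ q ∂μ ≠ ⊤ := by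
  have hq0 : 0 < q := by linarith
  -- Iterating the inequality gives `u ≤ U k + S k`: the first term lives in `L^p` and dies out, the
  -- second is built from `g` alone and stays bounded in `L^q`. No integrability of `u` in `L^q` is
  -- presupposed.
  set U : ℕ → Ω → ℝ≥0∞ := fun k => T^[k] u with hU
  set S : ℕ → Ω → ℝ≥0∞ := fun k => (fun f x => T f x + g x)^[k] (fun _ => 0) with hS
  have hUs : ∀ k, U (k + 1) = T (U k) := fun k => Function.iterate_succ_apply' _ _ _
  have hSs : ∀ k, S (k + 1) = fun x => T (S k) x + g x := fun k =>
    Function.iterate_succ_apply' _ _ _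
  have hUm : ∀ k, Measurable (U k) := by
    intro k
    induction k with
    | zero => exact hu
    | succ k ih => rw [hUs]; exact hTm _ ih
  have hSm : ∀ k, Measurable (S k) := by
    intro k
    induction k with
    | zero => exact measurable_const
    | succ k ih => rw [hSs]; exact (hTm _ ih).add hg
  have hUS : ∀ k, ∀ᵐ x ∂μ, u x ≤ U k x + S k x := by
    intro k
    induction k with
    | zero => exact Eventually.of_forall fun x => by simp [hU]
    | succ k ih =>
      filter_upwards [hle] with x hx
      calc u x ≤ T u x + g x := hx
        _ ≤ T (fun y => U k y + S k y) x + g x := by gcongr; exact hTmono _ _ ih x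
        _ ≤ (T (U k) x + T (S k) x) + g x := by gcongr; exact hTadd _ _ (hUm k) (hSm k) x
        _ = _ := by rw [hUs, hSs, add_assoc]
  have hUint : ∀ k, ∫⁻ x, U k x ^ p ∂μ ≤ 2⁻¹ ^ k * ∫⁻ x, u x ^ p ∂μ := by
    intro k
    induction k with
    | zero => simp [hU]
    | succ k ih =>
      rw [hUs, pow_succ']
      calc _ ≤ 2⁻¹ * ∫⁻ x, U k x ^ p ∂μ := hTp _ (hUm k)
        _ ≤ 2⁻¹ * (2⁻¹ ^ k * ∫⁻ x, u x ^ p ∂μ) := by gcongr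
        _ = _ := by ring
  have hU0 : ∀ᵐ x ∂μ, Tendsto (fun k => U k x) atTop (𝓝 0) := by
    -- Geometric decay makes the sum of the `p`-th moments finite, which yields almost everywhere
    -- convergence of the whole sequence.
    have hsum : ∫⁻ x, ∑' k, U k x ^ p ∂μ ≠ ⊤ := by
      rw [lintegral_tsum fun k => ((hUm k).pow_const _).aemeasurable]
      refine ne_top_of_le_ne_top ?_ (ENNReal.tsum_le_tsum hUint)
      rw [ENNReal.tsum_mul_right, ENNReal.tsum_geometric, ENNReal.one_sub_inv_two, inv_inv]
      exact ENNReal.mul_ne_top (by simp) hup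
    filter_upwards [ae_lt_top (Measurable.tsum fun k => (hUm k).pow_const _) hsum] with x hx
    have h1 := ENNReal.tendsto_atTop_zero_of_tsum_ne_top hx.ne
    have h2 := ((ENNReal.continuous_rpow_const (y := 1 / p)).tendsto 0).comp h1
    rw [ENNReal.zero_rpow_of_pos (by positivity)] at h2
    refine h2.congr fun k => ?_
    simp only [Function.comp]
    rw [← ENNReal.rpow_mul, mul_one_div_cancel hp.ne', ENNReal.rpow_one]
  set N := (∫⁻ x, g x ^ q ∂μ) ^ (1 / q) with hN
  have hNtop : N ≠ ⊤ := ENNReal.rpow_ne_top_of_nonneg (by positivity) hgq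
  -- The bound `2 * N` reproduces itself: half of it plus `N`.
  have hSint : ∀ k, (∫⁻ x, S k x ^ q ∂μ) ^ (1 / q) ≤ 2 * N := by
    intro k
    induction k with
    | zero => simp [hS, hq0]
    | succ k ih =>
      rw [hSs]
      have h1 := ENNReal.lintegral_Lp_add_le (hTm _ (hSm k)).aemeasurable hg.aemeasurable hq (μ := μ)
      simp only [Pi.add_apply] at h1
      refine h1.trans ?_
      have h2 : (∫⁻ x, T (S k) x ^ q ∂μ) ^ (1 / q) ≤ N := by
        calc _ ≤ (2⁻¹ ^ q * ∫⁻ x, S k x ^ q ∂μ) ^ (1 / q) := by gcongr; exact hTq _ (hSm k)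
          _ = 2⁻¹ * (∫⁻ x, S k x ^ q ∂μ) ^ (1 / q) := by
              rw [ENNReal.mul_rpow_of_nonneg _ _ (by positivity), ← ENNReal.rpow_mul,
                mul_one_div_cancel hq0.ne', ENNReal.rpow_one]
          _ ≤ 2⁻¹ * (2 * N) := by gcongr
          _ = N := by
              rw [← mul_assoc, ENNReal.inv_mul_cancel (by simp) (by simp), one_mul]
      rw [two_mul]
      exact add_le_add h2 le_rfl
  have hfin : ∫⁻ x, u x ^ q ∂μ ≤ (2 * N) ^ q := by
    -- Since `u - U k ≤ S k` and `U k → 0`, Fatou's lemma transfers the uniform bound to `u`.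
    calc ∫⁻ x, u x ^ q ∂μ ≤ ∫⁻ x, liminf (fun k => S k x ^ q) atTop ∂μ := by
          refine lintegral_mono_ae ?_
          filter_upwards [hU0, ae_all_iff.2 hUS] with x hx0 hx
          have h1 : Tendsto (fun k => (u x - U k x) ^ q) atTop (𝓝 (u x ^ q)) := by
            have h2 : Tendsto (fun k => u x - U k x) atTop (𝓝 (u x - 0)) :=
              ENNReal.Tendsto.sub tendsto_const_nhds hx0 (Or.inr (by simp))
            rw [tsub_zero] at h2
            exact ((ENNReal.continuous_rpow_const (y := q)).tendsto _).comp h2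
          rw [← h1.liminf_eq]
          refine liminf_le_liminf (Eventually.of_forall fun k => ?_)
          have := hx k
          gcongr
          exact tsub_le_iff_left.2 this
      _ ≤ liminf (fun k => ∫⁻ x, S k x ^ q ∂μ) atTop :=
          lintegral_liminf_le fun k => (hSm k).pow_const _
      _ ≤ (2 * N) ^ q := by
          refine (liminf_le_liminf (Eventually.of_forall fun k => ?_)).trans
            (le_of_eq (liminf_const ((2 * N) ^ q)))
          calc ∫⁻ x, S k x ^ q ∂μ = ((∫⁻ x, S k x ^ q ∂μ) ^ (1 / q)) ^ q := by
                rw [← ENNReal.rpow_mul, one_div_mul_cancel hq0.ne', ENNReal.rpow_one]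
            _ ≤ _ := by gcongr; exact hSint k
  refine ne_top_of_le_ne_top ?_ hfin
  exact ENNReal.rpow_ne_top_of_nonneg hq0.le (ENNReal.mul_ne_top (by simp) hNtop)

end CriticalDirac

end

/-! ### Boundedness of subsolutions of the critical integral inequality. -/

noncomputable section

namespace CriticalDirac

open Set Metric Filter Topology
open scoped ENNReal

variable {n : ℕ}

lemma critExp_sub_two (hn : 2 ≤ n) : critExp n - 2 = 2 / ((n : ℝ) - 1) := by
  have : (2 : ℝ) ≤ n := by exact_mod_cast hn
  have h1 : (n : ℝ) - 1 ≠ 0 := by linarith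
  rw [critExp]; field_simp; ring

lemma critExp_sub_two_pos (hn : 2 ≤ n) : 0 < critExp n - 2 := by
  have : (2 : ℝ) ≤ n := by exact_mod_cast hn
  rw [critExp_sub_two hn]
  exact div_pos two_pos (by linarith)

/-- Criticality: `u ∈ L^{2^♯}` puts the potential `|u|^{2^♯-2}` exactly in `Lⁿ`. -/
lemma critExp_sub_two_mul (hn : 2 ≤ n) : (critExp n - 2) * n = critExp n := by
  have : (2 : ℝ) ≤ n := by exact_mod_cast hn
  have h1 : (n : ℝ) - 1 ≠ 0 := by linarith
  rw [critExp]; field_simp; ring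

lemma one_div_critExp (hn : 2 ≤ n) : 1 / critExp n = 1 / 2 - 1 / (2 * n) := by
  have : (2 : ℝ) ≤ n := by exact_mod_cast hn
  have h1 : (n : ℝ) - 1 ≠ 0 := by linarith
  rw [critExp]; field_simp

lemma sub_one_mul_critExp (hn : 2 ≤ n) : ((n : ℝ) - 1) * critExp n = 2 * n := by
  have : (2 : ℝ) ≤ n := by exact_mod_cast hn
  have h1 : (n : ℝ) - 1 ≠ 0 := by linarith
  rw [critExp]; field_simp

/-- The dual exponent of `2^♯` is `2n / (n + 1)`. -/
lemma holderConjugate_critExp (hn : 2 ≤ n) :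
    (critExp n / (critExp n - 1)).HolderConjugate (critExp n) := by
  have := critExp_sub_two_pos hn
  exact (Real.HolderConjugate.conjExponent (by linarith : 1 < critExp n)).symm

/-- A Riesz potential of a function in `L^{(2^♯)'} ∩ L^t`, `t > n`, is bounded. -/
lemma riesz_bounded (hn : 2 ≤ n) {f : Space n → ℝ≥0∞} (hf : Measurable f)
    (h1 : ∫⁻ x, f x ^ (critExp n / (critExp n - 1)) ≠ ⊤) {t : ℝ} (ht : (n : ℝ) < t)
    (h2 : ∫⁻ x, f x ^ t ≠ ⊤) :
    ∃ M : ℝ≥0∞, M ≠ ⊤ ∧ ∀ x, riesz ((n : ℝ) - 1) f x ≤ M := by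
  have hn2 : (2 : ℝ) ≤ n := by exact_mod_cast hn
  have ht1 : 1 < t := by linarith
  set t' := t.conjExponent
  have hc : t.HolderConjugate t' := Real.HolderConjugate.conjExponent ht1
  have ht'0 : 0 < t' := hc.symm.pos
  have hpp := critExp_sub_two_pos hn
  -- Near the singularity `t > n` is equivalent to `(n - 1) t' < n`.
  obtain ⟨c₁, hc1, near⟩ := lintegral_ball_rpow (n := n) (by omega) (a := ((n : ℝ) - 1) * t') (by
    have : 1 / t' = 1 - 1 / t := by
      have := hc.inv_add_inv_eq_one; simp only [one_div]; linarith
    have h3 : 1 / t < 1 / n := one_div_lt_one_div_of_lt (by linarith) ht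
    have h4 : 1 - 1 / (n : ℝ) < 1 / t' := by linarith
    rw [lt_div_iff₀ ht'0] at h4
    have h5 := mul_lt_mul_of_pos_left h4 (by linarith : (0 : ℝ) < n)
    calc ((n : ℝ) - 1) * t' = n * ((1 - 1 / n) * t') := by field_simp
      _ < n := by linarith)
  -- At infinity the dual exponent is `2^♯`, and `(n - 1) 2^♯ = 2n > n`.
  obtain ⟨c₂, hc2, far⟩ := lintegral_compl_ball_rpow (n := n) (by omega)
    (a := ((n : ℝ) - 1) * critExp n) (by rw [sub_one_mul_critExp hn]; linarith)
  have near1 := near 1 one_pos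
  have far1 := far 1 one_pos
  refine ⟨ENNReal.ofReal (c₁ * 1 ^ ((n : ℝ) - ((n : ℝ) - 1) * t')) ^ (1 / t') *
      (∫⁻ y, f y ^ t) ^ (1 / t) + ENNReal.ofReal (c₂ * 1 ^ ((n : ℝ) - ((n : ℝ) - 1) * critExp n)) ^
      (1 / critExp n) * (∫⁻ y, f y ^ (critExp n / (critExp n - 1))) ^
      (1 / (critExp n / (critExp n - 1))), ?_, fun x => ?_⟩
  · have hcpos : 0 ≤ critExp n / (critExp n - 1) := (holderConjugate_critExp hn).nonneg
    have e1 := ENNReal.rpow_ne_top_of_nonneg (by positivity : 0 ≤ 1 / t') (ENNReal.ofReal_ne_top (r := c₁ * 1 ^ ((n : ℝ) - ((n : ℝ) - 1) * t')))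
    have e2 := ENNReal.rpow_ne_top_of_nonneg (by positivity : 0 ≤ 1 / t) h2
    have e3 := ENNReal.rpow_ne_top_of_nonneg (by simp; linarith : 0 ≤ 1 / critExp n) (ENNReal.ofReal_ne_top (r := c₂ * 1 ^ ((n : ℝ) - ((n : ℝ) - 1) * critExp n)))
    have e4 := ENNReal.rpow_ne_top_of_nonneg (by positivity : 0 ≤ 1 / (critExp n / (critExp n - 1))) h1
    exact ENNReal.add_ne_top.2 ⟨ENNReal.mul_ne_top e1 e2, ENNReal.mul_ne_top e3 e4⟩
  · refine (riesz_le_near_add_far _ hf (holderConjugate_critExp hn) 1 x).trans ?_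
    have hexp : 0 ≤ 1 / critExp n := (one_div_pos.2 (by linarith)).le
    refine add_le_add ?_ (by gcongr)
    refine (lintegral_conv_le_holder ((measurable_enorm_rpow _).indicator measurableSet_ball) hf hc
      x).trans ?_
    gcongr
    refine le_trans (le_of_eq ?_) near1
    rw [← lintegral_indicator measurableSet_ball]
    refine lintegral_congr fun z => ?_
    by_cases hz : z ∈ ball (0 : Space n) 1
    · simp only [indicator_of_mem hz]
      rw [← ENNReal.rpow_mul, neg_mul]
    · simp only [indicator_of_notMem hz]
      rw [ENNReal.zero_rpow_of_pos ht'0]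

/-- Critical regularity: a subsolution of `u ≤ C I₁(u^{2^♯ - 1})` in `L^{2^♯}` is bounded. -/
theorem bounded_of_le_riesz (hn : 2 ≤ n) {u : Space n → ℝ≥0∞} (hu : Measurable u) {C : ℝ≥0∞}
    (hC : C ≠ ⊤) (hint : ∫⁻ x, u x ^ critExp n ≠ ⊤)
    (hle : ∀ᵐ x, u x ≤ C * riesz ((n : ℝ) - 1) (fun y => u y ^ (critExp n - 1)) x) :
    ∃ M : ℝ≥0∞, M ≠ ⊤ ∧ ∀ᵐ x, u x ≤ M := by
  have hn2 : (2 : ℝ) ≤ n := by exact_mod_cast hn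
  have hs := critExp_sub_two_pos hn
  set p := critExp n with hp
  have hp0 : 0 < p := by linarith
  -- With this exponent `u ∈ L^q` means `u^{p-1} ∈ L^{n+1}`, just above the threshold `n` of
  -- `riesz_bounded`.
  set q := ((n : ℝ) + 1) * (p - 1) with hqdef
  have hpq : p ≤ q := by nlinarith
  have hq0 : 0 < q := by linarith
  have condp : 1 / p + 1 / (n : ℝ) < 1 := by
    rw [hp, one_div_critExp hn]
    have : 1 / (2 * (n : ℝ)) = 1 / n / 2 := by field_simp
    have h2 : 1 / (n : ℝ) ≤ 1 / 2 := one_div_le_one_div_of_le two_pos hn2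
    linarith
  have condq : 1 / q + 1 / (n : ℝ) < 1 := by
    have : 1 / q ≤ 1 / p := one_div_le_one_div_of_le hp0 hpq
    linarith
  obtain ⟨Θ, hΘ, hΘ0, HΘ⟩ := riesz_mul_strong_type hn hp0 condp
  obtain ⟨Θ', hΘ', hΘ0', HΘ'⟩ := riesz_mul_strong_type hn hq0 condq
  -- The `Lⁿ` norm of the potential need not be small, but its part on `{u > k}` tends to zero by
  -- dominated convergence.
  set big : ℕ → Set (Space n) := fun k => {x | (k : ℝ≥0∞) < u x} with hbig
  have hbm : ∀ k, MeasurableSet (big k) := fun k => measurableSet_lt measurable_const hu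
  have hus : Measurable fun x => u x ^ (p - 2) := hu.pow_const _
  set V₁ : ℕ → Space n → ℝ≥0∞ := fun k => (big k).indicator fun x => u x ^ (p - 2)
  have hV1m : ∀ k, Measurable (V₁ k) := fun k => hus.indicator (hbm k)
  have hufin : ∀ᵐ x, u x < ⊤ := by
    filter_upwards [ae_lt_top (hu.pow_const p) hint] with x hx
    by_contra h
    rw [not_lt, top_le_iff] at h
    rw [h, ENNReal.top_rpow_of_pos hp0] at hx
    exact lt_irrefl _ hx
  have hVn : ∀ x, (u x ^ (p - 2)) ^ (n : ℝ) = u x ^ p := fun x => by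
    rw [← ENNReal.rpow_mul, hp, critExp_sub_two_mul hn]
  have hV1 : Tendsto (fun k => ∫⁻ x, V₁ k x ^ (n : ℝ)) atTop (𝓝 0) := by
    have h := tendsto_lintegral_of_dominated_convergence (μ := (volume : Measure (Space n)))
      (F := fun k x => V₁ k x ^ (n : ℝ)) (f := fun _ => 0) (fun x => u x ^ p)
      (fun k => (hV1m k).pow_const _) (fun k => Eventually.of_forall fun x => by
        by_cases hx : x ∈ big k
        · simp only [V₁, indicator_of_mem hx, hVn]; exact le_rfl
        · simp only [V₁, indicator_of_notMem hx]
          rw [ENNReal.zero_rpow_of_pos (by linarith)]; exact zero_le) hint (by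
        filter_upwards [hufin] with x hx
        obtain ⟨N, hN⟩ := ENNReal.exists_nat_gt hx.ne
        refine tendsto_const_nhds.congr' ?_
        filter_upwards [eventually_ge_atTop N] with k hk
        have : x ∉ big k := by
          simp only [hbig, mem_ofPred_eq, not_lt]
          exact hN.le.trans (by exact_mod_cast hk)
        simp only [V₁, indicator_of_notMem this]
        rw [ENNReal.zero_rpow_of_pos (by linarith)])
    simpa using h
  have small : ∀ (Φ : ℝ≥0∞ → ℝ≥0∞), Tendsto Φ (𝓝 0) (𝓝 0) → ∀ r : ℝ, 0 < r → ∀ ε : ℝ≥0∞, 0 < ε →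
      ∀ᶠ k in atTop, C ^ r * Φ (∫⁻ x, V₁ k x ^ (n : ℝ)) < ε := by
    intro Φ hΦ r hr ε hε
    have h := ENNReal.Tendsto.const_mul (hΦ.comp hV1)
      (Or.inr (ENNReal.rpow_ne_top_of_nonneg hr.le hC))
    rw [mul_zero] at h
    exact h.eventually_lt_const hε
  -- A single level `k` has to serve for both exponents, since regularity lifting uses the same
  -- operator on both spaces.
  obtain ⟨k, hk1, hk2⟩ := ((small Θ hΘ0 p hp0 2⁻¹ (by simp)).and
    (small Θ' hΘ0' q hq0 (2⁻¹ ^ q) (ENNReal.rpow_pos (by simp) (by simp)))).exists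
  have mulm : ∀ f g : Space n → ℝ≥0∞, Measurable f → Measurable g →
      Measurable fun y => f y * g y := fun f g hf hg => hf.mul hg
  -- Below the level `k` the function `u` is bounded and in `L^p`, hence in `L^q` because `p ≤ q`;
  -- this part supplies the inhomogeneity `g`.
  set V₂ : Space n → ℝ≥0∞ := (big k)ᶜ.indicator fun x => u x ^ (p - 2)
  have hV2m : Measurable V₂ := hus.indicator (hbm k).compl
  set w : Space n → ℝ≥0∞ := (big k)ᶜ.indicator u
  have hwm : Measurable w := hu.indicator (hbm k).compl
  set T : (Space n → ℝ≥0∞) → Space n → ℝ≥0∞ := fun f x =>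
    C * riesz ((n : ℝ) - 1) (fun y => V₁ k y * f y) x
  set g : Space n → ℝ≥0∞ := fun x => C * riesz ((n : ℝ) - 1) (fun y => V₂ y * w y) x
  have hgm : Measurable g := (measurable_riesz _ (hV2m.mul hwm)).const_mul _
  have scale : ∀ (r : ℝ), 0 < r → ∀ f : Space n → ℝ≥0∞, Measurable f →
      ∫⁻ x, (C * riesz ((n : ℝ) - 1) f x) ^ r =
      C ^ r * ∫⁻ x, riesz ((n : ℝ) - 1) f x ^ r := by
    intro r hr f hf
    rw [← lintegral_const_mul _ ((measurable_riesz _ hf).pow_const _)]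
    refine lintegral_congr fun x => ?_
    rw [ENNReal.mul_rpow_of_nonneg _ _ hr.le]
  have hV2n : ∫⁻ x, V₂ x ^ (n : ℝ) ≠ ⊤ := by
    refine ne_top_of_le_ne_top hint (lintegral_mono fun x => ?_)
    by_cases hx : x ∈ (big k)ᶜ
    · simp only [V₂, indicator_of_mem hx, hVn]; exact le_rfl
    · simp only [V₂, indicator_of_notMem hx]
      rw [ENNReal.zero_rpow_of_pos (by linarith)]; exact zero_le
  have hwq : ∫⁻ x, w x ^ q ≠ ⊤ := by
    have h1 : ∫⁻ x, w x ^ q ≤ ∫⁻ x, (k : ℝ≥0∞) ^ (q - p) * u x ^ p := by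
      refine lintegral_mono fun x => ?_
      by_cases hx : x ∈ (big k)ᶜ
      · simp only [w, indicator_of_mem hx]
        have hx' : u x ≤ k := not_lt.1 hx
        calc u x ^ q = u x ^ (q - p) * u x ^ p := by
              rw [← ENNReal.rpow_add_of_nonneg _ _ (by linarith) hp0.le, sub_add_cancel]
          _ ≤ _ := by gcongr
      · simp only [w, indicator_of_notMem hx]
        rw [ENNReal.zero_rpow_of_pos hq0]; exact zero_le
    refine ne_top_of_le_ne_top ?_ h1
    rw [lintegral_const_mul _ (hu.pow_const _)]
    exact ENNReal.mul_ne_top (ENNReal.rpow_ne_top_of_nonneg (by linarith) (by simp)) hint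
  have huq : ∫⁻ x, u x ^ q ≠ ⊤ := by
    refine lintegral_rpow_ne_top_of_le_contraction (T := T) (p := p) (g := g)
      (fun f hf => (measurable_riesz _ ((hV1m k).mul hf)).const_mul _) ?_ ?_ hp0 (by linarith) ?_ ?_
      hu hgm hint ?_ ?_
    · intro f f' hf hf' x
      simp only [T, mul_add]
      rw [riesz_add _ (mulm _ _ (hV1m k) hf), mul_add]
    · intro f f' h x
      simp only [T]
      gcongr
      refine riesz_mono_ae _ ?_ x
      filter_upwards [h] with y hy
      gcongr
    · intro f hf
      simp only [T]
      rw [scale p hp0 _ (mulm _ _ (hV1m k) hf)]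
      calc _ ≤ C ^ p * (Θ (∫⁻ x, V₁ k x ^ (n : ℝ)) * ∫⁻ x, f x ^ p) := by
            gcongr; exact HΘ _ _ (hV1m k) hf
        _ ≤ _ := by rw [← mul_assoc]; gcongr
    · intro f hf
      simp only [T]
      rw [scale q hq0 _ (mulm _ _ (hV1m k) hf)]
      calc _ ≤ C ^ q * (Θ' (∫⁻ x, V₁ k x ^ (n : ℝ)) * ∫⁻ x, f x ^ q) := by
            gcongr; exact HΘ' _ _ (hV1m k) hf
        _ ≤ _ := by rw [← mul_assoc]; gcongr
    · simp only [g]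
      rw [scale q hq0 _ (mulm _ _ hV2m hwm)]
      refine ENNReal.mul_ne_top (ENNReal.rpow_ne_top_of_nonneg hq0.le hC) ?_
      exact ne_top_of_le_ne_top (ENNReal.mul_ne_top (hΘ' _ hV2n) hwq) (HΘ' _ _ hV2m hwm)
    · filter_upwards [hle] with x hx
      refine hx.trans (le_of_eq ?_)
      simp only [T, g]
      rw [← mul_add, ← riesz_add _ (mulm _ _ (hV1m k) hu)]
      congr 2
      ext y
      have e : u y ^ (p - 1) = u y ^ (p - 2) * u y := by
        conv_rhs => rw [← ENNReal.rpow_one (u y), ← ENNReal.rpow_mul, one_mul]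
        rw [← ENNReal.rpow_add_of_nonneg _ _ hs.le zero_le_one]
        congr 1; ring
      by_cases hy : y ∈ big k
      · have hy' : y ∉ (big k)ᶜ := notMem_compl_iff.2 hy
        simp only [V₁, V₂, w, indicator_of_mem hy, indicator_of_notMem hy', e]; simp
      · have hy' : y ∈ (big k)ᶜ := hy
        simp only [V₁, V₂, w, indicator_of_mem hy', indicator_of_notMem hy, e]; simp
  obtain ⟨M, hM, hb⟩ := riesz_bounded hn (hu.pow_const (p - 1)) (by
      have : p - 1 ≠ 0 := by linarith
      refine ne_of_eq_of_ne (lintegral_congr fun x => ?_) hint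
      rw [← ENNReal.rpow_mul, ← hp, mul_div_cancel₀ _ this]) (t := (n : ℝ) + 1) (by linarith) (by
      refine ne_of_eq_of_ne (lintegral_congr fun x => ?_) huq
      rw [← ENNReal.rpow_mul, hqdef, mul_comm])
  refine ⟨C * M, ENNReal.mul_ne_top hC hM, ?_⟩
  filter_upwards [hle] with x hx
  exact hx.trans (by gcongr; exact hb x)

end CriticalDirac

end

/-! ### Clifford algebra of the Dirac symbol and of `𝒰`. -/

noncomputable section

namespace CriticalDirac

open Set Metric Filter Topology
open scoped ENNReal

variable {n m : ℕ}

lemma act_eq (A : SpinorMatrix m) (z : Spinor m) :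
    act A z = Matrix.toEuclideanCLM (n := Fin m ⊕ Fin m) (𝕜 := ℂ) A z := rfl

lemma act_act (A B : SpinorMatrix m) (z : Spinor m) : act A (act B z) = act (A * B) z := by
  simp [act_eq]

lemma inner_act (A : SpinorMatrix m) (z w : Spinor m) :
    inner ℂ (act A z) w = inner ℂ z (act Aᴴ w) := by
  rw [act_eq, act_eq, ← Matrix.star_eq_conjTranspose, map_star, ContinuousLinearMap.star_eq_adjoint,
    ContinuousLinearMap.adjoint_inner_right]

lemma norm_act_le (A : SpinorMatrix m) (z : Spinor m) : ‖act A z‖ ≤ opNorm A * ‖z‖ :=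
  (Matrix.toEuclideanCLM (n := Fin m ⊕ Fin m) (𝕜 := ℂ) A).le_opNorm z

lemma act_one (z : Spinor m) : act 1 z = z := by simp [act_eq]

lemma act_smul (A : SpinorMatrix m) (c : ℂ) (z : Spinor m) : act A (c • z) = c • act A z := by
  simp [act_eq]

lemma smul_act (A : SpinorMatrix m) (c : ℂ) (z : Spinor m) : act (c • A) z = c • act A z := by
  simp [act_eq]

/-- The symbol `x ↦ ∑ⱼ xⱼ αⱼ` of the Dirac operator. -/
def symbolMatrix (σ : Fin n → Matrix (Fin m) (Fin m) ℂ) (x : Space n) : SpinorMatrix m :=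
  ∑ j, ((x j : ℝ) : ℂ) • diracMatrix (σ j)

lemma conjTranspose_diracMatrix (s : Matrix (Fin m) (Fin m) ℂ) :
    (diracMatrix s)ᴴ = diracMatrix s := by
  simp [diracMatrix, Matrix.fromBlocks_conjTranspose]

lemma conjTranspose_symbolMatrix (σ : Fin n → Matrix (Fin m) (Fin m) ℂ) (x : Space n) :
    (symbolMatrix σ x)ᴴ = symbolMatrix σ x := by
  simp [symbolMatrix, Matrix.conjTranspose_sum, Matrix.conjTranspose_smul,
    conjTranspose_diracMatrix]

lemma symbolMatrix_anticomm {σ : Fin n → Matrix (Fin m) (Fin m) ℂ} (hσ : IsCliffordFamily σ)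
    (x y : Space n) : symbolMatrix σ x * symbolMatrix σ y + symbolMatrix σ y * symbolMatrix σ x =
      ((2 * inner ℝ x y : ℝ) : ℂ) • (1 : SpinorMatrix m) := by
  have h : symbolMatrix σ x * symbolMatrix σ y + symbolMatrix σ y * symbolMatrix σ x =
      ∑ j, ∑ k, (((x j : ℝ) : ℂ) * ((y k : ℝ) : ℂ)) •
        (diracMatrix (σ j) * diracMatrix (σ k) + diracMatrix (σ k) * diracMatrix (σ j)) := by
    simp only [symbolMatrix, Finset.sum_mul_sum, smul_add, Finset.sum_add_distrib]
    congr 1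
    · simp only [smul_mul_smul_comm]
    · rw [Finset.sum_comm]
      simp only [smul_mul_smul_comm, mul_comm]
  rw [h]
  simp only [hσ _ _, smul_smul]
  simp only [mul_ite, mul_zero, ite_smul, zero_smul, Finset.sum_ite_eq, Finset.mem_univ, if_true]
  rw [← Finset.sum_smul]
  congr 1
  rw [PiLp.inner_apply]
  push_cast
  rw [Finset.mul_sum]
  refine Finset.sum_congr rfl fun j _ => ?_
  simp
  ring

lemma symbolMatrix_mul_self {σ : Fin n → Matrix (Fin m) (Fin m) ℂ} (hσ : IsCliffordFamily σ)
    (x : Space n) : symbolMatrix σ x * symbolMatrix σ x =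
      ((‖x‖ ^ 2 : ℝ) : ℂ) • (1 : SpinorMatrix m) := by
  have h := symbolMatrix_anticomm hσ x x
  rw [real_inner_self_eq_norm_sq, ← two_smul ℂ] at h
  have h2 := congrArg (fun M => (2⁻¹ : ℂ) • M) h
  simp only [smul_smul] at h2
  norm_num at h2
  simpa using h2

/-- The symbol of the Dirac operator as a linear map into the operators on spinors. -/
def symbol (σ : Fin n → Matrix (Fin m) (Fin m) ℂ) : Space n →ₗ[ℝ] Spinor m →L[ℂ] Spinor m where
  toFun x := Matrix.toEuclideanCLM (n := Fin m ⊕ Fin m) (𝕜 := ℂ) (symbolMatrix σ x)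
  map_add' x y := by
    rw [← map_add]
    congr 1
    simp [symbolMatrix, add_smul, Finset.sum_add_distrib]
  map_smul' c x := by
    have : symbolMatrix σ (c • x) = (c : ℂ) • symbolMatrix σ x := by
      simp only [symbolMatrix, Finset.smul_sum, smul_smul, PiLp.smul_apply, smul_eq_mul,
        Complex.ofReal_mul]
    rw [this, map_smul]
    ext z i
    simp

lemma symbol_apply (σ : Fin n → Matrix (Fin m) (Fin m) ℂ) (x : Space n) (z : Spinor m) :
    symbol σ x z = act (symbolMatrix σ x) z := rfl

lemma inner_symbol (σ : Fin n → Matrix (Fin m) (Fin m) ℂ) (x : Space n) (z w : Spinor m) :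
    inner ℂ (symbol σ x z) w = inner ℂ z (symbol σ x w) := by
  rw [symbol_apply, inner_act, conjTranspose_symbolMatrix, symbol_apply]

lemma real_smul_eq (c : ℝ) (z : Spinor m) : c • z = (c : ℂ) • z := by
  ext i; simp

lemma symbol_symbol {σ : Fin n → Matrix (Fin m) (Fin m) ℂ} (hσ : IsCliffordFamily σ)
    (x : Space n) (z : Spinor m) : symbol σ x (symbol σ x z) = (‖x‖ ^ 2) • z := by
  rw [symbol_apply, symbol_apply, act_act, symbolMatrix_mul_self hσ, smul_act, act_one, real_smul_eq]

/-- The symbol is self-adjoint with square `|x|²`, hence `|x|` times an isometry. Kernel sizes are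
therefore exact. -/
lemma norm_symbol {σ : Fin n → Matrix (Fin m) (Fin m) ℂ} (hσ : IsCliffordFamily σ)
    (x : Space n) (z : Spinor m) : ‖symbol σ x z‖ = ‖x‖ * ‖z‖ := by
  have h : ‖symbol σ x z‖ ^ 2 = (‖x‖ * ‖z‖) ^ 2 := by
    have h1 : inner ℂ (symbol σ x z) (symbol σ x z) = ((‖x‖ ^ 2 : ℝ) : ℂ) * inner ℂ z z := by
      rw [inner_symbol, symbol_symbol hσ, real_smul_eq, inner_smul_right]
    rw [inner_self_eq_norm_sq_to_K, inner_self_eq_norm_sq_to_K] at h1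
    rw [mul_pow]
    have h2 : (((‖symbol σ x z‖ ^ 2 : ℝ)) : ℂ) = ((‖x‖ ^ 2 * ‖z‖ ^ 2 : ℝ) : ℂ) := by
      push_cast
      simpa using h1
    exact Complex.ofReal_injective h2
  exact (sq_eq_sq₀ (norm_nonneg _) (by positivity)).1 h

lemma symbolMatrix_single (σ : Fin n → Matrix (Fin m) (Fin m) ℂ) (j : Fin n) :
    symbolMatrix σ (EuclideanSpace.single j 1) = diracMatrix (σ j) := by
  rw [symbolMatrix, Finset.sum_eq_single j]
  · simp
  · intro k _ hk; simp [hk]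
  · simp

lemma diracOp_eq (σ : Fin n → Matrix (Fin m) (Fin m) ℂ) (φ : Space n → Spinor m) (x : Space n) :
    diracOp σ φ x = (-Complex.I) • ∑ j, symbol σ (EuclideanSpace.single j 1)
      (fderiv ℝ φ x (EuclideanSpace.single j 1)) := by
  simp only [diracOp, symbol_apply, symbolMatrix_single]

/-- Factoring `𝒰` into the symbol and a constant matrix reduces its properties to the Clifford
relations and one anticommutation rule. -/
lemma inversionMatrix_eq (σ : Fin n → Matrix (Fin m) (Fin m) ℂ) (x : Space n) :
    inversionMatrix σ x = ((‖x‖⁻¹ : ℝ) : ℂ) • (symbolMatrix σ x *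
      Matrix.fromBlocks (Complex.I • 1) 0 0 (-Complex.I • 1)) := by
  have h : symbolMatrix σ x = Matrix.fromBlocks 0 (∑ j, ((x j : ℝ) : ℂ) • σ j)
      (∑ j, ((x j : ℝ) : ℂ) • σ j)ᴴ 0 := by
    ext i k
    rcases i with i | i <;> rcases k with k | k <;>
      simp [symbolMatrix, diracMatrix, Matrix.sum_apply]
  have h2 : unitSigma σ x = ((‖x‖⁻¹ : ℝ) : ℂ) • ∑ j, ((x j : ℝ) : ℂ) • σ j := by
    simp only [unitSigma, Finset.smul_sum, smul_smul]
    refine Finset.sum_congr rfl fun j _ => ?_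
    congr 1
    push_cast
    rw [div_eq_inv_mul]
  rw [inversionMatrix, h, h2, Matrix.fromBlocks_multiply, Matrix.fromBlocks_smul]
  simp [Matrix.conjTranspose_smul, smul_smul, mul_comm]

/-- The chirality matrix, which anticommutes with all Dirac matrices. -/
def chirality (m : ℕ) : SpinorMatrix m :=
  Matrix.fromBlocks (Complex.I • 1) 0 0 (-Complex.I • 1)

lemma chirality_mul_self : chirality m * chirality m = -1 := by
  rw [chirality, Matrix.fromBlocks_multiply, ← Matrix.fromBlocks_one, Matrix.fromBlocks_neg]
  simp [smul_smul]

lemma symbolMatrix_mul_chirality (σ : Fin n → Matrix (Fin m) (Fin m) ℂ) (x : Space n) :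
    symbolMatrix σ x * chirality m = -(chirality m * symbolMatrix σ x) := by
  have : ∀ s : Matrix (Fin m) (Fin m) ℂ, diracMatrix s * chirality m =
      -(chirality m * diracMatrix s) := by
    intro s
    rw [chirality, diracMatrix, Matrix.fromBlocks_multiply, Matrix.fromBlocks_multiply,
      Matrix.fromBlocks_neg]
    simp
  simp [symbolMatrix, Finset.sum_mul, Finset.mul_sum, this]

lemma conjTranspose_chirality : (chirality m)ᴴ = -chirality m := by
  simp [chirality, Matrix.fromBlocks_conjTranspose, Matrix.fromBlocks_neg]

/-- Together with `inversionMatrix_mul_self` this makes `𝒰(x)` a Hermitian unitary involution for `x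
≠ 0`, so adjoints and inverses of `𝒰` can be dropped throughout. -/
lemma conjTranspose_inversionMatrix (σ : Fin n → Matrix (Fin m) (Fin m) ℂ) (x : Space n) :
    (inversionMatrix σ x)ᴴ = inversionMatrix σ x := by
  rw [inversionMatrix_eq, ← chirality, Matrix.conjTranspose_smul, Matrix.conjTranspose_mul,
    conjTranspose_chirality, conjTranspose_symbolMatrix, symbolMatrix_mul_chirality]
  simp

lemma inversionMatrix_mul_self {σ : Fin n → Matrix (Fin m) (Fin m) ℂ} (hσ : IsCliffordFamily σ)
    {x : Space n} (hx : x ≠ 0) : inversionMatrix σ x * inversionMatrix σ x = 1 := by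
  have h0 : ‖x‖ ≠ 0 := norm_ne_zero_iff.2 hx
  rw [inversionMatrix_eq, ← chirality, smul_mul_smul_comm]
  have : symbolMatrix σ x * chirality m * (symbolMatrix σ x * chirality m) =
      symbolMatrix σ x * symbolMatrix σ x := by
    have h1 : chirality m * symbolMatrix σ x = -(symbolMatrix σ x * chirality m) := by
      rw [symbolMatrix_mul_chirality, neg_neg]
    rw [mul_assoc, ← mul_assoc (chirality m), h1, neg_mul, mul_assoc _ (chirality m),
      chirality_mul_self]
    simp
  rw [this, symbolMatrix_mul_self hσ, smul_smul]
  have e : ((‖x‖⁻¹ : ℝ) : ℂ) * ((‖x‖⁻¹ : ℝ) : ℂ) * ((‖x‖ ^ 2 : ℝ) : ℂ) = 1 := by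
    rw [← Complex.ofReal_mul, ← Complex.ofReal_mul]
    norm_cast
    field_simp
  rw [e, one_smul]

end CriticalDirac

end

/-! ### Size, Hölder and Taylor estimates for the fundamental solution. -/

noncomputable section

namespace CriticalDirac

open Set Metric Filter Topology
open scoped ENNReal

variable {n m : ℕ}

/-- The fundamental solution of the Dirac operator, up to normalization. -/
def kern (σ : Fin n → Matrix (Fin m) (Fin m) ℂ) (x : Space n) (z : Spinor m) : Spinor m :=
  (‖x‖ ^ n)⁻¹ • symbol σ x z

/-- The differential of `kern σ` at `-y` in the direction `x`. -/
def dkern (σ : Fin n → Matrix (Fin m) (Fin m) ℂ) (y x : Space n) (z : Spinor m) : Spinor m :=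
  (‖y‖ ^ n)⁻¹ • symbol σ x z - (n * inner ℝ x y * (‖y‖ ^ (n + 2))⁻¹) • symbol σ y z

lemma inv_pow_mul_self {a : ℝ} (ha : 0 < a) (n : ℕ) : (a ^ n)⁻¹ * a = a ^ (-((n : ℝ) - 1)) := by
  rw [neg_sub, sub_eq_add_neg, Real.rpow_add ha, Real.rpow_one, Real.rpow_neg ha.le,
    Real.rpow_natCast, mul_comm]

lemma norm_kern {σ : Fin n → Matrix (Fin m) (Fin m) ℂ} (hσ : IsCliffordFamily σ) {x : Space n}
    (hx : x ≠ 0) (z : Spinor m) : ‖kern σ x z‖ = ‖x‖ ^ (-((n : ℝ) - 1)) * ‖z‖ := by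
  rw [kern, norm_smul, norm_symbol hσ, ← mul_assoc, ← inv_pow_mul_self (norm_pos_iff.2 hx)]
  simp

lemma enorm_kern_le {σ : Fin n → Matrix (Fin m) (Fin m) ℂ} (hσ : IsCliffordFamily σ)
    (x : Space n) (z : Spinor m) : ‖kern σ x z‖ₑ ≤ ‖x‖ₑ ^ (-((n : ℝ) - 1)) * ‖z‖ₑ := by
  by_cases hx : x = 0
  · simp [hx, kern]
  · rw [enorm_rpow_neg hx, ← ofReal_norm, ← ofReal_norm, ← ENNReal.ofReal_mul (by positivity),
      norm_kern hσ hx]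

/-- Bernoulli's inequality for `(a / b) ^ n`. -/
lemma inv_pow_sub_inv_pow_mul_le {a b : ℝ} (ha : 0 < a) (hab : a ≤ b) (n : ℕ) :
    ((a ^ n)⁻¹ - (b ^ n)⁻¹) * b ≤ n * (b - a) * (a ^ n)⁻¹ := by
  have hb : 0 < b := ha.trans_le hab
  have h := one_add_mul_le_pow (a := a / b - 1) (by have : 0 < a / b := by positivity
                                                    linarith) n
  have h1 : 1 - (a / b) ^ n ≤ n * (1 - a / b) := by
    have : 1 + (a / b - 1) = a / b := by ring
    rw [this] at h; linarith
  calc ((a ^ n)⁻¹ - (b ^ n)⁻¹) * b = (1 - (a / b) ^ n) * ((a ^ n)⁻¹ * b) := by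
        rw [div_pow]; field_simp
    _ ≤ (n * (1 - a / b)) * ((a ^ n)⁻¹ * b) := by gcongr
    _ = _ := by field_simp

/-- If `|x - x'| ≥ |x|`, the sizes of the two kernels already suffice. Otherwise numerator and
denominator are varied separately, and the Lipschitz gain `d = |x - x'|` is weakened to `d^β
|x|^{1-β}`. The ordering makes `|x|` the more singular distance. -/
lemma norm_kern_sub_kern_le_aux {σ : Fin n → Matrix (Fin m) (Fin m) ℂ} (hn : 1 ≤ n)
    (hσ : IsCliffordFamily σ)
    {β : ℝ} (hβ : 0 < β) (hβ1 : β ≤ 1) {x x' : Space n} (hx : x ≠ 0) (hx' : x' ≠ 0)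
    (hxx : ‖x‖ ≤ ‖x'‖) (z : Spinor m) :
    ‖kern σ x z - kern σ x' z‖ ≤
      (n + 2) * ‖x - x'‖ ^ β * ‖x‖ ^ (-((n : ℝ) - 1 + β)) * ‖z‖ := by
  have ha : 0 < ‖x‖ := norm_pos_iff.2 hx
  have hb : 0 < ‖x'‖ := norm_pos_iff.2 hx'
  have hn1 : (1 : ℝ) ≤ n := by exact_mod_cast hn
  set a := ‖x‖ with hadef
  set b := ‖x'‖ with hbdef
  set d := ‖x - x'‖ with hd
  have hd0 : 0 ≤ d := norm_nonneg _
  rcases le_or_gt a d with h | h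
  · have h1 : a ^ (-((n : ℝ) - 1)) ≤ d ^ β * a ^ (-((n : ℝ) - 1 + β)) := by
      calc a ^ (-((n : ℝ) - 1)) = a ^ β * a ^ (-((n : ℝ) - 1 + β)) := by
            rw [← Real.rpow_add ha]; congr 1; ring
        _ ≤ _ := by gcongr
    have h2 : b ^ (-((n : ℝ) - 1)) ≤ a ^ (-((n : ℝ) - 1)) :=
      Real.rpow_le_rpow_of_nonpos ha hxx (by linarith)
    calc _ ≤ ‖kern σ x z‖ + ‖kern σ x' z‖ := norm_sub_le _ _
      _ = (a ^ (-((n : ℝ) - 1)) + b ^ (-((n : ℝ) - 1))) * ‖z‖ := by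
          rw [norm_kern hσ hx, norm_kern hσ hx']; ring
      _ ≤ (2 * (d ^ β * a ^ (-((n : ℝ) - 1 + β)))) * ‖z‖ := by gcongr; linarith
      _ ≤ ((n + 2) * (d ^ β * a ^ (-((n : ℝ) - 1 + β)))) * ‖z‖ := by gcongr; linarith
      _ = _ := by ring
  · have e : kern σ x z - kern σ x' z = (a ^ n)⁻¹ • symbol σ (x - x') z +
        ((a ^ n)⁻¹ - (b ^ n)⁻¹) • symbol σ x' z := by
      simp only [kern, map_sub, _root_.sub_apply]
      module
    have hpos : 0 ≤ (a ^ n)⁻¹ - (b ^ n)⁻¹ := by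
      rw [sub_nonneg]; gcongr
    have hba : b - a ≤ d := by
      have := norm_sub_norm_le x' x
      rw [norm_sub_rev] at this; exact this
    have h1 : d * (a ^ n)⁻¹ ≤ d ^ β * a ^ (-((n : ℝ) - 1 + β)) := by
      rcases hd0.eq_or_lt with h0 | h0
      · rw [← h0]; simp [Real.zero_rpow hβ.ne']
      calc d * (a ^ n)⁻¹ = d ^ β * (d ^ (1 - β) * (a ^ n)⁻¹) := by
            rw [← mul_assoc, ← Real.rpow_add h0]; simp
        _ ≤ d ^ β * (a ^ (1 - β) * (a ^ n)⁻¹) := by gcongr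
        _ = _ := by
            congr 1
            rw [← Real.rpow_natCast, ← Real.rpow_neg ha.le, ← Real.rpow_add ha]
            congr 1; ring
    calc _ ≤ (a ^ n)⁻¹ * (d * ‖z‖) + ((a ^ n)⁻¹ - (b ^ n)⁻¹) * (b * ‖z‖) := by
          rw [e]
          refine (norm_add_le _ _).trans ?_
          rw [norm_smul, norm_smul, norm_symbol hσ, norm_symbol hσ, Real.norm_of_nonneg hpos,
            Real.norm_of_nonneg (by positivity)]
      _ = ((a ^ n)⁻¹ * d + ((a ^ n)⁻¹ - (b ^ n)⁻¹) * b) * ‖z‖ := by ring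
      _ ≤ ((a ^ n)⁻¹ * d + n * (b - a) * (a ^ n)⁻¹) * ‖z‖ := by
          have := inv_pow_sub_inv_pow_mul_le ha hxx n
          exact mul_le_mul_of_nonneg_right (by linarith) (norm_nonneg _)
      _ ≤ ((a ^ n)⁻¹ * d + n * d * (a ^ n)⁻¹) * ‖z‖ := by gcongr
      _ = (n + 1) * (d * (a ^ n)⁻¹) * ‖z‖ := by ring
      _ ≤ (n + 2) * (d ^ β * a ^ (-((n : ℝ) - 1 + β))) * ‖z‖ := by gcongr; linarith
      _ = _ := by ring

lemma norm_kern_sub_kern_le {σ : Fin n → Matrix (Fin m) (Fin m) ℂ} (hn : 1 ≤ n)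
    (hσ : IsCliffordFamily σ)
    {β : ℝ} (hβ : 0 < β) (hβ1 : β ≤ 1) {x x' : Space n} (hx : x ≠ 0) (hx' : x' ≠ 0)
    (z : Spinor m) :
    ‖kern σ x z - kern σ x' z‖ ≤ (n + 2) * ‖x - x'‖ ^ β *
      (‖x‖ ^ (-((n : ℝ) - 1 + β)) + ‖x'‖ ^ (-((n : ℝ) - 1 + β))) * ‖z‖ := by
  have p1 : 0 ≤ ‖x‖ ^ (-((n : ℝ) - 1 + β)) := by positivity
  have p2 : 0 ≤ ‖x'‖ ^ (-((n : ℝ) - 1 + β)) := by positivity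
  rcases le_total ‖x‖ ‖x'‖ with h | h
  · refine (norm_kern_sub_kern_le_aux hn hσ hβ hβ1 hx hx' h z).trans ?_
    gcongr; linarith
  · rw [norm_sub_rev, norm_sub_rev x x']
    refine (norm_kern_sub_kern_le_aux hn hσ hβ hβ1 hx' hx h z).trans ?_
    gcongr; linarith

/-- Used for the ratio `p = |y| / |x - y|`, which is at most `2` when `2|x| ≤ |y|`. -/
lemma abs_pow_sub_linear_le (k : ℕ) : ∃ C : ℝ, 0 ≤ C ∧ ∀ p : ℝ, 0 ≤ p → p ≤ 2 →
    |p ^ k - 1 - k * (p - 1)| ≤ C * (p - 1) ^ 2 := by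
  induction k with
  | zero => exact ⟨0, le_rfl, fun p _ _ => by simp⟩
  | succ k ih =>
    obtain ⟨C, hC, h⟩ := ih
    refine ⟨2 * C + k, by positivity, fun p hp0 hp2 => ?_⟩
    have e : p ^ (k + 1) - 1 - ((k + 1 : ℕ) : ℝ) * (p - 1) =
        p * (p ^ k - 1 - k * (p - 1)) + k * (p - 1) ^ 2 := by push_cast; ring
    rw [e]
    calc _ ≤ |p * (p ^ k - 1 - k * (p - 1))| + |k * (p - 1) ^ 2| := abs_add_le _ _
      _ = p * |p ^ k - 1 - k * (p - 1)| + k * (p - 1) ^ 2 := by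
          rw [abs_mul, abs_of_nonneg hp0, abs_of_nonneg (by positivity : (0:ℝ) ≤ k * (p - 1) ^ 2)]
      _ ≤ 2 * (C * (p - 1) ^ 2) + k * (p - 1) ^ 2 := by
          gcongr; exact h p hp0 hp2
      _ = _ := by ring

/-- Second order Taylor estimate for `kern`. -/
lemma norm_kern_taylor_le (σ : Fin n → Matrix (Fin m) (Fin m) ℂ) (hσ : IsCliffordFamily σ) :
    ∃ C : ℝ, 0 ≤ C ∧ ∀ (x y : Space n) (z : Spinor m), y ≠ 0 → 2 * ‖x‖ ≤ ‖y‖ →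
      ‖kern σ (x - y) z - kern σ (-y) z - dkern σ y x z‖ ≤
        C * ‖x‖ ^ 2 * (‖y‖ ^ (n + 1))⁻¹ * ‖z‖ := by
  obtain ⟨C, hC, hpow⟩ := abs_pow_sub_linear_le n
  refine ⟨(4 * C + n * 2) + (4 * C + 10 * n), by positivity, fun x y z hy hxy => ?_⟩
  have hb : 0 < ‖y‖ := norm_pos_iff.2 hy
  set b := ‖y‖ with hbdef
  set e := ‖x‖ with hedef
  have he0 : 0 ≤ e := norm_nonneg _
  set a := ‖x - y‖ with hadef
  have hab : |b - a| ≤ e := by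
    have := abs_norm_sub_norm_le y (y - x)
    rw [sub_sub_cancel, norm_sub_rev y x] at this
    exact this
  obtain ⟨hab1, hab2⟩ := abs_le.1 hab
  have ha : b / 2 ≤ a := by linarith
  have ha0 : 0 < a := by linarith
  -- The Taylor expansion is reduced to scalars: `|x - y|^{-n} = |y|^{-n} p^n`, with small parameter
  -- `ε = |x| / |y|` and with `q` below as the linear part of `p - 1`.
  set p := b / a with hp
  have hp0 : 0 ≤ p := by positivity
  have hp2 : p ≤ 2 := by rw [hp, div_le_iff₀ ha0]; linarith
  set ε := e / b with hε
  have hε0 : 0 ≤ ε := by positivity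
  have hε1 : ε ≤ 1 / 2 := by rw [hε, div_le_iff₀ hb]; linarith
  have hp1 : |p - 1| ≤ 2 * ε := by
    have : p - 1 = (b - a) / a := by rw [hp]; field_simp
    rw [this, abs_div, abs_of_pos ha0, div_le_iff₀ ha0]
    calc |b - a| ≤ e := hab
      _ = 2 * ε * (b / 2) := by rw [hε]; field_simp
      _ ≤ 2 * ε * a := by gcongr
  set q := inner ℝ x y / b ^ 2 with hq
  have hq1 : |q| ≤ ε := by
    rw [hq, abs_div, abs_of_pos (by positivity : 0 < b ^ 2), div_le_iff₀ (by positivity)]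
    calc |inner ℝ x y| ≤ e * b := abs_real_inner_le_norm x y
      _ = _ := by rw [hε]; field_simp
  have ha2 : a ^ 2 = b ^ 2 * (1 - 2 * q + ε ^ 2) := by
    rw [hadef, norm_sub_sq_real, hq, hε]; field_simp; ring
  have hpa : p ^ 2 * (1 - 2 * q + ε ^ 2) = 1 := by
    have : p ^ 2 * a ^ 2 = b ^ 2 := by rw [hp]; field_simp
    rw [ha2] at this
    have hb2 : b ^ 2 ≠ 0 := by positivity
    have h3 : b ^ 2 * (p ^ 2 * (1 - 2 * q + ε ^ 2)) = b ^ 2 * 1 := by linarith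
    exact mul_left_cancel₀ hb2 h3
  have hpsq : (p - 1) ^ 2 ≤ 4 * ε ^ 2 := by
    have := pow_le_pow_left₀ (abs_nonneg _) hp1 2
    rw [sq_abs] at this; linarith
  -- Solving `p² (1 - 2q + ε²) = 1` for `p - 1 - q` leaves half of three quadratic terms, bounded by
  -- `12 ε²`, `4 ε²` and `4 ε²`.
  have hpq : |p - 1 - q| ≤ 10 * ε ^ 2 := by
    have e1 : p - 1 - q = (2 * q * (p - 1) * (p + 1) - ε ^ 2 * p ^ 2 - (p - 1) ^ 2) / 2 := by
      have : p ^ 2 - 1 = 2 * q * p ^ 2 - ε ^ 2 * p ^ 2 := by linarith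
      linear_combination (1 / 2 : ℝ) * this
    have e2 : |2 * q * (p - 1) * (p + 1)| ≤ 12 * ε ^ 2 := by
      rw [abs_mul, abs_mul, abs_mul, abs_two, abs_of_nonneg (by linarith : (0:ℝ) ≤ p + 1)]
      calc 2 * |q| * |p - 1| * (p + 1) ≤ 2 * ε * (2 * ε) * 3 := by gcongr; linarith
        _ = _ := by ring
    have e3 : ε ^ 2 * p ^ 2 ≤ 4 * ε ^ 2 := by
      calc ε ^ 2 * p ^ 2 ≤ ε ^ 2 * 2 ^ 2 := by gcongr
        _ = _ := by ring
    have e4 : 0 ≤ ε ^ 2 * p ^ 2 := by positivity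
    have e5 : 0 ≤ (p - 1) ^ 2 := by positivity
    obtain ⟨e6, e7⟩ := abs_le.1 e2
    rw [e1, abs_le]
    constructor <;> linarith
  have hA : |p ^ n - 1| ≤ (4 * C + n * 2) * ε := by
    have h1 := hpow p hp0 hp2
    calc |p ^ n - 1| = |(p ^ n - 1 - n * (p - 1)) + n * (p - 1)| := by ring_nf
      _ ≤ |p ^ n - 1 - n * (p - 1)| + |n * (p - 1)| := abs_add_le _ _
      _ ≤ C * (4 * ε ^ 2) + n * (2 * ε) := by
          rw [abs_mul, Nat.abs_cast]
          gcongr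
          exact h1.trans (by gcongr)
      _ ≤ C * (4 * ε) + n * (2 * ε) := by
          have : ε ^ 2 ≤ ε := by nlinarith
          gcongr
      _ = _ := by ring
  have hB : |p ^ n - 1 - n * q| ≤ (4 * C + 10 * n) * ε ^ 2 := by
    have h1 := hpow p hp0 hp2
    calc |p ^ n - 1 - n * q| = |(p ^ n - 1 - n * (p - 1)) + n * (p - 1 - q)| := by ring_nf
      _ ≤ |p ^ n - 1 - n * (p - 1)| + |n * (p - 1 - q)| := abs_add_le _ _
      _ ≤ C * (4 * ε ^ 2) + n * (10 * ε ^ 2) := by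
          rw [abs_mul, Nat.abs_cast]
          gcongr
          exact h1.trans (by gcongr)
      _ = _ := by ring
  have hinv : (a ^ n)⁻¹ = (b ^ n)⁻¹ * p ^ n := by rw [hp, div_pow]; field_simp
  -- The coefficient of the small vector `x` needs an error of order `ε` (`hA`) only, that of `y`
  -- one of order `ε²` (`hB`).
  have expand : kern σ (x - y) z - kern σ (-y) z - dkern σ y x z =
      ((b ^ n)⁻¹ * (p ^ n - 1)) • symbol σ x z -
        ((b ^ n)⁻¹ * (p ^ n - 1 - n * q)) • symbol σ y z := by
    have hqn : (n : ℝ) * inner ℝ x y * (b ^ (n + 2))⁻¹ = (b ^ n)⁻¹ * (n * q) := by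
      rw [hq, pow_add]; field_simp
    simp only [kern, dkern, map_sub, map_neg, _root_.sub_apply,
      _root_.neg_apply, norm_neg]
    rw [← hadef, ← hbdef, hinv, hqn]
    module
  rw [expand]
  calc _ ≤ (b ^ n)⁻¹ * |p ^ n - 1| * (e * ‖z‖) + (b ^ n)⁻¹ * |p ^ n - 1 - n * q| * (b * ‖z‖) := by
        refine (norm_sub_le _ _).trans (le_of_eq ?_)
        rw [norm_smul, norm_smul, norm_symbol hσ, norm_symbol hσ, norm_mul, norm_mul,
          Real.norm_of_nonneg (by positivity : 0 ≤ (b ^ n)⁻¹), Real.norm_eq_abs, Real.norm_eq_abs]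
    _ ≤ (b ^ n)⁻¹ * ((4 * C + n * 2) * ε) * (e * ‖z‖) +
        (b ^ n)⁻¹ * ((4 * C + 10 * n) * ε ^ 2) * (b * ‖z‖) := by gcongr
    _ = _ := by rw [hε, pow_succ]; field_simp; ring

lemma norm_dkern_le {σ : Fin n → Matrix (Fin m) (Fin m) ℂ} (hσ : IsCliffordFamily σ)
    {y : Space n} (hy : y ≠ 0) (x : Space n) (z : Spinor m) :
    ‖dkern σ y x z‖ ≤ (n + 1) * ‖x‖ * (‖y‖ ^ n)⁻¹ * ‖z‖ := by
  have hb : 0 < ‖y‖ := norm_pos_iff.2 hy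
  calc _ ≤ (‖y‖ ^ n)⁻¹ * (‖x‖ * ‖z‖) +
        (n * |inner ℝ x y| * (‖y‖ ^ (n + 2))⁻¹) * (‖y‖ * ‖z‖) := by
        refine (norm_sub_le _ _).trans (le_of_eq ?_)
        rw [norm_smul, norm_smul, norm_symbol hσ, norm_symbol hσ, norm_mul, norm_mul,
          Real.norm_eq_abs, Real.norm_eq_abs, Real.norm_eq_abs, Real.norm_eq_abs, abs_inv, abs_pow,
          abs_norm, abs_inv, abs_pow, abs_norm, Nat.abs_cast]
    _ ≤ (‖y‖ ^ n)⁻¹ * (‖x‖ * ‖z‖) +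
        (n * (‖x‖ * ‖y‖) * (‖y‖ ^ (n + 2))⁻¹) * (‖y‖ * ‖z‖) := by
        gcongr; exact abs_real_inner_le_norm x y
    _ = _ := by rw [pow_add]; field_simp; ring

end CriticalDirac

end

/-! ### Hölder continuity and first order expansion of potentials. -/

noncomputable section

namespace CriticalDirac

open Set Metric Filter Topology
open scoped ENNReal

variable {n m : ℕ}

/-- For bounded `f` the near part needs only `a < n`. The range covers `a = n - 1`, for the
potential itself, and `a = n - 1 + β`, for its Hölder quotients. -/
lemma riesz_bounded_of_ae_le (hn : 2 ≤ n) {f : Space n → ℝ≥0∞} (hf : Measurable f)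
    (h1 : ∫⁻ x, f x ^ (critExp n / (critExp n - 1)) ≠ ⊤) {M : ℝ≥0∞} (hM : M ≠ ⊤)
    (h2 : ∀ᵐ x, f x ≤ M) {a : ℝ} (ha : (n : ℝ) - 1 ≤ a) (han : a < n) :
    ∃ B : ℝ≥0∞, B ≠ ⊤ ∧ ∀ x, riesz a f x ≤ B := by
  have hn2 : (2 : ℝ) ≤ n := by exact_mod_cast hn
  have hpp := critExp_sub_two_pos hn
  have hexp : 0 ≤ 1 / critExp n := (one_div_pos.2 (by linarith)).le
  obtain ⟨c₁, hc1, near⟩ := lintegral_ball_rpow (n := n) (by omega) han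
  obtain ⟨c₂, hc2, far⟩ := lintegral_compl_ball_rpow (n := n) (by omega)
    (a := a * critExp n) (by
      have : ((n : ℝ) - 1) * critExp n ≤ a * critExp n := by gcongr; linarith
      rw [sub_one_mul_critExp hn] at this; linarith)
  have near1 := near 1 one_pos
  have far1 := far 1 one_pos
  refine ⟨ENNReal.ofReal (c₁ * 1 ^ ((n : ℝ) - a)) * M +
      ENNReal.ofReal (c₂ * 1 ^ ((n : ℝ) - a * critExp n)) ^
      (1 / critExp n) * (∫⁻ y, f y ^ (critExp n / (critExp n - 1))) ^
      (1 / (critExp n / (critExp n - 1))), ?_, fun x => ?_⟩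
  · have hcpos : 0 ≤ critExp n / (critExp n - 1) := (holderConjugate_critExp hn).nonneg
    have e3 := ENNReal.rpow_ne_top_of_nonneg hexp
      (ENNReal.ofReal_ne_top (r := c₂ * 1 ^ ((n : ℝ) - a * critExp n)))
    have e4 := ENNReal.rpow_ne_top_of_nonneg
      (by positivity : 0 ≤ 1 / (critExp n / (critExp n - 1))) h1
    exact ENNReal.add_ne_top.2 ⟨ENNReal.mul_ne_top ENNReal.ofReal_ne_top hM,
      ENNReal.mul_ne_top e3 e4⟩
  · refine (riesz_le_near_add_far _ hf (holderConjugate_critExp hn) 1 x).trans ?_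
    refine add_le_add ?_ (by gcongr)
    set K := (ball (0 : Space n) 1).indicator fun z => ‖z‖ₑ ^ (-a) with hK
    have hKm : Measurable K := (measurable_enorm_rpow _).indicator measurableSet_ball
    have hKx : Measurable fun y => K (x - y) := hKm.comp (measurable_const.sub measurable_id)
    calc _ ≤ ∫⁻ y, K (x - y) * M := by
          refine lintegral_mono_ae ?_
          filter_upwards [h2] with y hy
          gcongr
      _ = (∫⁻ z, K z) * M := by
          rw [lintegral_mul_const _ hKx, lintegral_sub_left_eq_self]
      _ ≤ _ := by
          gcongr
          rw [hK, lintegral_indicator measurableSet_ball]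
          exact near1

lemma continuous_symbol_apply (σ : Fin n → Matrix (Fin m) (Fin m) ℂ) :
    Continuous fun p : Space n × Spinor m => symbol σ p.1 p.2 := by
  have h : Continuous (symbol σ) := LinearMap.continuous_of_finiteDimensional _
  exact (h.comp continuous_fst).clm_apply continuous_snd

lemma measurable_kern (σ : Fin n → Matrix (Fin m) (Fin m) ℂ) :
    Measurable fun p : Space n × Spinor m => kern σ p.1 p.2 := by
  have h1 : Measurable fun p : Space n × Spinor m => (‖p.1‖ ^ n)⁻¹ :=
    ((measurable_norm.comp measurable_fst).pow_const n).inv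
  exact h1.smul (continuous_symbol_apply σ).measurable

lemma measurable_dkern (σ : Fin n → Matrix (Fin m) (Fin m) ℂ) (x : Space n) :
    Measurable fun p : Space n × Spinor m => dkern σ p.1 x p.2 := by
  have h1 : ∀ k : ℕ, Measurable fun p : Space n × Spinor m => (‖p.1‖ ^ k)⁻¹ := fun k =>
    ((measurable_norm.comp measurable_fst).pow_const k).inv
  have h2 : Measurable fun p : Space n × Spinor m => symbol σ x p.2 :=
    ((symbol σ x).continuous.comp continuous_snd).measurable
  have h3 : Measurable fun p : Space n × Spinor m => (n : ℝ) * inner ℝ x p.1 :=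
    (Continuous.inner continuous_const continuous_fst).measurable.const_mul _
  exact ((h1 n).smul h2).sub ((h3.mul (h1 (n + 2))).smul (continuous_symbol_apply σ).measurable)

/-- The convolution with the fundamental solution of the Dirac operator, up to normalization. -/
def potential (σ : Fin n → Matrix (Fin m) (Fin m) ℂ) (f : Space n → Spinor m) (x : Space n) :
    Spinor m := ∫ y, kern σ (x - y) (f y)

lemma measurable_potential_integrand (σ : Fin n → Matrix (Fin m) (Fin m) ℂ)
    {f : Space n → Spinor m} (hf : Measurable f) (x : Space n) :
    Measurable fun y => kern σ (x - y) (f y) := by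
  have h1 : Measurable fun y : Space n => x - y := measurable_id.const_sub x
  have h2 : Measurable fun y : Space n => (x - y, f y) := h1.prodMk hf
  have h3 := (measurable_kern σ).comp h2
  simpa only [Function.comp_def] using h3

lemma lintegral_enorm_kern_le {σ : Fin n → Matrix (Fin m) (Fin m) ℂ} (hσ : IsCliffordFamily σ)
    (f : Space n → Spinor m) (x : Space n) :
    ∫⁻ y, ‖kern σ (x - y) (f y)‖ₑ ≤ riesz ((n : ℝ) - 1) (fun y => ‖f y‖ₑ) x :=
  lintegral_mono fun _ => enorm_kern_le hσ _ _

lemma integrable_kern {σ : Fin n → Matrix (Fin m) (Fin m) ℂ} (hσ : IsCliffordFamily σ)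
    {f : Space n → Spinor m} (hf : Measurable f) {x : Space n}
    (hx : riesz ((n : ℝ) - 1) (fun y => ‖f y‖ₑ) x ≠ ⊤) :
    Integrable fun y => kern σ (x - y) (f y) :=
  ⟨(measurable_potential_integrand σ hf x).aestronglyMeasurable,
    (lintegral_enorm_kern_le hσ f x).trans_lt hx.lt_top⟩

lemma enorm_potential_le {σ : Fin n → Matrix (Fin m) (Fin m) ℂ} (hσ : IsCliffordFamily σ)
    (f : Space n → Spinor m) (x : Space n) :
    ‖potential σ f x‖ₑ ≤ riesz ((n : ℝ) - 1) (fun y => ‖f y‖ₑ) x :=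
  (enorm_integral_le_lintegral_enorm _).trans (lintegral_enorm_kern_le hσ f x)

lemma ae_sub_ne_zero (hn : 1 ≤ n) (x : Space n) : ∀ᵐ y : Space n, x - y ≠ 0 := by
  have := nontrivial_space hn
  filter_upwards [Measure.ae_ne volume x] with y hy
  exact sub_ne_zero.2 hy.symm

/-- The Hölder bound of the kernel integrates to two Riesz potentials with exponent `n - 1 + β`,
which is below `n` because `β < 1`. -/
lemma holder_potential (hn : 2 ≤ n) {σ : Fin n → Matrix (Fin m) (Fin m) ℂ}
    (hσ : IsCliffordFamily σ) {f : Space n → Spinor m} (hf : Measurable f)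
    (h1 : ∫⁻ x, ‖f x‖ₑ ^ (critExp n / (critExp n - 1)) ≠ ⊤) {M : ℝ≥0∞} (hM : M ≠ ⊤)
    (h2 : ∀ᵐ x, ‖f x‖ₑ ≤ M) {β : ℝ} (hβ : 0 < β) (hβ1 : β < 1) :
    ∃ C : ℝ, 0 ≤ C ∧ ∀ x x', ‖potential σ f x - potential σ f x'‖ ≤ C * ‖x - x'‖ ^ β := by
  have hfm : Measurable fun y => ‖f y‖ₑ := hf.enorm
  obtain ⟨B, hB, hb⟩ := riesz_bounded_of_ae_le hn hfm h1 hM h2 le_rfl (by linarith)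
  obtain ⟨D, hD, hd⟩ := riesz_bounded_of_ae_le hn hfm h1 hM h2
    (a := (n : ℝ) - 1 + β) (by linarith) (by linarith)
  refine ⟨(n + 2) * (D + D).toReal, by positivity, fun x x' => ?_⟩
  have hi : ∀ x, Integrable fun y => kern σ (x - y) (f y) := fun x =>
    integrable_kern hσ hf (ne_top_of_le_ne_top hB (hb x))
  rw [potential, potential, ← integral_sub (hi x) (hi x')]
  have hDD : D + D ≠ ⊤ := ENNReal.add_ne_top.2 ⟨hD, hD⟩
  have key : ‖∫ y, (kern σ (x - y) (f y) - kern σ (x' - y) (f y))‖ₑ ≤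
      ENNReal.ofReal ((n + 2) * (D + D).toReal * ‖x - x'‖ ^ β) := by
    refine (enorm_integral_le_lintegral_enorm _).trans ?_
    calc _ ≤ ∫⁻ y, ENNReal.ofReal ((n + 2) * ‖x - x'‖ ^ β) *
          (‖x - y‖ₑ ^ (-((n : ℝ) - 1 + β)) * ‖f y‖ₑ + ‖x' - y‖ₑ ^ (-((n : ℝ) - 1 + β)) * ‖f y‖ₑ) := by
          refine lintegral_mono_ae ?_
          filter_upwards [ae_sub_ne_zero (by omega) x, ae_sub_ne_zero (by omega) x'] with y hy hy'
          rw [enorm_rpow_neg hy, enorm_rpow_neg hy', ← add_mul,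
            ← ENNReal.ofReal_add (by positivity) (by positivity), ← ofReal_norm (f y),
            ← ofReal_norm, ← ENNReal.ofReal_mul (by positivity), ← ENNReal.ofReal_mul (by positivity)]
          refine ENNReal.ofReal_le_ofReal ?_
          have := norm_kern_sub_kern_le (by omega) hσ hβ hβ1.le hy hy' (f y)
          rw [sub_sub_sub_cancel_right] at this
          rw [← mul_assoc]
          exact this
      _ = ENNReal.ofReal ((n + 2) * ‖x - x'‖ ^ β) * (riesz ((n : ℝ) - 1 + β) (fun y => ‖f y‖ₑ) x +
          riesz ((n : ℝ) - 1 + β) (fun y => ‖f y‖ₑ) x') := by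
          rw [lintegral_const_mul' _ _ ENNReal.ofReal_ne_top,
            lintegral_add_left (measurable_riesz_integrand _ hfm x)]
          rfl
      _ ≤ ENNReal.ofReal ((n + 2) * ‖x - x'‖ ^ β) * (D + D) := by
          gcongr <;> exact hd _
      _ = _ := by
          conv_lhs => rw [← ENNReal.ofReal_toReal hDD]
          rw [← ENNReal.ofReal_mul (by positivity)]
          congr 1; ring
  rw [← ofReal_norm] at key
  exact (ENNReal.ofReal_le_ofReal_iff (by positivity)).1 key

lemma continuous_of_holder {X Y : Type*} [NormedAddCommGroup X] [NormedAddCommGroup Y]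
    {u : X → Y} {C β : ℝ} (hβ : 0 < β) (h : ∀ x x', ‖u x - u x'‖ ≤ C * ‖x - x'‖ ^ β) :
    Continuous u := by
  rw [continuous_iff_continuousAt]
  intro x
  rw [ContinuousAt, tendsto_iff_norm_sub_tendsto_zero]
  have h1 : Tendsto (fun y => C * ‖y - x‖ ^ β) (𝓝 x) (𝓝 0) := by
    have : Continuous fun y => C * ‖y - x‖ ^ β :=
      continuous_const.mul ((continuous_id.sub continuous_const).norm.rpow_const
        fun _ => Or.inr hβ.le)
    have h2 := this.tendsto x
    simpa [Real.zero_rpow hβ.ne'] using h2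
  exact squeeze_zero (fun _ => norm_nonneg _) (fun y => h y x) h1

lemma lintegral_riesz_ball (x : Space n) (R a : ℝ) :
    ∫⁻ y in {y | ‖x - y‖ < R}, ‖x - y‖ₑ ^ (-a) = ∫⁻ z in ball (0 : Space n) R, ‖z‖ₑ ^ (-a) := by
  have hS : MeasurableSet {y : Space n | ‖x - y‖ < R} :=
    measurableSet_lt (measurable_const.sub measurable_id).norm measurable_const
  rw [← lintegral_indicator measurableSet_ball, ← lintegral_indicator hS,
    ← lintegral_sub_left_eq_self _ x]
  refine lintegral_congr fun y => ?_
  simp [indicator]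

/-- First order expansion at the origin of the potential of a function vanishing there. -/
theorem potential_expansion (hn : 2 ≤ n) {σ : Fin n → Matrix (Fin m) (Fin m) ℂ}
    (hσ : IsCliffordFamily σ) {g : Space n → Spinor m} (hg : Measurable g)
    (h1 : ∫⁻ x, ‖g x‖ₑ ^ (critExp n / (critExp n - 1)) ≠ ⊤) {M : ℝ≥0∞} (hM : M ≠ ⊤)
    (h2 : ∀ᵐ x, ‖g x‖ₑ ≤ M) {α K : ℝ} (hα : 0 < α) (hα1 : α < 1)
    (hK : ∀ y, ‖g y‖ ≤ K * ‖y‖ ^ α) :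
    ∃ C : ℝ, ∀ x, ‖potential σ g x - potential σ g 0 -
      ∑ j, x j • ∫ y, dkern σ y (EuclideanSpace.single j 1) (g y)‖ ≤ C * ‖x‖ ^ (1 + α) := by
  have hn2 : (2 : ℝ) ≤ n := by exact_mod_cast hn
  have hK0 : 0 ≤ K := by
    have := nontrivial_space (n := n) (by omega)
    obtain ⟨y, hy⟩ := exists_ne (0 : Space n)
    have h3 : 0 ≤ K * ‖y‖ ^ α := (norm_nonneg _).trans (hK y)
    have h4 : 0 < ‖y‖ ^ α := Real.rpow_pos_of_pos (norm_pos_iff.2 hy) _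
    exact nonneg_of_mul_nonneg_left h3 h4
  have hgm : Measurable fun y => ‖g y‖ₑ := hg.enorm
  obtain ⟨B, hB, hb⟩ := riesz_bounded_of_ae_le hn hgm h1 hM h2 le_rfl (by linarith)
  have hi : ∀ x, Integrable fun y => kern σ (x - y) (g y) := fun x =>
    integrable_kern hσ hg (ne_top_of_le_ne_top hB (hb x))
  obtain ⟨c₁, hc1, near1⟩ := lintegral_ball_rpow (n := n) (by omega) (a := (n : ℝ) - 1)
    (by linarith)
  obtain ⟨c₂, hc2, near2⟩ := lintegral_ball_rpow (n := n) (by omega) (a := (n : ℝ) - α)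
    (by linarith)
  obtain ⟨c₃, hc3, far3⟩ := lintegral_compl_ball_rpow (n := n) (by omega) (a := (n : ℝ) + 1 - α)
    (by linarith)
  have hne : ∀ᵐ y : Space n, y ≠ 0 := ae_ne_zero (by omega)
  have hpw : ∀ {y : Space n}, y ≠ 0 → (‖y‖ ^ n)⁻¹ * ‖y‖ ^ α = ‖y‖ ^ (-((n : ℝ) - α)) := by
    intro y hy
    have hy0 : 0 < ‖y‖ := norm_pos_iff.2 hy
    rw [← Real.rpow_natCast, ← Real.rpow_neg hy0.le, ← Real.rpow_add hy0]; congr 1; ring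
  -- The differentiated kernel has the non-integrable size `|y|^{-n}`. Near the origin the vanishing
  -- of `g` compensates; outside the unit ball it is dominated by `|y|^{1-n}`.
  have hdi : ∀ x, Integrable fun y => dkern σ y x (g y) := by
    intro x
    refine ⟨((measurable_dkern σ x).comp (measurable_id.prodMk hg)).aestronglyMeasurable, ?_⟩
    have hbd : ∀ᵐ y : Space n, ‖dkern σ y x (g y)‖ₑ ≤ ENNReal.ofReal ((n + 1) * ‖x‖) *
        ((ball (0 : Space n) 1).indicator (fun y => ENNReal.ofReal K * ‖y‖ₑ ^ (-((n : ℝ) - α))) y +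
        ‖0 - y‖ₑ ^ (-((n : ℝ) - 1)) * ‖g y‖ₑ) := by
      filter_upwards [hne] with y hy
      have hy0 : 0 < ‖y‖ := norm_pos_iff.2 hy
      have hd := norm_dkern_le hσ hy x (g y)
      rw [zero_sub, enorm_neg, enorm_rpow_neg hy, ← ofReal_norm, ← ofReal_norm]
      by_cases hy1 : y ∈ ball (0 : Space n) 1
      · rw [indicator_of_mem hy1, enorm_rpow_neg hy]
        refine le_trans ?_ (mul_le_mul_right (le_self_add) _)
        rw [← ENNReal.ofReal_mul hK0, ← ENNReal.ofReal_mul (by positivity)]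
        refine ENNReal.ofReal_le_ofReal (hd.trans ?_)
        calc _ ≤ (n + 1) * ‖x‖ * (‖y‖ ^ n)⁻¹ * (K * ‖y‖ ^ α) := by gcongr; exact hK y
          _ = (n + 1) * ‖x‖ * (K * ((‖y‖ ^ n)⁻¹ * ‖y‖ ^ α)) := by ring
          _ = _ := by rw [hpw hy]
      · rw [indicator_of_notMem hy1, zero_add, ← ENNReal.ofReal_mul (by positivity),
          ← ENNReal.ofReal_mul (by positivity)]
        refine ENNReal.ofReal_le_ofReal (hd.trans ?_)
        have hy1' : 1 ≤ ‖y‖ := by simpa using hy1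
        rw [mul_assoc]
        have : (‖y‖ ^ n)⁻¹ ≤ ‖y‖ ^ (-((n : ℝ) - 1)) := by
          rw [← inv_pow_mul_self hy0]
          exact le_mul_of_one_le_right (by positivity) hy1'
        gcongr
    refine (lintegral_mono_ae hbd).trans_lt ?_
    have hm : Measurable fun y => (ball (0 : Space n) 1).indicator
        (fun y => ENNReal.ofReal K * ‖y‖ₑ ^ (-((n : ℝ) - α))) y :=
      ((measurable_enorm_rpow _).const_mul _).indicator measurableSet_ball
    rw [lintegral_const_mul' _ _ ENNReal.ofReal_ne_top, lintegral_add_left hm,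
      lintegral_indicator measurableSet_ball, lintegral_const_mul' _ _ ENNReal.ofReal_ne_top]
    refine ENNReal.mul_lt_top ENNReal.ofReal_lt_top (ENNReal.add_lt_top.2
      ⟨ENNReal.mul_lt_top ENNReal.ofReal_lt_top ((near2 1 one_pos).trans_lt ENNReal.ofReal_lt_top),
        (hb 0).trans_lt hB.lt_top⟩)
  have hlin : ∀ x, ∑ j, x j • ∫ y, dkern σ y (EuclideanSpace.single j 1) (g y) =
      ∫ y, dkern σ y x (g y) := by
    intro x
    simp only [← integral_smul]
    have hsm : ∀ j ∈ Finset.univ, Integrable fun y =>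
        x j • dkern σ y (EuclideanSpace.single j 1) (g y) := fun j _ => (hdi _).smul (x j)
    rw [← integral_finsetSum _ hsm]
    refine integral_congr_ae (Eventually.of_forall fun y => ?_)
    have hx : x = ∑ j, x j • (EuclideanSpace.single j 1 : Space n) := by
      ext i; simp [Finset.sum_apply, Pi.single_apply]
    have hadd : ∀ z : Spinor m, dkern σ y x z =
        ∑ j, x j • dkern σ y (EuclideanSpace.single j 1) z := by
      intro z
      conv_lhs => rw [hx]
      simp only [dkern, map_sum, map_smul, sum_inner, real_inner_smul_left, smul_sub,
        Finset.sum_sub_distrib, _root_.sum_apply, _root_.smul_apply]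
      congr 1
      · rw [Finset.smul_sum]
        exact Finset.sum_congr rfl fun j _ => smul_comm _ _ _
      · rw [Finset.mul_sum, Finset.sum_mul, Finset.sum_smul]
        refine Finset.sum_congr rfl fun j _ => ?_
        rw [smul_smul]; congr 1; ring
    exact (hadd (g y)).symm
  obtain ⟨C, hC, taylor⟩ := norm_kern_taylor_le σ hσ
  refine ⟨C * K * (c₃ * 2 ^ (α - 1)) + K * 2 ^ α * (c₁ * 3) + K * (n + 3) * (c₂ * 2 ^ α),
    fun x => ?_⟩
  rcases eq_or_ne x 0 with rfl | hx
  · simp [Real.zero_rpow (by linarith : (1 + α) ≠ 0)]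
  have hx0 : 0 < ‖x‖ := norm_pos_iff.2 hx
  have hi2 : Integrable fun y => kern σ (x - y) (g y) - kern σ (0 - y) (g y) :=
    (hi x).sub (hi 0)
  rw [hlin, potential, potential, ← integral_sub (hi x) (hi 0), ← integral_sub hi2 (hdi x)]
  -- Split at `|y| = 2|x|`. Outside, the second order Taylor bound is integrable at infinity since
  -- `α < 1`; inside, the three terms are bounded one by one, which uses `α > 0`. Every contribution
  -- scales as `|x|^{1+α}`.
  have key : ∀ᵐ y : Space n, ‖kern σ (x - y) (g y) - kern σ (0 - y) (g y) - dkern σ y x (g y)‖ₑ ≤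
      (ENNReal.ofReal (C * K * ‖x‖ ^ 2) * (ball (0 : Space n) (2 * ‖x‖))ᶜ.indicator
        (fun y => ‖y‖ₑ ^ (-((n : ℝ) + 1 - α))) y +
      ENNReal.ofReal (K * (2 * ‖x‖) ^ α) * {y | ‖x - y‖ < 3 * ‖x‖}.indicator
        (fun y => ‖x - y‖ₑ ^ (-((n : ℝ) - 1))) y) +
      ENNReal.ofReal (K * (n + 3) * ‖x‖) * (ball (0 : Space n) (2 * ‖x‖)).indicator
        (fun y => ‖y‖ₑ ^ (-((n : ℝ) - α))) y := by
    filter_upwards [hne, ae_sub_ne_zero (by omega) x] with y hy hxy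
    have hy0 : 0 < ‖y‖ := norm_pos_iff.2 hy
    rw [zero_sub]
    by_cases hyb : y ∈ (ball (0 : Space n) (2 * ‖x‖))ᶜ
    · have hyb' : 2 * ‖x‖ ≤ ‖y‖ := by simpa using hyb
      rw [indicator_of_mem hyb]
      refine le_trans ?_ (le_self_add.trans le_self_add)
      rw [enorm_rpow_neg hy, ← ofReal_norm, ← ENNReal.ofReal_mul (by positivity)]
      refine ENNReal.ofReal_le_ofReal ((taylor x y (g y) hy hyb').trans ?_)
      calc _ ≤ C * ‖x‖ ^ 2 * (‖y‖ ^ (n + 1))⁻¹ * (K * ‖y‖ ^ α) := by gcongr; exact hK y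
        _ = C * K * ‖x‖ ^ 2 * ((‖y‖ ^ (n + 1))⁻¹ * ‖y‖ ^ α) := by ring
        _ = _ := by
            congr 1
            rw [← Real.rpow_natCast, ← Real.rpow_neg hy0.le, ← Real.rpow_add hy0]
            congr 1; push_cast; ring
    · have hyb' : y ∈ ball (0 : Space n) (2 * ‖x‖) := by simpa using hyb
      have hyb'' : ‖y‖ < 2 * ‖x‖ := by simpa using hyb'
      -- The kernel singular at `x` is integrated over a ball centred at `x` that contains the inner
      -- region.
      have hy3 : y ∈ {y | ‖x - y‖ < 3 * ‖x‖} := by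
        have := norm_sub_le x y
        simp only [mem_ofPred_eq]; linarith
      rw [indicator_of_notMem hyb, indicator_of_mem hyb', indicator_of_mem hy3, mul_zero, zero_add]
      rw [enorm_rpow_neg hy, enorm_rpow_neg hxy, ← ofReal_norm, ← ENNReal.ofReal_mul (by positivity),
        ← ENNReal.ofReal_mul (by positivity), ← ENNReal.ofReal_add (by positivity) (by positivity)]
      refine ENNReal.ofReal_le_ofReal ?_
      have t1 : ‖kern σ (x - y) (g y)‖ ≤ K * (2 * ‖x‖) ^ α * ‖x - y‖ ^ (-((n : ℝ) - 1)) := by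
        rw [norm_kern hσ hxy, mul_comm]
        gcongr
        exact (hK y).trans (by gcongr)
      have t2 : ‖kern σ (-y) (g y)‖ ≤ K * 2 * ‖x‖ * ‖y‖ ^ (-((n : ℝ) - α)) := by
        rw [norm_kern hσ (neg_ne_zero.2 hy), norm_neg, ← hpw hy, ← inv_pow_mul_self hy0]
        calc _ ≤ (‖y‖ ^ n)⁻¹ * (2 * ‖x‖) * (K * ‖y‖ ^ α) := by gcongr; exact hK y
          _ = _ := by ring
      have t3 : ‖dkern σ y x (g y)‖ ≤ K * (n + 1) * ‖x‖ * ‖y‖ ^ (-((n : ℝ) - α)) := by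
        refine (norm_dkern_le hσ hy x (g y)).trans ?_
        rw [← hpw hy]
        calc _ ≤ (n + 1) * ‖x‖ * (‖y‖ ^ n)⁻¹ * (K * ‖y‖ ^ α) := by gcongr; exact hK y
          _ = _ := by ring
      refine (norm_sub_le _ _).trans ?_
      have t4 := norm_sub_le (kern σ (x - y) (g y)) (kern σ (-y) (g y))
      linarith
  have hS : MeasurableSet {y : Space n | ‖x - y‖ < 3 * ‖x‖} :=
    measurableSet_lt (measurable_const.sub measurable_id).norm measurable_const
  have total : ‖∫ y, (kern σ (x - y) (g y) - kern σ (0 - y) (g y) - dkern σ y x (g y))‖ₑ ≤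
      ENNReal.ofReal ((C * K * (c₃ * 2 ^ (α - 1)) + K * 2 ^ α * (c₁ * 3) +
        K * (n + 3) * (c₂ * 2 ^ α)) * ‖x‖ ^ (1 + α)) := by
    refine (enorm_integral_le_lintegral_enorm _).trans ((lintegral_mono_ae key).trans ?_)
    have mA : Measurable fun y => (ball (0 : Space n) (2 * ‖x‖))ᶜ.indicator
        (fun y => ‖y‖ₑ ^ (-((n : ℝ) + 1 - α))) y :=
      (measurable_enorm_rpow _).indicator measurableSet_ball.compl
    have mB : Measurable fun y => {y | ‖x - y‖ < 3 * ‖x‖}.indicator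
        (fun y => ‖x - y‖ₑ ^ (-((n : ℝ) - 1))) y :=
      ((measurable_enorm_rpow _).comp (measurable_const.sub measurable_id)).indicator hS
    have mAB : Measurable fun y => ENNReal.ofReal (C * K * ‖x‖ ^ 2) *
        (ball (0 : Space n) (2 * ‖x‖))ᶜ.indicator (fun y => ‖y‖ₑ ^ (-((n : ℝ) + 1 - α))) y +
        ENNReal.ofReal (K * (2 * ‖x‖) ^ α) * {y | ‖x - y‖ < 3 * ‖x‖}.indicator
        (fun y => ‖x - y‖ₑ ^ (-((n : ℝ) - 1))) y := (mA.const_mul _).add (mB.const_mul _)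
    rw [lintegral_add_left mAB,
      lintegral_add_left (mA.const_mul _), lintegral_const_mul' _ _ ENNReal.ofReal_ne_top,
      lintegral_const_mul' _ _ ENNReal.ofReal_ne_top,
      lintegral_const_mul' _ _ ENNReal.ofReal_ne_top, lintegral_indicator measurableSet_ball.compl,
      lintegral_indicator hS, lintegral_indicator measurableSet_ball, lintegral_riesz_ball]
    calc _ ≤ ENNReal.ofReal (C * K * ‖x‖ ^ 2) *
          ENNReal.ofReal (c₃ * (2 * ‖x‖) ^ ((n : ℝ) - (n + 1 - α))) +
          ENNReal.ofReal (K * (2 * ‖x‖) ^ α) * ENNReal.ofReal (c₁ * (3 * ‖x‖) ^ ((n : ℝ) - (n - 1))) +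
          ENNReal.ofReal (K * (n + 3) * ‖x‖) *
            ENNReal.ofReal (c₂ * (2 * ‖x‖) ^ ((n : ℝ) - (n - α))) := by
          gcongr
          · exact far3 _ (by positivity)
          · exact near1 _ (by positivity)
          · exact near2 _ (by positivity)
      _ = ENNReal.ofReal (C * K * ‖x‖ ^ 2 * (c₃ * (2 * ‖x‖) ^ ((n : ℝ) - (n + 1 - α))) +
          K * (2 * ‖x‖) ^ α * (c₁ * (3 * ‖x‖) ^ ((n : ℝ) - (n - 1))) +
          K * (n + 3) * ‖x‖ * (c₂ * (2 * ‖x‖) ^ ((n : ℝ) - (n - α)))) := by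
          rw [← ENNReal.ofReal_mul (by positivity), ← ENNReal.ofReal_mul (by positivity),
            ← ENNReal.ofReal_mul (by positivity), ← ENNReal.ofReal_add (by positivity)
            (by positivity), ← ENNReal.ofReal_add (by positivity) (by positivity)]
      _ = _ := by
          congr 1
          have e1 : (n : ℝ) - (n + 1 - α) = α - 1 := by ring
          have e2 : (n : ℝ) - (n - 1) = 1 := by ring
          have e3 : (n : ℝ) - (n - α) = α := by ring
          have p1 : ‖x‖ ^ 2 * ‖x‖ ^ (α - 1) = ‖x‖ ^ (1 + α) := by
            rw [← Real.rpow_natCast, ← Real.rpow_add hx0]; congr 1; push_cast; ring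
          have p2 : ‖x‖ * ‖x‖ ^ α = ‖x‖ ^ (1 + α) := by
            rw [Real.rpow_add hx0, Real.rpow_one]
          rw [e1, e2, e3, Real.rpow_one, Real.mul_rpow two_pos.le hx0.le,
            Real.mul_rpow two_pos.le hx0.le]
          linear_combination C * K * c₃ * 2 ^ (α - 1) * p1 +
            (K * 2 ^ α * c₁ * 3 + K * (n + 3) * c₂ * 2 ^ α) * p2
  rw [← ofReal_norm] at total
  exact (ENNReal.ofReal_le_ofReal_iff (by positivity)).1 total

end CriticalDirac

end

/-! ### The Dirac operator on radial fields and the truncated fundamental solution. -/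

noncomputable section

namespace CriticalDirac

open Set Metric Filter Topology
open scoped ENNReal

variable {n m : ℕ}

lemma hasFDerivAt_radial_smul (σ : Fin n → Matrix (Fin m) (Fin m) ℂ) {κ : ℝ → ℝ} {κ' : ℝ}
    (x y : Space n) (z : Spinor m) (hκ : HasDerivAt κ κ' (‖y - x‖ ^ 2)) :
    HasFDerivAt (fun y => κ (‖y - x‖ ^ 2) • symbol σ (y - x) z)
      (κ (‖y - x‖ ^ 2) • ((ContinuousLinearMap.apply ℝ (Spinor m) z).comp
          ((ContinuousLinearMap.restrictScalarsL ℂ (Spinor m) (Spinor m) ℝ ℝ).comp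
            (LinearMap.toContinuousLinearMap (symbol σ)))) +
        (κ' • (2 • innerSL ℝ (y - x))).smulRight (symbol σ (y - x) z)) y := by
  have h1 : HasFDerivAt (fun y : Space n => ‖y - x‖ ^ 2) (2 • innerSL ℝ (y - x)) y := by
    have := ((hasFDerivAt_id (𝕜 := ℝ) y).sub_const x).norm_sq
    simpa using this
  have h2 := hκ.comp_hasFDerivAt y h1
  set L := (ContinuousLinearMap.apply ℝ (Spinor m) z).comp
          ((ContinuousLinearMap.restrictScalarsL ℂ (Spinor m) (Spinor m) ℝ ℝ).comp
            (LinearMap.toContinuousLinearMap (symbol σ))) with hL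
  have h3 : HasFDerivAt (fun y => symbol σ (y - x) z) L y := by
    have h4 : HasFDerivAt (fun y => L (y - x)) (L.comp (ContinuousLinearMap.id ℝ (Space n))) y :=
      L.hasFDerivAt.comp y ((hasFDerivAt_id (𝕜 := ℝ) y).sub_const x)
    rw [ContinuousLinearMap.comp_id] at h4
    exact h4
  exact h2.smul h3

lemma sum_smul_single (x : Space n) : ∑ j, x j • (EuclideanSpace.single j 1 : Space n) = x := by
  ext i; simp [Finset.sum_apply, Pi.single_apply]

/-- Each `α_j` squares to one, which produces `n κ`, and `∑ w_j α_j` composed with the symbol of `w`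
is `|w|²`, which produces the term with `κ'`. For `κ(t) = t^{-n/2}` the result vanishes, as it must
for a fundamental solution away from its pole. -/
lemma diracOp_radial {σ : Fin n → Matrix (Fin m) (Fin m) ℂ} (hσ : IsCliffordFamily σ)
    {κ : ℝ → ℝ} {κ' : ℝ} (x y : Space n) (z : Spinor m) (hκ : HasDerivAt κ κ' (‖y - x‖ ^ 2)) :
    diracOp σ (fun y => κ (‖y - x‖ ^ 2) • symbol σ (y - x) z) y =
      (-Complex.I) • ((2 * ‖y - x‖ ^ 2 * κ' + n * κ (‖y - x‖ ^ 2)) • z) := by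
  rw [diracOp_eq, (hasFDerivAt_radial_smul σ x y z hκ).fderiv]
  congr 1
  set w := y - x with hw
  have h1 : ∀ j : Fin n, symbol σ (EuclideanSpace.single j 1)
      ((κ (‖w‖ ^ 2) • ((ContinuousLinearMap.apply ℝ (Spinor m) z).comp
          ((ContinuousLinearMap.restrictScalarsL ℂ (Spinor m) (Spinor m) ℝ ℝ).comp
            (LinearMap.toContinuousLinearMap (symbol σ)))) +
        (κ' • (2 • innerSL ℝ w)).smulRight (symbol σ w z)) (EuclideanSpace.single j 1)) =
      κ (‖w‖ ^ 2) • z + (2 * κ') • symbol σ (w j • EuclideanSpace.single j 1) (symbol σ w z) := by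
    intro j
    have e1 : (κ (‖w‖ ^ 2) • ((ContinuousLinearMap.apply ℝ (Spinor m) z).comp
          ((ContinuousLinearMap.restrictScalarsL ℂ (Spinor m) (Spinor m) ℝ ℝ).comp
            (LinearMap.toContinuousLinearMap (symbol σ)))) +
        (κ' • (2 • innerSL ℝ w)).smulRight (symbol σ w z)) (EuclideanSpace.single j 1) =
        κ (‖w‖ ^ 2) • symbol σ (EuclideanSpace.single j 1) z + (κ' * (2 * w j)) • symbol σ w z := by
      simp [EuclideanSpace.inner_single_right]
    have hs : ‖(EuclideanSpace.single j 1 : Space n)‖ = 1 := by simp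
    rw [e1, map_add, real_smul_eq, map_smul, symbol_symbol hσ, real_smul_eq _ (symbol σ w z),
      map_smul, ← real_smul_eq, ← real_smul_eq, map_smul, _root_.smul_apply, hs]
    module
  simp only [h1, Finset.sum_add_distrib, ← Finset.smul_sum, ← _root_.sum_apply, ← map_sum]
  rw [sum_smul_single, symbol_symbol hσ]
  simp
  module

/-- A smooth step function, equal to `0` on `(-∞, 1]` and to `1` on `[2, ∞)`. -/
def step (t : ℝ) : ℝ := Real.smoothTransition (t - 1)

lemma contDiff_step : ContDiff ℝ ∞ step :=
  Real.smoothTransition.contDiff.comp (contDiff_id.sub contDiff_const)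

lemma step_of_le {t : ℝ} (h : t ≤ 1) : step t = 0 :=
  Real.smoothTransition.zero_of_nonpos (by linarith)

lemma step_of_ge {t : ℝ} (h : 2 ≤ t) : step t = 1 :=
  Real.smoothTransition.one_of_one_le (by linarith)

lemma step_nonneg (t : ℝ) : 0 ≤ step t := Real.smoothTransition.nonneg _

lemma step_le_one (t : ℝ) : step t ≤ 1 := Real.smoothTransition.le_one _

lemma hasDerivAt_step (t : ℝ) : HasDerivAt step (deriv step t) t :=
  (contDiff_step.differentiable (by simp) t).hasDerivAt

lemma monotone_step : Monotone step := by
  intro s t h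
  exact Real.smoothTransition.monotone (by linarith)

lemma deriv_step_nonneg (t : ℝ) : 0 ≤ deriv step t := monotone_step.deriv_nonneg

lemma deriv_step_of_lt {t : ℝ} (h : t < 1) : deriv step t = 0 := by
  have : step =ᶠ[𝓝 t] fun _ => 0 := by
    filter_upwards [Iio_mem_nhds h] with s hs
    exact step_of_le (le_of_lt hs)
  rw [this.deriv_eq]; simp

lemma deriv_step_of_gt {t : ℝ} (h : 2 < t) : deriv step t = 0 := by
  have : step =ᶠ[𝓝 t] fun _ => 1 := by
    filter_upwards [Ioi_mem_nhds h] with s hs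
    exact step_of_ge (le_of_lt hs)
  rw [this.deriv_eq]; simp

lemma continuous_deriv_step : Continuous (deriv step) :=
  contDiff_step.continuous_deriv (by simp)

/-- The radial profile of the truncated fundamental solution. -/
def truncProfile (n : ℕ) (ε R : ℝ) (t : ℝ) : ℝ :=
  t ^ (-(n : ℝ) / 2) * (step (t / ε ^ 2) - step (t / R ^ 2))

/-- The radial profile of the mollifier belonging to the truncated fundamental solution. -/
def mollProfile (n : ℕ) (t : ℝ) : ℝ := 2 * t ^ (1 - (n : ℝ) / 2) * deriv step t

lemma mollProfile_nonneg {t : ℝ} (ht : 0 ≤ t) : 0 ≤ mollProfile n t := by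
  have := deriv_step_nonneg t
  unfold mollProfile; positivity

lemma mollProfile_of_lt {t : ℝ} (h : t < 1) : mollProfile n t = 0 := by
  simp [mollProfile, deriv_step_of_lt h]

lemma mollProfile_of_gt {t : ℝ} (h : 2 < t) : mollProfile n t = 0 := by
  simp [mollProfile, deriv_step_of_gt h]

lemma continuous_mollProfile (n : ℕ) : Continuous (mollProfile n) := by
  rw [continuous_iff_continuousAt]
  intro t
  rcases lt_or_ge t 1 with h | h
  · have : mollProfile n =ᶠ[𝓝 t] fun _ => 0 := by
      filter_upwards [Iio_mem_nhds h] with s hs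
      exact mollProfile_of_lt hs
    exact this.continuousAt
  · exact (continuousAt_const.mul (Real.continuousAt_rpow_const _ _ (Or.inl (by linarith)))).mul
      continuous_deriv_step.continuousAt

lemma mollProfile_bounded (n : ℕ) : ∃ B : ℝ, 0 ≤ B ∧ ∀ t, |mollProfile n t| ≤ B := by
  have hc : HasCompactSupport (mollProfile n) :=
    HasCompactSupport.intro (K := Icc 1 2) isCompact_Icc fun t ht => by
      rw [mem_Icc, not_and_or, not_le, not_le] at ht
      exact ht.elim mollProfile_of_lt mollProfile_of_gt
  obtain ⟨B, hB⟩ := hc.exists_bound_of_continuous (continuous_mollProfile n)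
  exact ⟨B, (norm_nonneg _).trans (hB 0), hB⟩

lemma truncProfile_of_le {ε R t : ℝ} (hε : 0 < ε) (hR : 0 < R) (h1 : t ≤ ε ^ 2) (h2 : t ≤ R ^ 2) :
    truncProfile n ε R t = 0 := by
  rw [truncProfile, step_of_le ((div_le_one (by positivity)).2 h1),
    step_of_le ((div_le_one (by positivity)).2 h2)]
  simp

lemma hasDerivAt_truncProfile {ε R t : ℝ} (ht : 0 < t) :
    HasDerivAt (truncProfile n ε R)
      (-(n : ℝ) / 2 * t ^ (-(n : ℝ) / 2 - 1) * (step (t / ε ^ 2) - step (t / R ^ 2)) +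
        t ^ (-(n : ℝ) / 2) * (deriv step (t / ε ^ 2) * (1 / ε ^ 2) -
          deriv step (t / R ^ 2) * (1 / R ^ 2))) t := by
  have h1 : HasDerivAt (fun t : ℝ => t ^ (-(n : ℝ) / 2)) (-(n : ℝ) / 2 * t ^ (-(n : ℝ) / 2 - 1)) t :=
    Real.hasDerivAt_rpow_const (Or.inl ht.ne')
  have h2 : ∀ r : ℝ, HasDerivAt (fun t => step (t / r ^ 2)) (deriv step (t / r ^ 2) * (1 / r ^ 2)) t :=
    fun r => by
      have h3 : HasDerivAt (fun t : ℝ => t / r ^ 2) (1 / r ^ 2) t :=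
        (hasDerivAt_id t).div_const (r ^ 2)
      exact HasDerivAt.comp (h₂ := step) t (hasDerivAt_step (t / r ^ 2)) h3
  exact h1.mul ((h2 ε).sub (h2 R))

lemma contDiff_truncProfile {ε R : ℝ} (hε : 0 < ε) (hR : 0 < R) :
    ContDiff ℝ ∞ (truncProfile n ε R) := by
  rw [contDiff_iff_contDiffAt]
  intro t
  rcases lt_or_ge 0 t with ht | ht
  · have h2 : ∀ r : ℝ, ContDiffAt ℝ ∞ (fun t => step (t / r ^ 2)) t := fun r =>
      (contDiff_step.comp (contDiff_id.div_const (r ^ 2))).contDiffAt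
    exact (Real.contDiffAt_rpow_const_of_ne ht.ne').mul ((h2 ε).sub (h2 R))
  · have : truncProfile n ε R =ᶠ[𝓝 t] fun _ => 0 := by
      have hm : 0 < min (ε ^ 2) (R ^ 2) := by positivity
      filter_upwards [Iio_mem_nhds (ht.trans_lt hm)] with s hs
      have hs' := lt_min_iff.1 (mem_Iio.1 hs)
      exact truncProfile_of_le hε hR hs'.1.le hs'.2.le
    exact contDiffAt_const.congr_of_eventuallyEq this

lemma truncProfile_of_ge {ε R t : ℝ} (hε : 0 < ε) (hR : 0 < R) (h1 : 2 * ε ^ 2 ≤ t)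
    (h2 : 2 * R ^ 2 ≤ t) : truncProfile n ε R t = 0 := by
  rw [truncProfile, step_of_ge ((le_div_iff₀ (by positivity)).2 h1),
    step_of_ge ((le_div_iff₀ (by positivity)).2 h2)]
  simp

/-- Differentiating a cut-off at scale `r` gives the standard rescaling of one fixed profile, so all
the mollifiers have the same mass. -/
lemma mollProfile_div {r t : ℝ} (hr : 0 < r) (ht : 0 < t) :
    2 * t * (t ^ (-(n : ℝ) / 2) * (deriv step (t / r ^ 2) * (1 / r ^ 2))) =
      (r ^ n)⁻¹ * mollProfile n (t / r ^ 2) := by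
  have h1 : (t / r ^ 2) ^ (1 - (n : ℝ) / 2) = t ^ (1 - (n : ℝ) / 2) * (r ^ n * (r ^ 2)⁻¹) := by
    rw [Real.div_rpow ht.le (by positivity), div_eq_mul_inv]
    congr 1
    rw [← Real.rpow_natCast r 2, ← Real.rpow_mul hr.le, ← Real.rpow_neg hr.le, ← Real.rpow_natCast,
      ← Real.rpow_neg hr.le, ← Real.rpow_add hr]
    congr 1; push_cast; ring
  have h2 : t * t ^ (-(n : ℝ) / 2) = t ^ (1 - (n : ℝ) / 2) := by
    rw [sub_eq_add_neg, Real.rpow_add ht, Real.rpow_one, neg_div]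
  rw [mollProfile, h1, ← h2]
  field_simp

/-- The power `t^{-n/2}` drops out and only the derivatives of the two cut-offs survive: a mollifier
at scale `ε` minus one at scale `R`. -/
lemma diracOp_truncProfile {σ : Fin n → Matrix (Fin m) (Fin m) ℂ} (hσ : IsCliffordFamily σ)
    {ε R : ℝ} (hε : 0 < ε) (hR : 0 < R) (x y : Space n) (z : Spinor m) :
    diracOp σ (fun y => truncProfile n ε R (‖y - x‖ ^ 2) • symbol σ (y - x) z) y =
      (-Complex.I) • (((ε ^ n)⁻¹ * mollProfile n (‖y - x‖ ^ 2 / ε ^ 2) -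
        (R ^ n)⁻¹ * mollProfile n (‖y - x‖ ^ 2 / R ^ 2)) • z) := by
  -- At the centre the power is not differentiable, but the profile vanishes there and both
  -- mollifiers are zero.
  rcases (sq_nonneg ‖y - x‖).eq_or_lt with h | h
  · rw [diracOp_radial hσ x y z
      ((contDiff_truncProfile hε hR).differentiable (by simp) _).hasDerivAt, ← h,
      truncProfile_of_le hε hR (by positivity) (by positivity)]
    simp [mollProfile_of_lt]
  · rw [diracOp_radial hσ x y z (hasDerivAt_truncProfile h)]
    congr 2
    rw [← mollProfile_div hε h, ← mollProfile_div hR h, truncProfile]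
    have h2 : ‖y - x‖ ^ 2 * (‖y - x‖ ^ 2) ^ (-(n : ℝ) / 2 - 1) = (‖y - x‖ ^ 2) ^ (-(n : ℝ) / 2) := by
      rw [Real.rpow_sub_one h.ne', mul_div_cancel₀ _ h.ne']
    linear_combination (-(n : ℝ) * (step (‖y - x‖ ^ 2 / ε ^ 2) - step (‖y - x‖ ^ 2 / R ^ 2))) * h2

end CriticalDirac

end

/-! ### Limits of the mollifiers and finiteness of Riesz potentials. -/

noncomputable section

namespace CriticalDirac

open Set Metric Filter Topology
open scoped ENNReal

variable {n m : ℕ}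

/-- The mollifier at scale `r` belonging to the truncated fundamental solution. -/
def moll (r : ℝ) (w : Space n) : ℝ := (r ^ n)⁻¹ * mollProfile n (‖w‖ ^ 2 / r ^ 2)

/-- The total mass of the mollifiers. -/
def mollMass (n : ℕ) : ℝ := ∫ w : Space n, mollProfile n (‖w‖ ^ 2)

lemma continuous_moll (r : ℝ) : Continuous fun w : Space n => moll r w :=
  continuous_const.mul ((continuous_mollProfile n).comp ((continuous_norm.pow 2).div_const _))

lemma moll_eq_zero {r : ℝ} (hr : 0 < r) {w : Space n} (hw : 2 * r ≤ ‖w‖) : moll r w = 0 := by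
  rw [moll, mollProfile_of_gt, mul_zero]
  rw [lt_div_iff₀ (by positivity)]
  nlinarith

lemma hasCompactSupport_moll {r : ℝ} (hr : 0 < r) :
    HasCompactSupport fun w : Space n => moll r w := by
  refine HasCompactSupport.intro (isCompact_closedBall (0 : Space n) (2 * r)) fun w hw => ?_
  have : 2 * r < ‖w‖ := by simpa using hw
  exact moll_eq_zero hr this.le

lemma mollMass_pos (hn : 1 ≤ n) : 0 < mollMass n := by
  have := nontrivial_space hn
  have e : ∀ w : Space n, mollProfile n (‖w‖ ^ 2) = moll 1 w := fun w => by simp [moll]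
  rw [mollMass]
  have hs : HasCompactSupport fun w : Space n => mollProfile n (‖w‖ ^ 2) := by
    simp only [e]; exact hasCompactSupport_moll one_pos
  have hc : Continuous fun w : Space n => mollProfile n (‖w‖ ^ 2) := by
    simp only [e]; exact continuous_moll 1
  -- The mean value theorem supplies a point where `step` has derivative one; the mollifier is
  -- positive on the corresponding sphere.
  obtain ⟨t, ht, hd⟩ := exists_deriv_eq_slope step (a := 1) (b := 2) (by norm_num)
    contDiff_step.continuous.continuousOn (contDiff_step.differentiable (by simp)).differentiableOn
  rw [step_of_le le_rfl, step_of_ge le_rfl] at hd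
  obtain ⟨v, hv⟩ := exists_norm_eq (Space n) (Real.sqrt_nonneg t)
  have ht0 : 0 < t := by linarith [ht.1]
  refine hc.integral_pos_of_hasCompactSupport_nonneg_nonzero hs
    (fun w => mollProfile_nonneg (sq_nonneg _)) (x := v) ?_
  rw [hv, Real.sq_sqrt ht0.le, mollProfile, hd]
  have : 0 < t ^ (1 - (n : ℝ) / 2) := Real.rpow_pos_of_pos ht0 _
  norm_num
  exact this.ne'

lemma integral_moll {r : ℝ} (hr : 0 < r) (x : Space n) :
    ∫ y : Space n, moll r (y - x) = mollMass n := by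
  rw [integral_sub_right_eq_self (fun w => moll r w) x]
  have h := Measure.integral_comp_inv_smul (volume : Measure (Space n))
    (fun w => mollProfile n (‖w‖ ^ 2)) r
  have hf : Module.finrank ℝ (Space n) = n := by simp
  rw [hf, abs_of_pos (by positivity)] at h
  have e : ∀ w : Space n, moll r w = (r ^ n)⁻¹ * mollProfile n (‖r⁻¹ • w‖ ^ 2) := by
    intro w
    rw [moll, norm_smul, mul_pow, norm_inv, inv_pow, Real.norm_of_nonneg hr.le, div_eq_inv_mul]
  simp only [e]
  rw [integral_const_mul, h, mollMass, smul_eq_mul, ← mul_assoc,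
    inv_mul_cancel₀ (by positivity), one_mul]

lemma integrable_moll_smul {r : ℝ} (hr : 0 < r) (x : Space n) {ψ : Space n → Spinor m}
    (hψ : LocallyIntegrable ψ) : Integrable fun y => moll r (y - x) • ψ y := by
  refine hψ.integrable_smul_left_of_hasCompactSupport
    ((continuous_moll r).comp (continuous_id.sub continuous_const)) ?_
  exact (hasCompactSupport_moll hr).comp_homeomorph (Homeomorph.subRight x)

/-- The mollifier is at most a constant times `r^{-n}` and lives on the ball of radius `2r`, so the
error is controlled by the mean oscillation. -/
lemma tendsto_moll_of_lebesgue_point {ψ : Space n → Spinor m} (hψ : LocallyIntegrable ψ) {x : Space n}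
    {ε : ℕ → ℝ} (hε : ∀ k, 0 < ε k)
    (hx : Tendsto (fun k => ⨍ y in closedBall x (2 * ε k), ‖ψ y - ψ x‖) atTop (𝓝 0)) :
    Tendsto (fun k => ∫ y, moll (ε k) (y - x) • ψ y) atTop (𝓝 (mollMass n • ψ x)) := by
  obtain ⟨B, hB, hb⟩ := mollProfile_bounded n
  rw [tendsto_iff_norm_sub_tendsto_zero]
  set v := volume.real (ball (0 : Space n) 1)
  have hlim : Tendsto (fun k => B * 2 ^ n * v * ⨍ y in closedBall x (2 * ε k), ‖ψ y - ψ x‖) atTop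
      (𝓝 0) := by simpa using hx.const_mul (B * 2 ^ n * v)
  refine squeeze_zero (fun _ => norm_nonneg _) (fun k => ?_) hlim
  have hr := hε k
  set r := ε k
  have hc : Integrable fun y : Space n => moll r (y - x) • ψ x :=
    (((continuous_moll r).comp (continuous_id.sub continuous_const)).integrable_of_hasCompactSupport
      ((hasCompactSupport_moll hr).comp_homeomorph (Homeomorph.subRight x))).smul_const _
  have e : (∫ y, moll r (y - x) • ψ y) - mollMass n • ψ x =
      ∫ y, moll r (y - x) • (ψ y - ψ x) := by
    rw [← integral_moll hr x, ← integral_smul_const, ← integral_sub (integrable_moll_smul hr x hψ) hc]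
    simp only [smul_sub]
  rw [e]
  have hvol : volume.real (closedBall x (2 * r)) = (2 * r) ^ n * v := by
    rw [measureReal_def, Measure.addHaar_closedBall _ _ (by positivity), ENNReal.toReal_mul,
      ENNReal.toReal_ofReal (by positivity)]
    simp [v, measureReal_def]
  have hint : IntegrableOn (fun y => ‖ψ y - ψ x‖) (closedBall x (2 * r)) := by
    refine Integrable.norm ?_
    exact (hψ.integrableOn_isCompact (isCompact_closedBall _ _)).sub
      (integrableOn_const measure_closedBall_lt_top.ne)
  calc _ ≤ ∫ y, ‖moll r (y - x) • (ψ y - ψ x)‖ := norm_integral_le_integral_norm _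
    _ ≤ ∫ y, (closedBall x (2 * r)).indicator (fun y => (r ^ n)⁻¹ * B * ‖ψ y - ψ x‖) y := by
        refine integral_mono_of_nonneg (Eventually.of_forall fun _ => norm_nonneg _) ?_
          (Eventually.of_forall fun y => ?_)
        · have hint2 : IntegrableOn (fun y => (r ^ n)⁻¹ * B * ‖ψ y - ψ x‖) (closedBall x (2 * r)) :=
            hint.const_mul _
          exact hint2.integrable_indicator measurableSet_closedBall
        · by_cases hy : y ∈ closedBall x (2 * r)
          · rw [indicator_of_mem hy]
            simp only [norm_smul, moll, norm_mul]
            rw [Real.norm_of_nonneg (by positivity : 0 ≤ (r ^ n)⁻¹)]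
            gcongr
            exact hb _
          · rw [indicator_of_notMem hy]
            have : 2 * r < ‖y - x‖ := by simpa [dist_eq_norm] using hy
            simp [moll_eq_zero hr this.le]
    _ = (r ^ n)⁻¹ * B * ∫ y in closedBall x (2 * r), ‖ψ y - ψ x‖ := by
        rw [integral_indicator measurableSet_closedBall, integral_const_mul]
    _ = _ := by
        have hv : v ≠ 0 := (ENNReal.toReal_pos (measure_ball_pos _ _ one_pos).ne'
          measure_ball_lt_top.ne).ne'
        rw [setAverage_eq, hvol, smul_eq_mul, mul_pow]
        field_simp

lemma lintegral_norm_rpow_ne_top {E : Type*} [NormedAddCommGroup E] {ψ : Space n → E} {p : ℝ}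
    (hp : 0 < p) (hψ : MemLp ψ (ENNReal.ofReal p) volume) : ∫⁻ x, ‖ψ x‖ₑ ^ p ≠ ⊤ := by
  have h := lintegral_rpow_enorm_lt_top_of_eLpNorm_lt_top (by simpa using hp) ENNReal.ofReal_ne_top
    hψ.eLpNorm_lt_top
  rw [ENNReal.toReal_ofReal hp.le] at h
  exact h.ne

/-- Hölder's inequality bounds the average by a multiple of `R^{-n/p}`. Integrability thus plays the
role of decay at infinity and excludes an additional homogeneous solution in the representation
formula. -/
lemma tendsto_moll_atTop (hn : 1 ≤ n) {p : ℝ} (hp : 1 < p) {ψ : Space n → Spinor m}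
    (hψ : Measurable ψ) (hψp : ∫⁻ x, ‖ψ x‖ₑ ^ p ≠ ⊤) (x : Space n) {R : ℕ → ℝ} (hR : ∀ k, 0 < R k)
    (hRlim : Tendsto R atTop atTop) :
    Tendsto (fun k => ∫ y, moll (R k) (y - x) • ψ y) atTop (𝓝 0) := by
  have := nontrivial_space hn
  have hn0 : (0 : ℝ) < n := by exact_mod_cast hn
  obtain ⟨B, hB, hb⟩ := mollProfile_bounded n
  set p' := p.conjExponent
  have hc : p.HolderConjugate p' := Real.HolderConjugate.conjExponent hp
  have hp0 : 0 < p := hc.pos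
  have hp'0 : 0 < p' := hc.symm.pos
  set v := volume.real (ball (0 : Space n) 1) with hv
  set N := ((∫⁻ y, ‖ψ y‖ₑ ^ p) ^ (1 / p)).toReal with hN
  have hNtop : (∫⁻ y, ‖ψ y‖ₑ ^ p) ^ (1 / p) ≠ ⊤ := ENNReal.rpow_ne_top_of_nonneg (by positivity) hψp
  have hexp : -(n : ℝ) + n * (1 / p') = -(n / p) := by
    have := hc.inv_add_inv_eq_one
    have h2 : 1 / p' = 1 - 1 / p := by simp only [one_div]; linarith
    rw [h2]; ring
  have bound : ∀ k, ‖∫ y, moll (R k) (y - x) • ψ y‖ ≤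
      B * (2 ^ (n : ℝ) * v) ^ (1 / p') * R k ^ (-((n : ℝ) / p)) * N := by
    intro k
    have hr := hR k
    set r := R k
    have h1 : ‖∫ y, moll r (y - x) • ψ y‖ₑ ≤ ∫⁻ y, (ball (0 : Space n) (2 * r)).indicator
        (fun _ => ENNReal.ofReal ((r ^ n)⁻¹ * B)) (x - y) * ‖ψ y‖ₑ := by
      refine (enorm_integral_le_lintegral_enorm _).trans (lintegral_mono fun y => ?_)
      simp only
      rw [enorm_smul]
      gcongr
      by_cases hy : x - y ∈ ball (0 : Space n) (2 * r)
      · rw [indicator_of_mem hy, ← ofReal_norm, moll, norm_mul,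
          Real.norm_of_nonneg (by positivity : 0 ≤ (r ^ n)⁻¹)]
        refine ENNReal.ofReal_le_ofReal ?_
        gcongr
        exact hb _
      · rw [indicator_of_notMem hy]
        have : 2 * r ≤ ‖y - x‖ := by rw [norm_sub_rev]; simpa using hy
        simp [moll_eq_zero hr this]
    have h2 := h1.trans (lintegral_conv_le_holder (measurable_const.indicator measurableSet_ball)
      hψ.enorm hc x)
    have h3 : (∫⁻ z : Space n, (ball (0 : Space n) (2 * r)).indicator
        (fun _ => ENNReal.ofReal ((r ^ n)⁻¹ * B)) z ^ p') =
        ENNReal.ofReal ((r ^ n)⁻¹ * B) ^ p' * volume (ball (0 : Space n) (2 * r)) := by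
      rw [← setLIntegral_const, ← lintegral_indicator measurableSet_ball]
      refine lintegral_congr fun z => ?_
      by_cases hz : z ∈ ball (0 : Space n) (2 * r)
      · simp only [indicator_of_mem hz]
      · simp only [indicator_of_notMem hz, ENNReal.zero_rpow_of_pos hp'0]
    have hvol : volume (ball (0 : Space n) (2 * r)) = ENNReal.ofReal ((2 * r) ^ (n : ℝ) * v) := by
      rw [Measure.addHaar_ball _ _ (by positivity), ENNReal.ofReal_mul (by positivity), hv,
        ofReal_measureReal measure_ball_lt_top.ne]
      simp
    have hv0 : 0 < v := ENNReal.toReal_pos (measure_ball_pos _ _ one_pos).ne' measure_ball_lt_top.ne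
    rw [h3, hvol, ENNReal.mul_rpow_of_nonneg _ _ (by positivity), ← ENNReal.rpow_mul,
      mul_one_div_cancel hp'0.ne', ENNReal.rpow_one, ← ENNReal.ofReal_toReal hNtop, ← hN,
      ENNReal.ofReal_rpow_of_pos (by positivity), ← ENNReal.ofReal_mul (by positivity),
      ← ENNReal.ofReal_mul (by positivity), ← ofReal_norm,
      ENNReal.ofReal_le_ofReal_iff (by positivity)] at h2
    refine h2.trans (le_of_eq ?_)
    congr 1
    have e1 : ((2 * r) ^ (n : ℝ) * v) ^ (1 / p') =
        (2 ^ (n : ℝ) * v) ^ (1 / p') * r ^ ((n : ℝ) * (1 / p')) := by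
      rw [Real.rpow_mul hr.le, ← Real.mul_rpow (by positivity) (by positivity),
        Real.mul_rpow two_pos.le hr.le, mul_right_comm]
    rw [e1, ← hexp, Real.rpow_add hr, Real.rpow_neg hr.le, Real.rpow_natCast r]
    ring
  have hlim : Tendsto (fun k => B * (2 ^ (n : ℝ) * v) ^ (1 / p') * R k ^ (-((n : ℝ) / p)) * N) atTop
      (𝓝 0) := by
    have h := (tendsto_rpow_neg_atTop (by positivity : 0 < (n : ℝ) / p)).comp hRlim
    have := (h.const_mul (B * (2 ^ (n : ℝ) * v) ^ (1 / p'))).mul_const N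
    simpa using this
  exact squeeze_zero_norm bound hlim

/-- The exponents `(2^♯)'` and `2^♯` differ by exactly `1/n` in their reciprocals, so the weak type
bound applies; letting the level tend to infinity shows that the set of infinite values is null. -/
lemma ae_riesz_lt_top (hn : 2 ≤ n) {f : Space n → ℝ≥0∞} (hf : Measurable f)
    (h1 : ∫⁻ x, f x ^ (critExp n / (critExp n - 1)) ≠ ⊤) :
    ∀ᵐ x, riesz ((n : ℝ) - 1) f x ≠ ⊤ := by
  have hn2 : (2 : ℝ) ≤ n := by exact_mod_cast hn
  have hpp := critExp_sub_two_pos hn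
  set p := critExp n with hp
  set r := p / (p - 1) with hr
  have hp1 : 0 < p - 1 := by linarith
  have hr1 : 1 < r := by rw [hr, one_lt_div hp1]; linarith
  have hinv : 1 / r = 1 - 1 / p := by
    have hp0 : p ≠ 0 := by linarith
    rw [hr]; field_simp
  have hpi : 1 / p = 1 / 2 - 1 / (2 * n) := one_div_critExp hn
  have hnn : 1 / (2 * (n : ℝ)) = 1 / n / 2 := by field_simp
  have hrn : r < n := by
    have hn4 : 1 / (n : ℝ) ≤ 1 / 2 := one_div_le_one_div_of_le two_pos hn2
    have h3 : 1 / (n : ℝ) < 1 / r := by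
      have : 0 < 1 / (n : ℝ) := by positivity
      linarith
    exact (one_div_lt_one_div (by linarith) (by linarith)).1 h3
  obtain ⟨C, hC, H⟩ := riesz_weak_type (n := n) (by omega) hr1 hrn (q := p) (by linarith)
  rw [ae_iff]
  simp only [not_not]
  have hfin : ENNReal.ofReal C * (∫⁻ y, f y ^ r) ^ (p / r) ≠ ⊤ :=
    ENNReal.mul_ne_top ENNReal.ofReal_ne_top
      (ENNReal.rpow_ne_top_of_nonneg (div_nonneg (by linarith) (by linarith)) h1)
  have hle : ∀ t : ℝ, 0 < t → volume {x | riesz ((n : ℝ) - 1) f x = ⊤} ≤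
      ENNReal.ofReal (t ^ (-p)) * (ENNReal.ofReal C * (∫⁻ y, f y ^ r) ^ (p / r)) := by
    intro t ht
    refine (measure_mono fun x hx => ?_).trans (H f hf t ht)
    have hx' : riesz ((n : ℝ) - 1) f x = ⊤ := hx
    simp [hx']
  have hlim : Tendsto (fun t : ℝ => ENNReal.ofReal (t ^ (-p)) *
      (ENNReal.ofReal C * (∫⁻ y, f y ^ r) ^ (p / r))) atTop (𝓝 0) := by
    have h2 : Tendsto (fun t : ℝ => ENNReal.ofReal (t ^ (-p))) atTop (𝓝 0) := by
      have := ENNReal.tendsto_ofReal (tendsto_rpow_neg_atTop (by linarith : 0 < p))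
      simpa using this
    simpa using ENNReal.Tendsto.mul_const h2 (Or.inr hfin)
  refine le_antisymm (ge_of_tendsto hlim ?_) zero_le
  filter_upwards [eventually_gt_atTop 0] with t ht
  exact hle t ht

end CriticalDirac

end

/-! ### Representation of weak solutions by potentials. -/

noncomputable section

namespace CriticalDirac

open Set Metric Filter Topology
open scoped ENNReal

variable {n m : ℕ}

lemma contDiff_radial_smul (σ : Fin n → Matrix (Fin m) (Fin m) ℂ) {κ : ℝ → ℝ}
    (hκ : ContDiff ℝ ∞ κ) (x : Space n) (z : Spinor m) :
    ContDiff ℝ ∞ fun y : Space n => κ (‖y - x‖ ^ 2) • symbol σ (y - x) z := by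
  have h1 : ContDiff ℝ ∞ fun y : Space n => ‖y - x‖ ^ 2 := (contDiff_id.sub contDiff_const).norm_sq ℝ
  set L := (ContinuousLinearMap.apply ℝ (Spinor m) z).comp
          ((ContinuousLinearMap.restrictScalarsL ℂ (Spinor m) (Spinor m) ℝ ℝ).comp
            (LinearMap.toContinuousLinearMap (symbol σ)))
  have h2 : ContDiff ℝ ∞ fun y : Space n => L (y - x) :=
    L.contDiff.comp (contDiff_id.sub contDiff_const)
  exact (hκ.comp h1).smul h2

lemma hasCompactSupport_radial_smul (σ : Fin n → Matrix (Fin m) (Fin m) ℂ) {κ : ℝ → ℝ} {T : ℝ}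
    (hκ : ∀ t, T ^ 2 ≤ t → κ t = 0) (x : Space n) (z : Spinor m) :
    HasCompactSupport fun y : Space n => κ (‖y - x‖ ^ 2) • symbol σ (y - x) z := by
  refine HasCompactSupport.intro (isCompact_closedBall x |T|) fun y hy => ?_
  have h : |T| < ‖y - x‖ := by simpa [dist_eq_norm] using hy
  have h2 : T ^ 2 ≤ ‖y - x‖ ^ 2 := by rw [← sq_abs T]; gcongr
  rw [hκ _ h2, zero_smul]

lemma abs_truncProfile_le {ε R t : ℝ} (ht : 0 ≤ t) : |truncProfile n ε R t| ≤ t ^ (-(n : ℝ) / 2) := by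
  rw [truncProfile, abs_mul, abs_of_nonneg (Real.rpow_nonneg ht _)]
  refine mul_le_of_le_one_right (Real.rpow_nonneg ht _) ?_
  rw [abs_le]
  constructor <;> linarith [step_nonneg (t / ε ^ 2), step_le_one (t / ε ^ 2),
    step_nonneg (t / R ^ 2), step_le_one (t / R ^ 2)]

lemma sq_rpow_neg_half {a : ℝ} (ha : 0 ≤ a) (n : ℕ) : (a ^ 2) ^ (-(n : ℝ) / 2) = (a ^ n)⁻¹ := by
  rw [← Real.rpow_natCast a 2, ← Real.rpow_mul ha, ← Real.rpow_natCast a n, ← Real.rpow_neg ha]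
  congr 1
  push_cast
  ring

lemma norm_truncProfile_smul_le (σ : Fin n → Matrix (Fin m) (Fin m) ℂ) (ε R : ℝ) (x y : Space n)
    (z : Spinor m) :
    ‖truncProfile n ε R (‖y - x‖ ^ 2) • symbol σ (y - x) z‖ ≤ ‖kern σ (x - y) z‖ := by
  rw [kern, norm_smul, norm_smul, ← neg_sub y x, norm_neg, map_neg, _root_.neg_apply, norm_neg,
    ← sq_rpow_neg_half (norm_nonneg _), Real.norm_eq_abs, Real.norm_eq_abs,
    abs_of_nonneg (Real.rpow_nonneg (sq_nonneg ‖y - x‖) _)]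
  exact mul_le_mul_of_nonneg_right (abs_truncProfile_le (sq_nonneg _)) (norm_nonneg _)

lemma truncProfile_smul_eq (σ : Fin n → Matrix (Fin m) (Fin m) ℂ) {ε R : ℝ} {x y : Space n}
    (z : Spinor m) (hε : 0 < ε) (hR : 0 < R) (h1 : 2 * ε ≤ ‖y - x‖) (h2 : ‖y - x‖ ≤ R) :
    truncProfile n ε R (‖y - x‖ ^ 2) • symbol σ (y - x) z = -kern σ (x - y) z := by
  have h3 : step (‖y - x‖ ^ 2 / ε ^ 2) = 1 := by
    refine step_of_ge ?_
    rw [le_div_iff₀ (by positivity)]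
    calc 2 * ε ^ 2 ≤ (2 * ε) ^ 2 := by nlinarith [sq_nonneg ε]
      _ ≤ _ := by gcongr
  have h4 : step (‖y - x‖ ^ 2 / R ^ 2) = 0 := by
    refine step_of_le ?_
    rw [div_le_one (by positivity)]; gcongr
  rw [truncProfile, h3, h4, sub_zero, mul_one, sq_rpow_neg_half (norm_nonneg _), kern,
    ← neg_sub y x, norm_neg, map_neg, _root_.neg_apply, smul_neg, neg_neg]

lemma measurable_truncProfile_smul (σ : Fin n → Matrix (Fin m) (Fin m) ℂ) {ε R : ℝ}
    {f : Space n → Spinor m} (hf : Measurable f) (hε : 0 < ε) (hR : 0 < R) (x : Space n) :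
    Measurable fun y => truncProfile n ε R (‖y - x‖ ^ 2) • symbol σ (y - x) (f y) := by
  have h1 : Measurable fun y : Space n => y - x := measurable_id.sub_const x
  have h2 : Measurable fun y : Space n => ‖y - x‖ ^ 2 := h1.norm.pow_const 2
  have h3 : Measurable (truncProfile n ε R) := (contDiff_truncProfile hε hR).continuous.measurable
  have h4 : Measurable fun y : Space n => (y - x, f y) := h1.prodMk hf
  have hm1 := h3.comp h2
  have hm2 := (continuous_symbol_apply σ).measurable.comp h4
  simp only [Function.comp_def] at hm1 hm2
  exact hm1.smul hm2

lemma integrable_truncProfile_smul {σ : Fin n → Matrix (Fin m) (Fin m) ℂ} (hσ : IsCliffordFamily σ)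
    {ε R : ℝ} {f : Space n → Spinor m} (hf : Measurable f) (hε : 0 < ε) (hR : 0 < R) {x : Space n}
    (hx : riesz ((n : ℝ) - 1) (fun y => ‖f y‖ₑ) x ≠ ⊤) :
    Integrable fun y => truncProfile n ε R (‖y - x‖ ^ 2) • symbol σ (y - x) (f y) :=
  (integrable_kern hσ hf hx).mono (measurable_truncProfile_smul σ hf hε hR x).aestronglyMeasurable
    (Eventually.of_forall fun y => norm_truncProfile_smul_le σ ε R x y (f y))

/-- Dominated convergence with the full kernel as majorant. The sign reflects the oddness of the
kernel, the truncated field being written in `y - x`. -/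
lemma tendsto_integral_truncProfile_smul (hn : 1 ≤ n) {σ : Fin n → Matrix (Fin m) (Fin m) ℂ}
    (hσ : IsCliffordFamily σ) {f : Space n → Spinor m} (hf : Measurable f) {ε R : ℕ → ℝ}
    (hε : ∀ k, 0 < ε k) (hR : ∀ k, 0 < R k) (hεlim : Tendsto ε atTop (𝓝 0))
    (hRlim : Tendsto R atTop atTop) {x : Space n}
    (hx : riesz ((n : ℝ) - 1) (fun y => ‖f y‖ₑ) x ≠ ⊤) :
    Tendsto (fun k => ∫ y, truncProfile n (ε k) (R k) (‖y - x‖ ^ 2) • symbol σ (y - x) (f y)) atTop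
      (𝓝 (- potential σ f x)) := by
  rw [potential, ← integral_neg]
  refine tendsto_integral_of_dominated_convergence _
    (fun k => (measurable_truncProfile_smul σ hf (hε k) (hR k) x).aestronglyMeasurable)
    (integrable_kern hσ hf hx).norm
    (fun k => Eventually.of_forall fun y => norm_truncProfile_smul_le σ _ _ x y (f y)) ?_
  filter_upwards [ae_sub_ne_zero hn x] with y hy
  have hpos : 0 < ‖y - x‖ := by rw [norm_sub_rev]; exact norm_pos_iff.2 hy
  refine tendsto_const_nhds.congr' ?_
  have e1 : ∀ᶠ k in atTop, 2 * ε k ≤ ‖y - x‖ :=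
    ((hεlim.const_mul 2).eventually_lt_const (by simpa using hpos)).mono fun _ h => h.le
  have e2 : ∀ᶠ k in atTop, ‖y - x‖ ≤ R k := hRlim.eventually_ge_atTop _
  filter_upwards [e1, e2] with k hk1 hk2
  exact (truncProfile_smul_eq σ (f y) (hε k) (hR k) hk1 hk2).symm

/-- The weak equation is tested with the truncated fundamental solution centred at `x` and applied
to an arbitrary spinor `z`; removing `z` leaves an identity of vectors. -/
lemma weak_eq_truncProfile {σ : Fin n → Matrix (Fin m) (Fin m) ℂ} (hσ : IsCliffordFamily σ)
    {ψ f : Space n → Spinor m} (hf : Measurable f) (hloc : LocallyIntegrable ψ)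
    (hw : ∀ φ : Space n → Spinor m, ContDiff ℝ ∞ φ → HasCompactSupport φ →
      ∫ x, inner ℂ (diracOp σ φ x) (ψ x) = ∫ x, inner ℂ (φ x) (f x))
    {ε R : ℝ} (hε : 0 < ε) (hR : 0 < R) (hεR : ε ≤ R) {x : Space n}
    (hx : riesz ((n : ℝ) - 1) (fun y => ‖f y‖ₑ) x ≠ ⊤) :
    Complex.I • ((∫ y, moll ε (y - x) • ψ y) - ∫ y, moll R (y - x) • ψ y) =
      ∫ y, truncProfile n ε R (‖y - x‖ ^ 2) • symbol σ (y - x) (f y) := by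
  refine ext_inner_left ℂ fun z => ?_
  have h := hw _ (contDiff_radial_smul σ (contDiff_truncProfile hε hR) x z)
    (hasCompactSupport_radial_smul σ (κ := truncProfile n ε R) (T := 2 * R) (fun t ht => by
      have h3 : ε ^ 2 ≤ R ^ 2 := by gcongr
      exact truncProfile_of_ge hε hR (by nlinarith) (by nlinarith)) x z)
  have hi1 := integrable_moll_smul hε x hloc
  have hi2 := integrable_moll_smul hR x hloc
  have hi3 : Integrable fun y => moll ε (y - x) • ψ y - moll R (y - x) • ψ y := hi1.sub hi2
  rw [← integral_sub hi1 hi2, inner_smul_right, ← integral_inner hi3,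
    ← integral_inner (integrable_truncProfile_smul hσ hf hε hR hx), ← integral_const_mul]
  refine Eq.trans (integral_congr_ae (Eventually.of_forall fun y => ?_))
    (h.trans (integral_congr_ae (Eventually.of_forall fun y => ?_)))
  · simp only
    rw [diracOp_truncProfile hσ hε hR, inner_smul_left, ← sub_smul, real_smul_eq,
      real_smul_eq, inner_smul_left, inner_smul_right, Complex.conj_ofReal, moll, moll]
    simp
  · simp only
    rw [real_smul_eq, real_smul_eq, inner_smul_left, inner_smul_right, Complex.conj_ofReal,
      inner_symbol]

/-- A solution of the inhomogeneous Dirac equation is the potential of the right-hand side. -/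
theorem ae_eq_potential (hn : 2 ≤ n) {σ : Fin n → Matrix (Fin m) (Fin m) ℂ} (hσ : IsCliffordFamily σ)
    {ψ f : Space n → Spinor m} (hψ : Measurable ψ) (hf : Measurable f)
    (hψp : MemLp ψ (ENNReal.ofReal (critExp n)))
    (h1 : ∫⁻ x, ‖f x‖ₑ ^ (critExp n / (critExp n - 1)) ≠ ⊤)
    (hw : ∀ φ : Space n → Spinor m, ContDiff ℝ ∞ φ → HasCompactSupport φ →
      ∫ x, inner ℂ (diracOp σ φ x) (ψ x) = ∫ x, inner ℂ (φ x) (f x)) :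
    ∀ᵐ x, ψ x = (Complex.I / (mollMass n : ℂ)) • potential σ f x := by
  have hpp := critExp_sub_two_pos hn
  have hp1 : 1 < critExp n := by linarith
  have hloc : LocallyIntegrable ψ := hψp.locallyIntegrable (by
    rw [← ENNReal.ofReal_one]; exact ENNReal.ofReal_le_ofReal hp1.le)
  have hψp' := lintegral_norm_rpow_ne_top (by linarith) hψp
  obtain ⟨ε, hεdef⟩ : ∃ ε : ℕ → ℝ, ε = fun k : ℕ => 1 / ((k : ℝ) + 1) := ⟨_, rfl⟩
  obtain ⟨R, hRdef⟩ : ∃ R : ℕ → ℝ, R = fun k : ℕ => (k : ℝ) + 1 := ⟨_, rfl⟩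
  have hε : ∀ k, 0 < ε k := fun k => by rw [hεdef]; positivity
  have hR : ∀ k, 0 < R k := fun k => by rw [hRdef]; positivity
  have hεlim : Tendsto ε atTop (𝓝 0) := hεdef ▸ tendsto_one_div_add_atTop_nhds_zero_nat
  have hRlim : Tendsto R atTop atTop := hRdef ▸
    tendsto_atTop_add_const_right _ _ tendsto_natCast_atTop_atTop
  have hεR : ∀ k, ε k ≤ R k := fun k => by
    rw [hεdef, hRdef]
    simp only
    rw [div_le_iff₀ (by positivity)]
    nlinarith [(Nat.cast_nonneg k : (0 : ℝ) ≤ k)]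
  -- The formula holds at every Lebesgue point of `ψ` where the Riesz potential of `|f|` is finite.
  filter_upwards [ae_riesz_lt_top hn hf.enorm h1,
    IsUnifLocDoublingMeasure.ae_tendsto_average_norm_sub volume hloc 1] with x hx hleb
  have hδ : Tendsto (fun k => 2 * ε k) atTop (𝓝[>] 0) := by
    refine tendsto_nhdsWithin_iff.2 ⟨by simpa using hεlim.const_mul 2, ?_⟩
    exact Eventually.of_forall fun k => mul_pos two_pos (hε k)
  have hmoll := (tendsto_moll_of_lebesgue_point hloc hε (hleb (fun _ => x) (fun k => 2 * ε k) hδ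
    (Eventually.of_forall fun k => by
      have := hε k
      rw [one_mul]
      exact mem_closedBall_self (by positivity)))).sub
    (tendsto_moll_atTop (by omega) hp1 hψ hψp' x hR hRlim)
  rw [sub_zero] at hmoll
  have hc : (mollMass n : ℂ) ≠ 0 := by exact_mod_cast (mollMass_pos (by omega)).ne'
  have huniq := tendsto_nhds_unique ((hmoll.const_smul Complex.I).congr fun k =>
    weak_eq_truncProfile hσ hf hloc hw (hε k) (hR k) (hεR k) hx)
    (tendsto_integral_truncProfile_smul (by omega) hσ hf hε hR hεlim hRlim hx)
  have e : potential σ f x = -(Complex.I • mollMass n • ψ x) := by rw [huniq, neg_neg]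
  rw [e, real_smul_eq, smul_neg, smul_smul, smul_smul, ← neg_smul]
  have : -(Complex.I / (mollMass n : ℂ) * (Complex.I * (mollMass n : ℂ))) = 1 := by
    field_simp
    simp
  rw [mul_assoc, this, one_smul]

end CriticalDirac

end

/-! ### Test functions as potentials. -/

noncomputable section

namespace CriticalDirac

open Set Metric Filter Topology
open scoped ENNReal

variable {n m : ℕ}

/-- The sesquilinear form `⟪z, σ(e) w⟫` as a real bilinear map. -/
def symbolForm (σ : Fin n → Matrix (Fin m) (Fin m) ℂ) (e : Space n) :
    Spinor m →L[ℝ] Spinor m →L[ℝ] ℂ :=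
  ContinuousLinearMap.bilinearComp
    (isBoundedBilinearMap_inner (𝕜 := ℂ) (E := Spinor m)).toContinuousLinearMap
    (ContinuousLinearMap.id ℝ (Spinor m)) ((symbol σ e).restrictScalars ℝ)

lemma symbolForm_apply (σ : Fin n → Matrix (Fin m) (Fin m) ℂ) (e : Space n) (z w : Spinor m) :
    symbolForm σ e z w = inner ℂ z (symbol σ e w) := rfl

lemma continuous_fderiv_apply {φ : Space n → Spinor m} (hφ : ContDiff ℝ ∞ φ) (e : Space n) :
    Continuous fun x => fderiv ℝ φ x e :=
  (hφ.continuous_fderiv (by simp)).clm_apply continuous_const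

lemma integrable_symbolForm (σ : Fin n → Matrix (Fin m) (Fin m) ℂ) (e : Space n)
    {f g : Space n → Spinor m} (hf : Continuous f) (hg : Continuous g) (hgc : HasCompactSupport g) :
    Integrable fun x => symbolForm σ e (f x) (g x) := by
  have h1 : Continuous fun x => symbolForm σ e (f x) (g x) :=
    ((symbolForm σ e).continuous.comp hf).clm_apply hg
  refine h1.integrable_of_hasCompactSupport (hgc.mono ?_)
  intro x hx hx'
  simp [hx'] at hx

/-- The Dirac operator is symmetric, so a test function is a weak solution with its own image as
right-hand side and `ae_eq_potential` applies to it. -/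
lemma integral_diracOp_inner (σ : Fin n → Matrix (Fin m) (Fin m) ℂ) {φ v : Space n → Spinor m}
    (hφ : ContDiff ℝ ∞ φ) (hv : ContDiff ℝ ∞ v) (hvc : HasCompactSupport v) :
    ∫ x, inner ℂ (diracOp σ φ x) (v x) = ∫ x, inner ℂ (φ x) (diracOp σ v x) := by
  have hvd : ∀ e, HasCompactSupport fun x => fderiv ℝ v x e := fun e =>
    (hvc.fderiv_apply ℝ e)
  have h1 : ∀ j : Fin n, Integrable fun x => symbolForm σ (EuclideanSpace.single j 1)
      (fderiv ℝ φ x (EuclideanSpace.single j 1)) (v x) := fun j =>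
    integrable_symbolForm σ _ (continuous_fderiv_apply hφ _) hv.continuous hvc
  have h2 : ∀ j : Fin n, Integrable fun x => symbolForm σ (EuclideanSpace.single j 1)
      (φ x) (fderiv ℝ v x (EuclideanSpace.single j 1)) := fun j =>
    integrable_symbolForm σ _ hφ.continuous (continuous_fderiv_apply hv _) (hvd _)
  have h3 : ∀ j : Fin n, ∫ x, symbolForm σ (EuclideanSpace.single j 1)
      (φ x) (fderiv ℝ v x (EuclideanSpace.single j 1)) =
      - ∫ x, symbolForm σ (EuclideanSpace.single j 1)
      (fderiv ℝ φ x (EuclideanSpace.single j 1)) (v x) := fun j =>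
    integral_bilinear_fderiv_right_eq_neg_left_of_integrable (h1 j) (h2 j)
      (integrable_symbolForm σ _ hφ.continuous hv.continuous hvc)
      (fun x _ => (hφ.differentiable (by simp)) x) (fun x _ => (hv.differentiable (by simp)) x)
  have e1 : ∀ x, inner ℂ (diracOp σ φ x) (v x) = Complex.I * ∑ j, symbolForm σ
      (EuclideanSpace.single j 1) (fderiv ℝ φ x (EuclideanSpace.single j 1)) (v x) := fun x => by
    rw [diracOp_eq, inner_smul_left, sum_inner]
    simp [symbolForm_apply, inner_symbol]
  have e2 : ∀ x, inner ℂ (φ x) (diracOp σ v x) = -Complex.I * ∑ j, symbolForm σ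
      (EuclideanSpace.single j 1) (φ x) (fderiv ℝ v x (EuclideanSpace.single j 1)) := fun x => by
    rw [diracOp_eq, inner_smul_right, inner_sum]
    simp [symbolForm_apply]
  simp only [e1, e2]
  rw [integral_const_mul, integral_const_mul, integral_finsetSum _ fun j _ => h1 j,
    integral_finsetSum _ fun j _ => h2 j]
  simp only [h3, Finset.sum_neg_distrib]
  ring

lemma continuous_diracOp (σ : Fin n → Matrix (Fin m) (Fin m) ℂ) {v : Space n → Spinor m}
    (hv : ContDiff ℝ ∞ v) : Continuous (diracOp σ v) := by
  have e : diracOp σ v = fun x => (-Complex.I) • ∑ j, symbol σ (EuclideanSpace.single j 1)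
      (fderiv ℝ v x (EuclideanSpace.single j 1)) := funext (diracOp_eq σ v)
  rw [e]
  refine Continuous.const_smul (continuous_finsetSum _ fun j _ => ?_) (-Complex.I)
  exact (symbol σ _).continuous.comp (continuous_fderiv_apply hv _)

lemma hasCompactSupport_diracOp (σ : Fin n → Matrix (Fin m) (Fin m) ℂ) {v : Space n → Spinor m}
    (hvc : HasCompactSupport v) : HasCompactSupport (diracOp σ v) := by
  refine HasCompactSupport.mono' (hvc.fderiv ℝ) fun x hx => subset_tsupport _ fun h => hx ?_
  rw [diracOp_eq, h]
  simp

lemma lintegral_enorm_rpow_ne_top_of_hasCompactSupport {g : Space n → Spinor m} (hg : Continuous g)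
    (hgc : HasCompactSupport g) {p : ℝ} (hp : 0 < p) : ∫⁻ x, ‖g x‖ₑ ^ p ≠ ⊤ :=
  lintegral_norm_rpow_ne_top hp (hg.memLp_of_hasCompactSupport hgc)

lemma enorm_bounded_of_hasCompactSupport {g : Space n → Spinor m} (hg : Continuous g)
    (hgc : HasCompactSupport g) : ∃ M : ℝ≥0∞, M ≠ ⊤ ∧ ∀ x, ‖g x‖ₑ ≤ M := by
  obtain ⟨C, hC⟩ := hgc.exists_bound_of_continuous hg
  refine ⟨ENNReal.ofReal C, ENNReal.ofReal_ne_top, fun x => ?_⟩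
  rw [← ofReal_norm]
  exact ENNReal.ofReal_le_ofReal (hC x)

/-- A test function is the potential of its image under the Dirac operator. -/
theorem eq_potential_diracOp (hn : 2 ≤ n) {σ : Fin n → Matrix (Fin m) (Fin m) ℂ}
    (hσ : IsCliffordFamily σ) {v : Space n → Spinor m} (hv : ContDiff ℝ ∞ v)
    (hvc : HasCompactSupport v) (x : Space n) :
    v x = (Complex.I / (mollMass n : ℂ)) • potential σ (diracOp σ v) x := by
  have hpp := critExp_sub_two_pos hn
  have hp' : 0 < critExp n / (critExp n - 1) := div_pos (by linarith) (by linarith)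
  have hc := continuous_diracOp σ hv
  have hcc := hasCompactSupport_diracOp σ hvc
  have h1 := lintegral_enorm_rpow_ne_top_of_hasCompactSupport hc hcc hp'
  obtain ⟨M, hM, hb⟩ := enorm_bounded_of_hasCompactSupport hc hcc
  -- Any Hölder exponent would do: continuity of the potential turns the almost everywhere identity
  -- into one at every point.
  obtain ⟨C, -, hC⟩ := holder_potential hn hσ hc.measurable h1 hM (Eventually.of_forall hb)
    (β := 1 / 2) (by norm_num) (by norm_num)
  have hpc : Continuous (potential σ (diracOp σ v)) := continuous_of_holder (by norm_num) hC
  have hae := ae_eq_potential hn hσ hv.continuous.measurable hc.measurable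
    (hv.continuous.memLp_of_hasCompactSupport hvc) h1
    (fun φ hφ _ => integral_diracOp_inner σ hφ hv hvc)
  have hcs : Continuous fun x => (Complex.I / (mollMass n : ℂ)) • potential σ (diracOp σ v) x :=
    hpc.const_smul (Complex.I / (mollMass n : ℂ))
  exact congrFun ((hv.continuous.ae_eq_iff_eq volume hcs).1 hae) x

end CriticalDirac

end

/-! ### Growth, Hölder continuity and equivariance of the nonlinearity. -/

noncomputable section

namespace CriticalDirac

open Set Metric Filter Topology
open scoped ENNReal

variable {n m : ℕ}

lemma act_sub (A : SpinorMatrix m) (z w : Spinor m) : act A (z - w) = act A z - act A w := by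
  simp [act_eq]

lemma sub_act (A B : SpinorMatrix m) (z : Spinor m) : act (A - B) z = act A z - act B z := by
  simp [act_eq]

lemma act_zero (A : SpinorMatrix m) : act A 0 = 0 := by
  simp [act_eq]

lemma act_real_smul (A : SpinorMatrix m) (c : ℝ) (z : Spinor m) : act A (c • z) = c • act A z := by
  rw [real_smul_eq, act_smul, ← real_smul_eq]

lemma opNorm_le_sub_add (A B : SpinorMatrix m) : opNorm A ≤ opNorm (A - B) + opNorm B := by
  simp only [opNorm, map_sub]
  have := norm_add_le (Matrix.toEuclideanCLM (n := Fin m ⊕ Fin m) (𝕜 := ℂ) A -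
    Matrix.toEuclideanCLM (n := Fin m ⊕ Fin m) (𝕜 := ℂ) B)
    (Matrix.toEuclideanCLM (n := Fin m ⊕ Fin m) (𝕜 := ℂ) B)
  rwa [sub_add_cancel] at this

lemma holderExp_pos (hn : 2 ≤ n) : 0 < holderExp n := by
  have h2 : (2 : ℝ) ≤ n := by exact_mod_cast hn
  exact lt_min (div_pos two_pos (by linarith)) one_pos

lemma holderExp_le_one : holderExp n ≤ 1 := min_le_right _ _

/-- The nonlinearity `z ↦ h(z) z`. -/
def nonlin (n : ℕ) (H : Spinor m → SpinorMatrix m) (z : Spinor m) : Spinor m :=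
  act (homogeneousNonlinearity n H z) z

/-- The function `z ↦ H(z) z`. -/
def sphereMap (H : Spinor m → SpinorMatrix m) (z : Spinor m) : Spinor m := act (H z) z

lemma nonlin_zero (n : ℕ) (H : Spinor m → SpinorMatrix m) : nonlin n H 0 = 0 := act_zero _

lemma nonlin_eq (H : Spinor m → SpinorMatrix m) {z : Spinor m} (hz : z ≠ 0) :
    nonlin n H z = ‖z‖ ^ (critExp n - 1) • sphereMap H (‖z‖⁻¹ • z) := by
  have h0 : 0 < ‖z‖ := norm_pos_iff.2 hz
  rw [nonlin, homogeneousNonlinearity, smul_act, sphereMap, act_real_smul, smul_smul,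
    ← real_smul_eq, ← real_smul_eq]
  congr 1
  rw [← Real.rpow_neg_one, ← Real.rpow_add h0]
  congr 1; ring

lemma norm_normalize {z : Spinor m} (hz : z ≠ 0) : ‖‖z‖⁻¹ • z‖ = 1 := by
  rw [norm_smul, norm_inv, norm_norm, inv_mul_cancel₀ (norm_ne_zero_iff.2 hz)]

lemma nonlin_real_smul (H : Spinor m → SpinorMatrix m) {c : ℝ} (hc : 0 < c) (z : Spinor m) :
    nonlin n H (c • z) = c ^ (critExp n - 1) • nonlin n H z := by
  rcases eq_or_ne z 0 with rfl | hz
  · rw [smul_zero, nonlin_zero, smul_zero]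
  · rw [nonlin_eq H hz, nonlin_eq H (smul_ne_zero hc.ne' hz), norm_smul, Real.norm_of_nonneg hc.le,
      Real.mul_rpow hc.le (norm_nonneg _), smul_smul, smul_smul, mul_inv, mul_right_comm,
      inv_mul_cancel₀ hc.ne', one_mul]

lemma rpow_bound_of_le {d D γ : ℝ} (hd : 0 ≤ d) (hdD : d ≤ D) (hγ : 0 < γ) (hγ1 : γ ≤ 1) :
    d ≤ D ^ (1 - γ) * d ^ γ := by
  rcases hd.eq_or_lt with rfl | h
  · rw [Real.zero_rpow hγ.ne', mul_zero]
  · calc d = d ^ (1 - γ) * d ^ γ := by rw [← Real.rpow_add h]; simp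
      _ ≤ _ := by
        gcongr

/-- Hölder continuity on a set of diameter at most two gives boundedness of `H`; the Lipschitz
factor `z` is `γ`-Hölder there because `γ ≤ 1`. -/
lemma sphereMap_bounds (hn : 2 ≤ n) {σ : Fin n → Matrix (Fin m) (Fin m) ℂ}
    {H : Spinor m → SpinorMatrix m} (hH : IsAdmissible σ H) :
    ∃ C : ℝ, 0 ≤ C ∧ (∀ z, ‖z‖ = 1 → ‖sphereMap H z‖ ≤ C) ∧
      ∀ z z', ‖z‖ = 1 → ‖z'‖ = 1 →
        ‖sphereMap H z - sphereMap H z'‖ ≤ C * ‖z - z'‖ ^ holderExp n := by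
  have hγ := holderExp_pos hn
  obtain ⟨C, hC⟩ := hH.holder
  obtain ⟨K, hK0, hK⟩ : ∃ K : ℝ, 0 ≤ K ∧ ∀ z, ‖z‖ = 1 → opNorm (H z) ≤ K := by
    -- The unit sphere is empty when `m = 0`.
    by_cases h : ∃ z : Spinor m, ‖z‖ = 1
    · obtain ⟨w, hw⟩ := h
      refine ⟨|C| * 2 ^ holderExp n + opNorm (H w), by
        have : 0 ≤ opNorm (H w) := norm_nonneg _
        positivity, fun z hz => (opNorm_le_sub_add (H z) (H w)).trans ?_⟩
      gcongr
      refine (hC z w hz hw).trans ?_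
      gcongr
      · exact le_abs_self C
      · exact (norm_sub_le _ _).trans (by rw [hz, hw]; norm_num)
    · exact ⟨0, le_rfl, fun z hz => (h ⟨z, hz⟩).elim⟩
  refine ⟨|C| + 2 * K, by positivity, fun z hz => ?_, fun z z' hz hz' => ?_⟩
  · refine (norm_act_le _ _).trans ?_
    rw [hz, mul_one]
    have := hK z hz
    have := abs_nonneg C
    linarith
  · have e : sphereMap H z - sphereMap H z' = act (H z - H z') z + act (H z') (z - z') := by
      rw [sphereMap, sphereMap, act_sub, sub_act]; abel
    have hd : ‖z - z'‖ ≤ 2 := (norm_sub_le _ _).trans (by rw [hz, hz']; norm_num)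
    have h1 := rpow_bound_of_le (norm_nonneg (z - z')) hd hγ holderExp_le_one
    have h2 : (2 : ℝ) ^ (1 - holderExp n) ≤ 2 := by
      conv_rhs => rw [← Real.rpow_one 2]
      exact Real.rpow_le_rpow_of_exponent_le (by norm_num) (by linarith)
    rw [e, add_mul]
    refine (norm_add_le _ _).trans (add_le_add ?_ ?_)
    · refine (norm_act_le _ _).trans ?_
      rw [hz, mul_one]
      refine (hC z z' hz hz').trans ?_
      gcongr
      exact le_abs_self C
    · refine (norm_act_le _ _).trans ?_
      calc opNorm (H z') * ‖z - z'‖ ≤ K * (2 ^ (1 - holderExp n) * ‖z - z'‖ ^ holderExp n) := by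
            gcongr
            exact hK z' hz'
        _ ≤ K * (2 * ‖z - z'‖ ^ holderExp n) := by gcongr
        _ = _ := by ring

lemma norm_nonlin_le (hn : 2 ≤ n) {σ : Fin n → Matrix (Fin m) (Fin m) ℂ}
    {H : Spinor m → SpinorMatrix m} (hH : IsAdmissible σ H) :
    ∃ C : ℝ, 0 ≤ C ∧ ∀ z, ‖nonlin n H z‖ ≤ C * ‖z‖ ^ (critExp n - 1) := by
  obtain ⟨C, hC0, hC, -⟩ := sphereMap_bounds hn hH
  refine ⟨C, hC0, fun z => ?_⟩
  rcases eq_or_ne z 0 with rfl | hz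
  · rw [nonlin_zero, norm_zero]; positivity
  · rw [nonlin_eq H hz, norm_smul, Real.norm_of_nonneg (by positivity), mul_comm]
    gcongr
    exact hC _ (norm_normalize hz)

lemma rpow_sub_rpow_le {a b q : ℝ} (hb : 0 ≤ b) (ha : 0 < a) (hq : 1 ≤ q) :
    a ^ q - b ^ q ≤ q * a ^ (q - 1) * (a - b) := by
  have h := one_add_mul_self_le_rpow_one_add (s := b / a - 1) (by
    have : 0 ≤ b / a := by positivity
    linarith) hq
  rw [add_sub_cancel, Real.div_rpow hb ha.le] at h
  have haq : 0 < a ^ q := Real.rpow_pos_of_pos ha q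
  rw [le_div_iff₀ haq] at h
  have e : a ^ q = a ^ (q - 1) * a := by
    rw [← Real.rpow_add_one ha.ne']; congr 1; ring
  have e2 : (1 + q * (b / a - 1)) * a ^ q = a ^ q + q * a ^ (q - 1) * (b - a) := by
    rw [e]; field_simp
  rw [e2] at h
  linarith

lemma norm_normalize_sub_le {z z' : Spinor m} (hz' : z' ≠ 0) (h : ‖z'‖ ≤ ‖z‖) :
    ‖‖z‖⁻¹ • z - ‖z'‖⁻¹ • z'‖ ≤ 2 * ‖z - z'‖ / ‖z'‖ := by
  have hb : 0 < ‖z'‖ := norm_pos_iff.2 hz'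
  have ha : 0 < ‖z‖ := hb.trans_le h
  have hz : z ≠ 0 := norm_pos_iff.1 ha
  rw [le_div_iff₀ hb, mul_comm]
  have e : ‖z'‖ • (‖z‖⁻¹ • z - ‖z'‖⁻¹ • z') = (z - z') + (‖z'‖ - ‖z‖) • (‖z‖⁻¹ • z) := by
    rw [smul_sub, smul_smul ‖z'‖ ‖z'‖⁻¹, mul_inv_cancel₀ hb.ne', one_smul, sub_smul,
      smul_smul ‖z‖, mul_inv_cancel₀ ha.ne', one_smul]
    abel
  have h2 := norm_add_le (z - z') ((‖z'‖ - ‖z‖) • (‖z‖⁻¹ • z))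
  rw [← e, norm_smul, norm_smul (‖z'‖ - ‖z‖), norm_normalize hz, norm_norm, Real.norm_eq_abs,
    mul_one] at h2
  have h3 := abs_norm_sub_norm_le z' z
  rw [norm_sub_rev] at h3
  linarith

/-- Radial and angular variation are separated. The angular part costs `(|z - z'| / |z'|)^γ`, but
carries the weight `|z'|^q` with `q = 2^♯ - 1 ≥ 1 ≥ γ`, so nothing blows up at the origin. -/
lemma nonlin_holder (hn : 2 ≤ n) {σ : Fin n → Matrix (Fin m) (Fin m) ℂ}
    {H : Spinor m → SpinorMatrix m} (hH : IsAdmissible σ H) {M : ℝ} (hM : 0 < M) :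
    ∃ C : ℝ, 0 ≤ C ∧ ∀ z z', ‖z‖ ≤ M → ‖z'‖ ≤ M →
      ‖nonlin n H z - nonlin n H z'‖ ≤ C * ‖z - z'‖ ^ holderExp n := by
  have hpp := critExp_sub_two_pos hn
  have hγ := holderExp_pos hn
  have hγ1 := holderExp_le_one (n := n)
  obtain ⟨C, hC0, hC, hC'⟩ := sphereMap_bounds hn hH
  set γ := holderExp n
  set q := critExp n - 1 with hq
  have hq1 : 1 ≤ q := by linarith
  set A := q * M ^ (q - 1) * (2 * M) ^ (1 - γ) * C + C * 2 * M ^ (q - γ) with hA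
  have hA0 : 0 ≤ A := by positivity
  have main : ∀ z z' : Spinor m, ‖z‖ ≤ M → ‖z'‖ ≤ ‖z‖ →
      ‖nonlin n H z - nonlin n H z'‖ ≤ A * ‖z - z'‖ ^ γ := by
    intro z z' hz hzz
    rcases eq_or_ne z 0 with rfl | h0
    · have : z' = 0 := by simpa using hzz
      rw [this, sub_self, norm_zero]
      positivity
    have ha : 0 < ‖z‖ := norm_pos_iff.2 h0
    have hd : ‖z - z'‖ ≤ 2 * M := (norm_sub_le _ _).trans (by linarith)
    have hd0 := norm_nonneg (z - z')
    have hdγ := rpow_bound_of_le hd0 hd hγ hγ1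
    have hpw : ‖z‖ ^ q - ‖z'‖ ^ q ≤ q * M ^ (q - 1) * ((2 * M) ^ (1 - γ) * ‖z - z'‖ ^ γ) :=
      calc ‖z‖ ^ q - ‖z'‖ ^ q ≤ q * ‖z‖ ^ (q - 1) * (‖z‖ - ‖z'‖) :=
            rpow_sub_rpow_le (norm_nonneg _) ha hq1
        _ ≤ q * M ^ (q - 1) * ((2 * M) ^ (1 - γ) * ‖z - z'‖ ^ γ) := by
            have h5 : ‖z‖ - ‖z'‖ ≤ (2 * M) ^ (1 - γ) * ‖z - z'‖ ^ γ :=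
              (norm_sub_norm_le _ _).trans hdγ
            have h6 : 0 ≤ ‖z‖ - ‖z'‖ := by linarith
            gcongr
    have hpw0 : 0 ≤ ‖z‖ ^ q - ‖z'‖ ^ q := by
      rw [sub_nonneg]
      exact Real.rpow_le_rpow (norm_nonneg _) hzz (by linarith)
    have hfirst : ‖(‖z‖ ^ q - ‖z'‖ ^ q) • sphereMap H (‖z‖⁻¹ • z)‖ ≤
        q * M ^ (q - 1) * (2 * M) ^ (1 - γ) * C * ‖z - z'‖ ^ γ := by
      rw [norm_smul, Real.norm_of_nonneg hpw0]
      calc _ ≤ q * M ^ (q - 1) * ((2 * M) ^ (1 - γ) * ‖z - z'‖ ^ γ) * C := by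
            gcongr
            exact hC _ (norm_normalize h0)
        _ = _ := by ring
    rcases eq_or_ne z' 0 with rfl | h0'
    · rw [norm_zero, Real.zero_rpow (by linarith), sub_zero] at hfirst
      rw [nonlin_zero, sub_zero, nonlin_eq H h0]
      refine hfirst.trans ?_
      rw [hA]
      gcongr
      exact le_add_of_nonneg_right (by positivity)
    · have hb : 0 < ‖z'‖ := norm_pos_iff.2 h0'
      have hsecond : ‖‖z'‖ ^ q • (sphereMap H (‖z‖⁻¹ • z) - sphereMap H (‖z'‖⁻¹ • z'))‖ ≤
          C * 2 * M ^ (q - γ) * ‖z - z'‖ ^ γ := by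
        rw [norm_smul, Real.norm_of_nonneg (by positivity)]
        calc _ ≤ ‖z'‖ ^ q * (C * (2 * ‖z - z'‖ / ‖z'‖) ^ γ) := by
              gcongr
              refine (hC' _ _ (norm_normalize h0) (norm_normalize h0')).trans ?_
              gcongr
              exact norm_normalize_sub_le h0' hzz
          _ = C * 2 ^ γ * ‖z'‖ ^ (q - γ) * ‖z - z'‖ ^ γ := by
              have h7 : ‖z'‖ ^ γ ≠ 0 := (Real.rpow_pos_of_pos hb γ).ne'
              have h8 : ‖z'‖ ^ q = ‖z'‖ ^ (q - γ) * ‖z'‖ ^ γ := by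
                rw [← Real.rpow_add hb, sub_add_cancel]
              rw [Real.div_rpow (by positivity) hb.le, Real.mul_rpow two_pos.le hd0, h8]
              generalize ‖z'‖ ^ γ = b at h7
              field_simp
          _ ≤ C * 2 * M ^ (q - γ) * ‖z - z'‖ ^ γ := by
              have h2 : (2 : ℝ) ^ γ ≤ 2 := by
                conv_rhs => rw [← Real.rpow_one 2]
                exact Real.rpow_le_rpow_of_exponent_le (by norm_num) hγ1
              have h3 : ‖z'‖ ^ (q - γ) ≤ M ^ (q - γ) :=
                Real.rpow_le_rpow hb.le (hzz.trans hz) (by linarith)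
              gcongr
      have e : nonlin n H z - nonlin n H z' = (‖z‖ ^ q - ‖z'‖ ^ q) • sphereMap H (‖z‖⁻¹ • z) +
          ‖z'‖ ^ q • (sphereMap H (‖z‖⁻¹ • z) - sphereMap H (‖z'‖⁻¹ • z')) := by
        rw [nonlin_eq H h0, nonlin_eq H h0', smul_sub, sub_smul]
        abel
      rw [e, hA, add_mul]
      exact (norm_add_le _ _).trans (add_le_add hfirst hsecond)
  refine ⟨A, hA0, fun z z' hz hz' => ?_⟩
  rcases le_total ‖z'‖ ‖z‖ with h | h
  · exact main z z' hz h
  · rw [norm_sub_rev, norm_sub_rev z]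
    exact main z' z hz' h

lemma continuous_nonlin (hn : 2 ≤ n) {σ : Fin n → Matrix (Fin m) (Fin m) ℂ}
    {H : Spinor m → SpinorMatrix m} (hH : IsAdmissible σ H) : Continuous (nonlin n H) := by
  rw [continuous_iff_continuousAt]
  intro z
  have hγ := holderExp_pos hn
  have hM : 0 < ‖z‖ + 1 := by positivity
  obtain ⟨C, hC0, hC⟩ := nonlin_holder hn hH hM
  rw [ContinuousAt, tendsto_iff_norm_sub_tendsto_zero]
  have h1 : Tendsto (fun y => C * ‖y - z‖ ^ holderExp n) (𝓝 z) (𝓝 0) := by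
    have : Continuous fun y => C * ‖y - z‖ ^ holderExp n :=
      continuous_const.mul ((continuous_id.sub continuous_const).norm.rpow_const
        fun _ => Or.inr hγ.le)
    have h2 := this.tendsto z
    simpa [Real.zero_rpow hγ.ne'] using h2
  refine squeeze_zero' (Eventually.of_forall fun _ => norm_nonneg _) ?_ h1
  filter_upwards [ball_mem_nhds z one_pos] with y hy
  refine hC y z ?_ (by linarith)
  have h3 : ‖y - z‖ < 1 := by simpa [dist_eq_norm] using hy
  have h4 := norm_sub_norm_le y z
  linarith

lemma inversionMatrix_smul (σ : Fin n → Matrix (Fin m) (Fin m) ℂ) {r : ℝ} (hr : 0 < r)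
    (x : Space n) : inversionMatrix σ (r • x) = inversionMatrix σ x := by
  have e : unitSigma σ (r • x) = unitSigma σ x := by
    rw [unitSigma, unitSigma]
    refine Finset.sum_congr rfl fun j _ => ?_
    congr 2
    rw [PiLp.smul_apply, norm_smul, Real.norm_of_nonneg hr.le, smul_eq_mul,
      mul_div_mul_left _ _ hr.ne']
  rw [inversionMatrix, inversionMatrix, e]

lemma act_inversion_act_inversion {σ : Fin n → Matrix (Fin m) (Fin m) ℂ} (hσ : IsCliffordFamily σ)
    {x : Space n} (hx : x ≠ 0) (z : Spinor m) :
    act (inversionMatrix σ x) (act (inversionMatrix σ x) z) = z := by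
  rw [act_act, inversionMatrix_mul_self hσ hx, act_one]

lemma norm_act_inversion {σ : Fin n → Matrix (Fin m) (Fin m) ℂ} (hσ : IsCliffordFamily σ)
    {x : Space n} (hx : x ≠ 0) (z : Spinor m) : ‖act (inversionMatrix σ x) z‖ = ‖z‖ := by
  rw [@norm_eq_sqrt_re_inner ℂ, @norm_eq_sqrt_re_inner ℂ _ _ _ _ z, inner_act,
    conjTranspose_inversionMatrix, act_inversion_act_inversion hσ hx]

/-- Equivariance of `H` is applied at the unit vector `x / |x|`, `𝒰` depending only on the
direction; the norm is preserved. -/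
lemma nonlin_act_inversion {σ : Fin n → Matrix (Fin m) (Fin m) ℂ} (hσ : IsCliffordFamily σ)
    {H : Spinor m → SpinorMatrix m} (hH : IsAdmissible σ H) {x : Space n} (hx : x ≠ 0)
    (z : Spinor m) :
    nonlin n H (act (inversionMatrix σ x) z) = act (inversionMatrix σ x) (nonlin n H z) := by
  rcases eq_or_ne z 0 with rfl | hz
  · rw [act_zero, nonlin_zero, act_zero]
  have hx0 : 0 < ‖x‖ := norm_pos_iff.2 hx
  have hw : ‖‖x‖⁻¹ • x‖ = 1 := by
    rw [norm_smul, norm_inv, norm_norm, inv_mul_cancel₀ hx0.ne']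
  have hnorm := norm_act_inversion hσ hx z
  have hz' : act (inversionMatrix σ x) z ≠ 0 := by
    rw [← norm_ne_zero_iff, hnorm]; exact norm_ne_zero_iff.2 hz
  rw [nonlin_eq H hz, nonlin_eq H hz', hnorm, act_real_smul]
  congr 1
  rw [← act_real_smul]
  have h := hH.equivariant (act (inversionMatrix σ x) (‖z‖⁻¹ • z)) (‖x‖⁻¹ • x) (by
    rw [norm_act_inversion hσ hx, norm_normalize hz]) hw
  rw [inversionMatrix_smul σ (inv_pos.2 hx0), conjTranspose_inversionMatrix,
    act_inversion_act_inversion hσ hx] at h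
  rw [sphereMap, h, ← act_act, ← act_act, act_inversion_act_inversion hσ hx, sphereMap]

end CriticalDirac

end

/-! ### Regularity of integral solutions and their expansion at the origin. -/

noncomputable section

namespace CriticalDirac

open Set Metric Filter Topology
open scoped ENNReal

variable {n m : ℕ} {σ : Fin n → Matrix (Fin m) (Fin m) ℂ} {H : Spinor m → SpinorMatrix m}

/-- The normalizing constant of the fundamental solution of the Dirac operator. -/
def potentialConst (n : ℕ) : ℂ := Complex.I / (mollMass n : ℂ)

lemma enorm_nonlin_le (hn : 2 ≤ n) (hH : IsAdmissible σ H) :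
    ∃ C : ℝ≥0∞, C ≠ ⊤ ∧ ∀ z, ‖nonlin n H z‖ₑ ≤ C * ‖z‖ₑ ^ (critExp n - 1) := by
  have hpp := critExp_sub_two_pos hn
  obtain ⟨C, hC0, hC⟩ := norm_nonlin_le hn hH
  refine ⟨ENNReal.ofReal C, ENNReal.ofReal_ne_top, fun z => ?_⟩
  rw [← ofReal_norm, ← ofReal_norm, ENNReal.ofReal_rpow_of_nonneg (norm_nonneg _) (by linarith),
    ← ENNReal.ofReal_mul hC0]
  exact ENNReal.ofReal_le_ofReal (hC z)

lemma lintegral_nonlin_ne_top (hn : 2 ≤ n) (hH : IsAdmissible σ H) {u : Space n → Spinor m}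
    (hup : ∫⁻ x, ‖u x‖ₑ ^ critExp n ≠ ⊤) :
    ∫⁻ x, ‖nonlin n H (u x)‖ₑ ^ (critExp n / (critExp n - 1)) ≠ ⊤ := by
  have hpp := critExp_sub_two_pos hn
  have hp1 : 0 < critExp n - 1 := by linarith
  have hp' : 0 ≤ critExp n / (critExp n - 1) := div_nonneg (by linarith) hp1.le
  obtain ⟨C, hC, hle⟩ := enorm_nonlin_le hn hH
  have h : ∫⁻ x, ‖nonlin n H (u x)‖ₑ ^ (critExp n / (critExp n - 1)) ≤
      ∫⁻ x, C ^ (critExp n / (critExp n - 1)) * ‖u x‖ₑ ^ critExp n := by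
    refine lintegral_mono fun x => ?_
    refine (ENNReal.rpow_le_rpow (hle (u x)) hp').trans_eq ?_
    rw [ENNReal.mul_rpow_of_nonneg _ _ hp', ← ENNReal.rpow_mul, mul_div_cancel₀ _ hp1.ne']
  have hCp := ENNReal.rpow_ne_top_of_nonneg hp' hC
  rw [lintegral_const_mul' _ _ hCp] at h
  exact ne_top_of_le_ne_top (ENNReal.mul_ne_top hCp hup) h

/-- A solution of the integral form of the critical Dirac equation. -/
structure IsIntegralSolution (σ : Fin n → Matrix (Fin m) (Fin m) ℂ) (H : Spinor m → SpinorMatrix m)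
    (u : Space n → Spinor m) : Prop where
  measurable : Measurable u
  lintegral : ∫⁻ x, ‖u x‖ₑ ^ critExp n ≠ ⊤
  ae_eq : ∀ᵐ x, u x = potentialConst n • potential σ (fun y => nonlin n H (u y)) x

lemma IsIntegralSolution.bounded (hn : 2 ≤ n) (hσ : IsCliffordFamily σ) (hH : IsAdmissible σ H)
    {u : Space n → Spinor m} (hu : IsIntegralSolution σ H u) :
    ∃ M : ℝ≥0∞, M ≠ ⊤ ∧ ∀ᵐ x, ‖u x‖ₑ ≤ M := by
  obtain ⟨C, hC, hle⟩ := enorm_nonlin_le hn hH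
  refine bounded_of_le_riesz hn hu.measurable.enorm (C := ‖potentialConst n‖ₑ * C)
    (ENNReal.mul_ne_top enorm_ne_top hC) hu.lintegral ?_
  filter_upwards [hu.ae_eq] with x hx
  rw [hx, enorm_smul, mul_assoc]
  gcongr
  refine (enorm_potential_le hσ _ x).trans ((riesz_mono_ae _
    (Eventually.of_forall fun y => hle (u y)) x).trans_eq ?_)
  simp only [riesz]
  rw [← lintegral_const_mul' _ _ hC]
  refine lintegral_congr fun y => ?_
  ring

/-- A bounded, Hölder continuous solution of the integral equation. -/
structure IsRegularSolution (σ : Fin n → Matrix (Fin m) (Fin m) ℂ) (H : Spinor m → SpinorMatrix m)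
    (v : Space n → Spinor m) : Prop where
  eq : ∀ x, v x = potentialConst n • potential σ (fun y => nonlin n H (v y)) x
  holder : ∀ β : ℝ, 0 < β → β < 1 → ∃ C : ℝ, 0 ≤ C ∧ ∀ x x', ‖v x - v x'‖ ≤ C * ‖x - x'‖ ^ β
  bounded : ∃ M : ℝ, 0 < M ∧ ∀ x, ‖v x‖ ≤ M
  lintegral : ∫⁻ x, ‖nonlin n H (v x)‖ₑ ^ (critExp n / (critExp n - 1)) ≠ ⊤

lemma IsRegularSolution.continuous {v : Space n → Spinor m} (hv : IsRegularSolution σ H v) :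
    Continuous v := by
  obtain ⟨C, -, hC⟩ := hv.holder (1 / 2) (by norm_num) (by norm_num)
  exact continuous_of_holder (by norm_num) hC

/-- The representative is the right-hand side of the integral equation, which is defined everywhere,
Hölder continuous and insensitive to null sets in `u`. The last clause keeps the formula in terms of
`u`, so that `v` can be compared with a given `u` at individual points. -/
theorem IsIntegralSolution.exists_regular (hn : 2 ≤ n) (hσ : IsCliffordFamily σ)
    (hH : IsAdmissible σ H) {u : Space n → Spinor m} (hu : IsIntegralSolution σ H u) :
    ∃ v : Space n → Spinor m, v =ᵐ[volume] u ∧ IsRegularSolution σ H v ∧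
      ∀ x, v x = potentialConst n • potential σ (fun y => nonlin n H (u y)) x := by
  have hn2 : (2 : ℝ) ≤ n := by exact_mod_cast hn
  have hpp := critExp_sub_two_pos hn
  obtain ⟨M, hM, hb⟩ := hu.bounded hn hσ hH
  obtain ⟨C, hC, hle⟩ := enorm_nonlin_le hn hH
  have h1 := lintegral_nonlin_ne_top hn hH hu.lintegral
  have hfm : Measurable fun y => nonlin n H (u y) :=
    (continuous_nonlin hn hH).measurable.comp hu.measurable
  have hM' : C * M ^ (critExp n - 1) ≠ ⊤ :=
    ENNReal.mul_ne_top hC (ENNReal.rpow_ne_top_of_nonneg (by linarith) hM)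
  have h2 : ∀ᵐ x, ‖nonlin n H (u x)‖ₑ ≤ C * M ^ (critExp n - 1) := by
    filter_upwards [hb] with x hx
    refine (hle (u x)).trans ?_
    have : 0 ≤ critExp n - 1 := by linarith
    gcongr
  set v : Space n → Spinor m :=
    fun x => potentialConst n • potential σ (fun y => nonlin n H (u y)) x with hv
  have hvu : v =ᵐ[volume] u := hu.ae_eq.mono fun x hx => hx.symm
  have hcongr : ∀ᵐ y, nonlin n H (v y) = nonlin n H (u y) := hvu.mono fun y hy => by rw [hy]
  refine ⟨v, hvu, ⟨fun x => ?_, fun β hβ hβ1 => ?_, ?_, ?_⟩, fun x => rfl⟩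
  · simp only [hv]
    congr 1
    refine integral_congr_ae ?_
    filter_upwards [hcongr] with y hy
    exact congrArg _ hy.symm
  · obtain ⟨K, hK0, hK⟩ := holder_potential hn hσ hfm h1 hM' h2 hβ hβ1
    refine ⟨‖potentialConst n‖ * K, by positivity, fun x x' => ?_⟩
    rw [hv]
    simp only
    rw [← smul_sub, norm_smul, mul_assoc]
    gcongr
    exact hK x x'
  · obtain ⟨B, hB, hrB⟩ := riesz_bounded_of_ae_le hn hfm.enorm h1 hM' h2
      (le_refl ((n : ℝ) - 1)) (by linarith)
    refine ⟨‖potentialConst n‖ * B.toReal + 1, by positivity, fun x => ?_⟩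
    have h3 := (enorm_potential_le hσ (fun y => nonlin n H (u y)) x).trans (hrB x)
    rw [← ofReal_norm, ← ENNReal.ofReal_toReal hB,
      ENNReal.ofReal_le_ofReal_iff ENNReal.toReal_nonneg] at h3
    rw [hv]
    simp only
    rw [norm_smul]
    have : ‖potentialConst n‖ * ‖potential σ (fun y => nonlin n H (u y)) x‖ ≤
      ‖potentialConst n‖ * B.toReal := by gcongr
    linarith
  · have e : ∫⁻ x, ‖nonlin n H (v x)‖ₑ ^ (critExp n / (critExp n - 1)) =
        ∫⁻ x, ‖nonlin n H (u x)‖ₑ ^ (critExp n / (critExp n - 1)) :=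
      lintegral_congr_ae (hcongr.mono fun x hx => by simp only [hx])
    rw [e]
    exact h1

/-- The profile of a smooth radial cut-off. -/
def cutoff (t : ℝ) : ℝ := 1 - step t

lemma contDiff_cutoff : ContDiff ℝ ∞ cutoff := contDiff_const.sub contDiff_step

/-- A compactly supported spinor whose image under the Dirac operator is `z` near the origin. -/
def localPrimitive (σ : Fin n → Matrix (Fin m) (Fin m) ℂ) (z : Spinor m) (y : Space n) : Spinor m :=
  cutoff (‖y - 0‖ ^ 2) • symbol σ (y - 0) ((Complex.I / n) • z)

lemma contDiff_localPrimitive (z : Spinor m) : ContDiff ℝ ∞ (localPrimitive σ z) :=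
  contDiff_radial_smul σ contDiff_cutoff 0 _

lemma hasCompactSupport_localPrimitive (z : Spinor m) :
    HasCompactSupport (localPrimitive σ z) := by
  refine hasCompactSupport_radial_smul σ (κ := cutoff) (T := 2) (fun t ht => ?_) 0 _
  rw [cutoff, step_of_ge (by linarith), sub_self]

lemma diracOp_localPrimitive (hn : 1 ≤ n) (hσ : IsCliffordFamily σ) (z : Spinor m) {y : Space n}
    (hy : ‖y‖ < 1) : diracOp σ (localPrimitive σ z) y = z := by
  have hd : HasDerivAt cutoff (-deriv step (‖y - 0‖ ^ 2)) (‖y - 0‖ ^ 2) := by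
    have := (hasDerivAt_step (‖y - 0‖ ^ 2)).const_sub 1
    exact this
  have h1 : ‖y - 0‖ ^ 2 < 1 := by
    rw [sub_zero]; nlinarith [norm_nonneg y]
  have h := diracOp_radial hσ 0 y ((Complex.I / n) • z) hd
  rw [deriv_step_of_lt h1, cutoff, step_of_le h1.le] at h
  have e : localPrimitive σ z = fun y => cutoff (‖y - 0‖ ^ 2) • symbol σ (y - 0)
    ((Complex.I / n) • z) := rfl
  rw [e, h]
  have hn0 : (n : ℂ) ≠ 0 := by exact_mod_cast (by omega : n ≠ 0)
  rw [real_smul_eq, smul_smul, smul_smul]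
  have : -Complex.I * (((2 * ‖y - 0‖ ^ 2 * -0 + (n : ℝ) * (1 - 0) : ℝ) : ℂ) * (Complex.I / n)) = 1 := by
    push_cast
    field_simp
    simp
  rw [mul_assoc, this, one_smul]

/-- On the unit ball the correction is exactly linear, so it enters only the first order
coefficients and adds no error. -/
lemma localPrimitive_of_le (z : Spinor m) {x : Space n} (hx : ‖x‖ ≤ 1) :
    localPrimitive σ z x =
      ∑ j, x j • symbol σ (EuclideanSpace.single j 1) ((Complex.I / n) • z) := by
  have h1 : ‖x - 0‖ ^ 2 ≤ 1 := by
    rw [sub_zero]; nlinarith [norm_nonneg x]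
  rw [localPrimitive, cutoff, step_of_le h1, sub_zero, one_smul, sub_zero]
  conv_lhs => rw [← sum_smul_single x]
  rw [map_sum, _root_.sum_apply]
  refine Finset.sum_congr rfl fun j _ => ?_
  rw [(symbol σ).map_smul, _root_.smul_apply]

lemma potential_add (hσ : IsCliffordFamily σ) {f g : Space n → Spinor m} (hf : Measurable f)
    (hg : Measurable g) {x : Space n} (hfx : riesz ((n : ℝ) - 1) (fun y => ‖f y‖ₑ) x ≠ ⊤)
    (hgx : riesz ((n : ℝ) - 1) (fun y => ‖g y‖ₑ) x ≠ ⊤) :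
    potential σ (fun y => f y + g y) x = potential σ f x + potential σ g x := by
  rw [potential, potential, potential, ← integral_add (integrable_kern hσ hf hfx)
    (integrable_kern hσ hg hgx)]
  refine integral_congr_ae (Eventually.of_forall fun y => ?_)
  simp only [kern, map_add, smul_add]

/-- The expansion of a regular solution at the origin. -/
theorem IsRegularSolution.expansion (hn : 2 ≤ n) (hσ : IsCliffordFamily σ) (hH : IsAdmissible σ H)
    {v : Space n → Spinor m} (hv : IsRegularSolution σ H v) :
    ∃ (Ψ : Spinor m) (Φ : Fin n → Spinor m), ∀ α : ℝ, 0 < α → α < holderExp n →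
      ∃ C : ℝ, ∀ x : Space n, ‖x‖ ≤ 1 →
        ‖v x - Ψ - ∑ j, x j • Φ j‖ ≤ C * ‖x‖ ^ (1 + α) := by
  have hn2 : (2 : ℝ) ≤ n := by exact_mod_cast hn
  have hpp := critExp_sub_two_pos hn
  have hp1 : 0 < critExp n - 1 := by linarith
  have hp'1 : 1 ≤ critExp n / (critExp n - 1) := by rw [one_le_div hp1]; linarith
  have hγ := holderExp_pos hn
  have hγ1 := holderExp_le_one (n := n)
  obtain ⟨M, hM0, hM⟩ := hv.bounded
  obtain ⟨Cγ, hCγ0, hCγ⟩ := nonlin_holder hn hH hM0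
  obtain ⟨CF, hCF0, hCF⟩ := norm_nonlin_le hn hH
  have hFc : Continuous fun y => nonlin n H (v y) := (continuous_nonlin hn hH).comp hv.continuous
  set c := potentialConst n with hc
  -- Subtracting `𝒟 w` makes the density `g` vanish at the origin, the prerequisite for
  -- `potential_expansion`.
  set w := localPrimitive σ (nonlin n H (v 0)) with hw
  have hwc : Continuous (diracOp σ w) := continuous_diracOp σ (contDiff_localPrimitive _)
  have hws : HasCompactSupport (diracOp σ w) :=
    hasCompactSupport_diracOp σ (hasCompactSupport_localPrimitive _)
  have hw1 := lintegral_enorm_rpow_ne_top_of_hasCompactSupport hwc hws (zero_lt_one.trans_le hp'1)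
  obtain ⟨D, hD⟩ := hws.exists_bound_of_continuous hwc
  have hD0 : 0 ≤ D := (norm_nonneg _).trans (hD 0)
  have hwpot : ∀ x, w x = c • potential σ (diracOp σ w) x :=
    eq_potential_diracOp hn hσ (contDiff_localPrimitive _) (hasCompactSupport_localPrimitive _)
  set g : Space n → Spinor m := fun y => nonlin n H (v y) - diracOp σ w y with hg
  have hgc : Continuous g := hFc.sub hwc
  have hFM : ∀ y, ‖nonlin n H (v y)‖ ≤ CF * M ^ (critExp n - 1) := fun y => by
    refine (hCF _).trans ?_
    gcongr
    exact hM y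
  have hgM : ∀ y, ‖g y‖ ≤ CF * M ^ (critExp n - 1) + D := fun y =>
    (norm_sub_le _ _).trans (add_le_add (hFM y) (hD y))
  have h1 : ∫⁻ x, ‖g x‖ₑ ^ (critExp n / (critExp n - 1)) ≠ ⊤ := by
    have h3 := ENNReal.lintegral_rpow_add_lt_top_of_lintegral_rpow_lt_top
      (hFc.measurable.enorm.aemeasurable (μ := volume)) hv.lintegral.lt_top hw1.lt_top hp'1
    refine ne_top_of_le_ne_top h3.ne (lintegral_mono fun x => ?_)
    simp only [Pi.add_apply, hg]
    gcongr
    exact enorm_sub_le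
  have toE : ∀ {f : Space n → Spinor m} {B : ℝ}, (∀ y, ‖f y‖ ≤ B) →
      ∀ᵐ y, ‖f y‖ₑ ≤ ENNReal.ofReal B := fun h => Eventually.of_forall fun y => by
    rw [← ofReal_norm]; exact ENNReal.ofReal_le_ofReal (h y)
  have hrg : ∀ x, riesz ((n : ℝ) - 1) (fun y => ‖g y‖ₑ) x ≠ ⊤ := fun x => by
    obtain ⟨B, hB, hrB⟩ := riesz_bounded_of_ae_le hn hgc.measurable.enorm h1 ENNReal.ofReal_ne_top
      (toE hgM) (le_refl ((n : ℝ) - 1)) (by linarith)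
    exact ne_top_of_le_ne_top hB (hrB x)
  have hrw : ∀ x, riesz ((n : ℝ) - 1) (fun y => ‖diracOp σ w y‖ₑ) x ≠ ⊤ := fun x => by
    obtain ⟨B, hB, hrB⟩ := riesz_bounded_of_ae_le hn hwc.measurable.enorm hw1 ENNReal.ofReal_ne_top
      (toE hD) (le_refl ((n : ℝ) - 1)) (by linarith)
    exact ne_top_of_le_ne_top hB (hrB x)
  have hsplit : ∀ x, v x = c • potential σ g x + w x := fun x => by
    rw [hv.eq x, hwpot x, ← smul_add, ← potential_add hσ hgc.measurable hwc.measurable (hrg x) (hrw x)]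
    simp only [hg, sub_add_cancel, hc]
  have hw0 : w 0 = 0 := by
    rw [hw, localPrimitive_of_le _ (by simp)]; simp
  -- First order coefficients: the differentiated potential of `g` plus the linear part of `w`. They
  -- are fixed before `α`.
  refine ⟨v 0, fun j => c • (∫ y, dkern σ y (EuclideanSpace.single j 1) (g y)) +
    symbol σ (EuclideanSpace.single j 1) ((Complex.I / n) • nonlin n H (v 0)), fun α hα hαγ => ?_⟩
  have hβ1 : α / holderExp n < 1 := by rwa [div_lt_one hγ]
  -- Composing a `γ`-Hölder map with an `α/γ`-Hölder function gives order `α`; this is why `α < γ`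
  -- is strict.
  obtain ⟨Cβ, hCβ0, hCβ⟩ := hv.holder (α / holderExp n) (by positivity) hβ1
  have hK : ∀ y, ‖g y‖ ≤ (Cγ * Cβ ^ holderExp n + (CF * M ^ (critExp n - 1) + D)) * ‖y‖ ^ α := by
    intro y
    rw [add_mul]
    have hyα : 0 ≤ ‖y‖ ^ α := by positivity
    rcases lt_or_ge ‖y‖ 1 with hy | hy
    · have e : g y = nonlin n H (v y) - nonlin n H (v 0) := by
        simp only [hg, hw]; rw [diracOp_localPrimitive (by omega) hσ _ hy]
      have h4 : ‖g y‖ ≤ Cγ * Cβ ^ holderExp n * ‖y‖ ^ α := by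
        rw [e]
        refine (hCγ _ _ (hM y) (hM 0)).trans ?_
        rw [mul_assoc]
        gcongr
        calc ‖v y - v 0‖ ^ holderExp n ≤ (Cβ * ‖y - 0‖ ^ (α / holderExp n)) ^ holderExp n := by
              gcongr
              exact hCβ y 0
          _ = _ := by
              rw [sub_zero, Real.mul_rpow hCβ0 (by positivity), ← Real.rpow_mul (norm_nonneg _),
                div_mul_cancel₀ _ hγ.ne']
      exact h4.trans (le_add_of_nonneg_right (by positivity))
    -- Outside the unit ball boundedness of `g` is enough, since `‖y‖ ^ α ≥ 1`.
    · refine (hgM y).trans ((le_mul_of_one_le_right (by positivity)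
        (Real.one_le_rpow hy hα.le)).trans (le_add_of_nonneg_left (by positivity)))
  obtain ⟨C, hC⟩ := potential_expansion hn hσ hgc.measurable h1 ENNReal.ofReal_ne_top (toE hgM)
    hα (hαγ.trans_le hγ1) hK
  refine ⟨‖c‖ * C, fun x hx => ?_⟩
  have e : v x - v 0 - ∑ j, x j • (c • (∫ y, dkern σ y (EuclideanSpace.single j 1) (g y)) +
      symbol σ (EuclideanSpace.single j 1) ((Complex.I / n) • nonlin n H (v 0))) =
      c • (potential σ g x - potential σ g 0 -
        ∑ j, x j • ∫ y, dkern σ y (EuclideanSpace.single j 1) (g y)) := by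
    have hwx : w x = _ := localPrimitive_of_le _ hx
    generalize nonlin n H (v 0) = f0 at hwx ⊢
    rw [hsplit x, hsplit 0, hw0, add_zero, hwx]
    simp only [smul_add, Finset.sum_add_distrib]
    rw [smul_sub, smul_sub, Finset.smul_sum]
    simp only [smul_comm c]
    abel
  rw [e, norm_smul, mul_assoc]
  gcongr
  exact hC x

end CriticalDirac

end

/-! ### Inversion and the Kelvin transform. -/

noncomputable section

namespace CriticalDirac

open Set Metric Filter Topology
open scoped ENNReal

variable {n m : ℕ} {σ : Fin n → Matrix (Fin m) (Fin m) ℂ} {H : Spinor m → SpinorMatrix m}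

/-- The inversion in the unit sphere. -/
def unitInversion (x : Space n) : Space n := EuclideanGeometry.inversion 0 1 x

lemma unitInversion_eq (x : Space n) : unitInversion x = (‖x‖ ^ 2)⁻¹ • x := by
  simp [unitInversion, EuclideanGeometry.inversion]

lemma unitInversion_unitInversion (x : Space n) : unitInversion (unitInversion x) = x :=
  EuclideanGeometry.inversion_inversion 0 one_ne_zero x

lemma norm_unitInversion (x : Space n) : ‖unitInversion x‖ = ‖x‖⁻¹ := by
  rw [unitInversion_eq, norm_smul, Real.norm_of_nonneg (by positivity)]
  rcases eq_or_ne ‖x‖ 0 with h | h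
  · simp [h]
  · field_simp

lemma unitInversion_ne_zero {x : Space n} (hx : x ≠ 0) : unitInversion x ≠ 0 := by
  rw [← norm_ne_zero_iff, norm_unitInversion]
  exact inv_ne_zero (norm_ne_zero_iff.2 hx)

lemma norm_unitInversion_sub {x y : Space n} (hx : x ≠ 0) (hy : y ≠ 0) :
    ‖unitInversion x - unitInversion y‖ = ‖x - y‖ / (‖x‖ * ‖y‖) := by
  rw [← dist_eq_norm, unitInversion, unitInversion,
    EuclideanGeometry.dist_inversion_inversion hx hy, dist_zero_right, dist_zero_right, dist_eq_norm]
  ring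

lemma measurable_unitInversion : Measurable (unitInversion : Space n → Space n) := by
  have e : (unitInversion : Space n → Space n) = fun x => (‖x‖ ^ 2)⁻¹ • x := funext unitInversion_eq
  rw [e]
  exact ((measurable_norm.pow_const 2).inv).smul measurable_id

lemma image_unitInversion : (unitInversion : Space n → Space n) '' {0}ᶜ = {0}ᶜ := by
  ext y
  simp only [mem_image, mem_compl_iff, mem_singleton_iff]
  constructor
  · rintro ⟨x, hx, rfl⟩
    exact unitInversion_ne_zero hx
  · exact fun hy => ⟨_, unitInversion_ne_zero hy, unitInversion_unitInversion y⟩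

/-- The derivative of the inversion. -/
def unitInversionDeriv (x : Space n) : Space n →L[ℝ] Space n :=
  (1 / dist x 0) ^ 2 • ((ℝ ∙ (x - 0))ᗮ.reflection : Space n →L[ℝ] Space n)

lemma hasFDerivAt_unitInversion {x : Space n} (hx : x ≠ 0) :
    HasFDerivAt unitInversion (unitInversionDeriv x) x :=
  EuclideanGeometry.hasFDerivAt_inversion hx

/-- The derivative is `|x|^{-2}` times a reflection. -/
lemma abs_det_unitInversionDeriv {x : Space n} :
    |(unitInversionDeriv x).det| = (‖x‖ ^ (2 * n))⁻¹ := by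
  have h := Submodule.det_reflection (ℝ ∙ (x - 0))ᗮ
  have e : (unitInversionDeriv x).det = ((1 / dist x 0) ^ 2) ^ n *
      LinearMap.det (ℝ ∙ (x - 0))ᗮ.reflection.toLinearMap := by
    rw [unitInversionDeriv, ContinuousLinearMap.det, ContinuousLinearMap.toLinearMap_smul,
      LinearMap.det_smul]
    simp only [finrank_euclideanSpace, Fintype.card_fin]
    rfl
  rw [e, h, abs_mul, abs_pow, abs_pow, abs_pow, abs_neg, abs_one, one_pow, mul_one, dist_zero_right,
    abs_of_nonneg (by positivity), ← pow_mul, one_div, inv_pow]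

lemma lintegral_unitInversion (hn : 1 ≤ n) (f : Space n → ℝ≥0∞) :
    ∫⁻ x, f x = ∫⁻ x, ENNReal.ofReal ((‖x‖ ^ (2 * n))⁻¹) * f (unitInversion x) := by
  have := nontrivial_space hn
  have h := lintegral_image_eq_lintegral_abs_det_fderiv_mul volume
    (measurableSet_singleton (0 : Space n)).compl
    (fun x hx => (hasFDerivAt_unitInversion hx).hasFDerivWithinAt)
    (Function.Involutive.injective unitInversion_unitInversion).injOn f
  rw [image_unitInversion] at h
  simp only [abs_det_unitInversionDeriv] at h
  rwa [Measure.restrict_eq_self_of_ae_mem (s := ({0}ᶜ : Set (Space n))) (Measure.ae_ne volume 0)] at h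

lemma integral_unitInversion (hn : 1 ≤ n) (f : Space n → Spinor m) :
    ∫ x, f x = ∫ x, (‖x‖ ^ (2 * n))⁻¹ • f (unitInversion x) := by
  have := nontrivial_space hn
  have h := integral_image_eq_integral_abs_det_fderiv_smul volume
    (measurableSet_singleton (0 : Space n)).compl
    (fun x hx => (hasFDerivAt_unitInversion hx).hasFDerivWithinAt)
    (Function.Involutive.injective unitInversion_unitInversion).injOn f
  rw [image_unitInversion] at h
  simp only [abs_det_unitInversionDeriv] at h
  rwa [Measure.restrict_eq_self_of_ae_mem (s := ({0}ᶜ : Set (Space n))) (Measure.ae_ne volume 0)] at h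

lemma act_inversion_eq (σ : Fin n → Matrix (Fin m) (Fin m) ℂ) (x : Space n) (z : Spinor m) :
    act (inversionMatrix σ x) z = ‖x‖⁻¹ • symbol σ x (act (chirality m) z) := by
  rw [inversionMatrix_eq, ← chirality, smul_act, ← act_act, ← symbol_apply, ← real_smul_eq]

lemma chirality_symbol (σ : Fin n → Matrix (Fin m) (Fin m) ℂ) (x : Space n) (z : Spinor m) :
    act (chirality m) (symbol σ x z) = -symbol σ x (act (chirality m) z) := by
  rw [symbol_apply, symbol_apply, act_act, act_act, symbolMatrix_mul_chirality]
  simp [act_eq]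

lemma chirality_chirality (z : Spinor m) : act (chirality m) (act (chirality m) z) = -z := by
  rw [act_act, chirality_mul_self]
  simp [act_eq]

lemma symbol_real_smul (σ : Fin n → Matrix (Fin m) (Fin m) ℂ) (x : Space n) (c : ℝ) (z : Spinor m) :
    symbol σ x (c • z) = c • symbol σ x z := act_real_smul _ _ _

/-- Writing `s` for the symbol, `s(x) s(x - y) s(y) = |x|² s(y) - |y|² s(x)`; the two chirality
factors contribute the sign `-1`, and division by `|x| |y|` leaves the difference of the inverted
points. -/
lemma inversion_symbol_inversion (hσ : IsCliffordFamily σ) {x y : Space n} (hx : x ≠ 0) (hy : y ≠ 0)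
    (z : Spinor m) :
    act (inversionMatrix σ x) (symbol σ (x - y) (act (inversionMatrix σ y) z)) =
      (‖x‖ * ‖y‖) • symbol σ (unitInversion x - unitInversion y) z := by
  have hx0 : ‖x‖ ≠ 0 := norm_ne_zero_iff.2 hx
  have hy0 : ‖y‖ ≠ 0 := norm_ne_zero_iff.2 hy
  have key : act (chirality m) (symbol σ (x - y) (symbol σ y (act (chirality m) z))) =
      -symbol σ (x - y) (symbol σ y z) := by
    rw [chirality_symbol, chirality_symbol, chirality_chirality, neg_eq_iff_eq_neg, map_neg,
      map_neg, map_neg, neg_neg]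
  have key2 : symbol σ x (symbol σ (x - y) (symbol σ y z)) =
      ‖x‖ ^ 2 • symbol σ y z - ‖y‖ ^ 2 • symbol σ x z := by
    rw [(symbol σ).map_sub, _root_.sub_apply, symbol_symbol hσ y, map_sub, symbol_symbol hσ,
      real_smul_eq, real_smul_eq, real_smul_eq, map_smul]
  rw [act_inversion_eq, act_inversion_eq, symbol_real_smul, act_real_smul, key, symbol_real_smul,
    map_neg, key2, unitInversion_eq, unitInversion_eq, (symbol σ).map_sub, _root_.sub_apply,
    (symbol σ).map_smul, (symbol σ).map_smul, _root_.smul_apply, _root_.smul_apply]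
  match_scalars <;> field_simp

/-- Conformal covariance of the fundamental solution, from the preceding identity and `|x* - y*| =
|x - y| / (|x| |y|)` for inverted points. -/
lemma kern_unitInversion_sub (hσ : IsCliffordFamily σ) {x y : Space n} (hx : x ≠ 0) (hy : y ≠ 0)
    (z : Spinor m) :
    kern σ (unitInversion x - unitInversion y) z = (‖x‖ ^ ((n : ℝ) - 1) * ‖y‖ ^ ((n : ℝ) - 1)) •
      act (inversionMatrix σ x) (kern σ (x - y) (act (inversionMatrix σ y) z)) := by
  have hx0 : 0 < ‖x‖ := norm_pos_iff.2 hx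
  have hy0 : 0 < ‖y‖ := norm_pos_iff.2 hy
  rw [kern, kern, act_real_smul, inversion_symbol_inversion hσ hx hy, smul_smul, smul_smul,
    norm_unitInversion_sub hx hy]
  congr 1
  rw [Real.rpow_sub_one hx0.ne', Real.rpow_sub_one hy0.ne', Real.rpow_natCast, Real.rpow_natCast,
    div_pow, mul_pow, inv_div]
  field_simp

lemma measurable_act_inversion (σ : Fin n → Matrix (Fin m) (Fin m) ℂ) {f : Space n → Spinor m}
    (hf : Measurable f) : Measurable fun x => act (inversionMatrix σ x) (f x) := by
  simp only [act_inversion_eq]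
  have h0 : Continuous fun z : Spinor m => act (chirality m) z := by
    simp only [act_eq]; exact ContinuousLinearMap.continuous _
  have h1 : Measurable fun x => act (chirality m) (f x) := h0.measurable.comp hf
  have h2 := (continuous_symbol_apply σ).measurable.comp (measurable_id.prodMk h1)
  simp only [Function.comp_def, id] at h2
  exact measurable_norm.inv.smul h2

/-- The action of `𝒰(x)` as a continuous linear equivalence. -/
def inversionEquiv (hσ : IsCliffordFamily σ) {x : Space n} (hx : x ≠ 0) :
    Spinor m ≃L[ℂ] Spinor m :=
  ContinuousLinearEquiv.equivOfInverse
    (Matrix.toEuclideanCLM (n := Fin m ⊕ Fin m) (𝕜 := ℂ) (inversionMatrix σ x))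
    (Matrix.toEuclideanCLM (n := Fin m ⊕ Fin m) (𝕜 := ℂ) (inversionMatrix σ x))
    (act_inversion_act_inversion hσ hx) (act_inversion_act_inversion hσ hx)

/-- Because `𝒰(x)` is invertible, no integrability of `f` is required. -/
lemma integral_act_inversion (hσ : IsCliffordFamily σ) {x : Space n} (hx : x ≠ 0)
    (f : Space n → Spinor m) :
    ∫ y, act (inversionMatrix σ x) (f y) = act (inversionMatrix σ x) (∫ y, f y) :=
  (inversionEquiv hσ hx).integral_comp_comm f

/-- The Kelvin transform of a spinor field. -/
def kelvin (σ : Fin n → Matrix (Fin m) (Fin m) ℂ) (u : Space n → Spinor m) (x : Space n) :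
    Spinor m := ‖x‖ ^ (1 - (n : ℝ)) • act (inversionMatrix σ x) (u (unitInversion x))

lemma measurable_kelvin (σ : Fin n → Matrix (Fin m) (Fin m) ℂ) {u : Space n → Spinor m}
    (hu : Measurable u) : Measurable (kelvin σ u) :=
  (measurable_norm.pow_const _).smul
    (measurable_act_inversion σ (hu.comp measurable_unitInversion))

lemma inversionMatrix_unitInversion (σ : Fin n → Matrix (Fin m) (Fin m) ℂ) {x : Space n}
    (hx : x ≠ 0) : inversionMatrix σ (unitInversion x) = inversionMatrix σ x := by
  have hx0 : 0 < ‖x‖ := norm_pos_iff.2 hx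
  rw [unitInversion_eq, inversionMatrix_smul σ (by positivity)]

lemma kelvin_kelvin (hσ : IsCliffordFamily σ) (u : Space n → Spinor m) {x : Space n} (hx : x ≠ 0) :
    kelvin σ (kelvin σ u) x = u x := by
  have hx0 : 0 < ‖x‖ := norm_pos_iff.2 hx
  rw [kelvin, kelvin, unitInversion_unitInversion, act_real_smul, inversionMatrix_unitInversion σ hx,
    act_inversion_act_inversion hσ hx, norm_unitInversion, smul_smul, Real.inv_rpow hx0.le,
    mul_inv_cancel₀ (Real.rpow_pos_of_pos hx0 _).ne', one_smul]

/-- The weight satisfies `(1 - n) 2^♯ = -2n`, which is the exponent of the Jacobian. -/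
lemma lintegral_kelvin (hn : 2 ≤ n) (hσ : IsCliffordFamily σ) (u : Space n → Spinor m) :
    ∫⁻ x, ‖kelvin σ u x‖ₑ ^ critExp n = ∫⁻ x, ‖u x‖ₑ ^ critExp n := by
  have hpp := critExp_sub_two_pos hn
  rw [lintegral_unitInversion (by omega) (fun x => ‖u x‖ₑ ^ critExp n)]
  refine lintegral_congr_ae ?_
  filter_upwards [ae_ne_zero (n := n) (by omega)] with x hx
  have hx0 : 0 < ‖x‖ := norm_pos_iff.2 hx
  rw [← ofReal_norm, kelvin, norm_smul, norm_act_inversion hσ hx, Real.norm_of_nonneg (by positivity),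
    ENNReal.ofReal_mul (by positivity), ENNReal.mul_rpow_of_nonneg _ _ (by linarith), ofReal_norm,
    ENNReal.ofReal_rpow_of_pos (by positivity), ← Real.rpow_mul hx0.le]
  congr 2
  rw [← Real.rpow_natCast, ← Real.rpow_neg hx0.le]
  congr 1
  have := sub_one_mul_critExp hn
  push_cast
  linarith

/-- Homogeneity of degree `2^♯ - 1` turns the weight `1 - n` into `-n - 1`. -/
lemma nonlin_kelvin (hn : 2 ≤ n) (hσ : IsCliffordFamily σ) (hH : IsAdmissible σ H)
    (u : Space n → Spinor m) {x : Space n} (hx : x ≠ 0) :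
    nonlin n H (kelvin σ u x) = ‖x‖ ^ (-(n : ℝ) - 1) •
      act (inversionMatrix σ x) (nonlin n H (u (unitInversion x))) := by
  have hx0 : 0 < ‖x‖ := norm_pos_iff.2 hx
  rw [kelvin, nonlin_real_smul H (Real.rpow_pos_of_pos hx0 _), nonlin_act_inversion hσ hH hx,
    ← Real.rpow_mul hx0.le]
  congr 2
  have := sub_one_mul_critExp hn
  linarith

/-- The Kelvin transform maps the potential of the nonlinearity of `u` to the potential of the
nonlinearity of its Kelvin transform. -/
lemma potential_kelvin (hn : 2 ≤ n) (hσ : IsCliffordFamily σ) (hH : IsAdmissible σ H)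
    (u : Space n → Spinor m) {x : Space n} (hx : x ≠ 0) :
    potential σ (fun y => nonlin n H (u y)) (unitInversion x) = ‖x‖ ^ ((n : ℝ) - 1) •
      act (inversionMatrix σ x) (potential σ (fun y => nonlin n H (kelvin σ u y)) x) := by
  rw [potential, potential, integral_unitInversion (by omega), ← act_real_smul, ← integral_smul,
    ← integral_act_inversion hσ hx]
  refine integral_congr_ae ?_
  filter_upwards [ae_ne_zero (n := n) (by omega)] with y hy
  have hy0 : 0 < ‖y‖ := norm_pos_iff.2 hy
  rw [kern_unitInversion_sub hσ hx hy, nonlin_kelvin hn hσ hH u hy, kern, kern, symbol_real_smul]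
  simp only [act_real_smul, smul_smul]
  congr 1
  -- Jacobian times kernel weight equals the weight of the transformed nonlinearity; here the
  -- critical power is decisive.
  have e : (‖y‖ ^ (2 * n))⁻¹ * ‖y‖ ^ ((n : ℝ) - 1) = ‖y‖ ^ (-(n : ℝ) - 1) := by
    rw [← Real.rpow_natCast, ← Real.rpow_neg hy0.le, ← Real.rpow_add hy0]
    congr 1
    push_cast
    ring
  rw [← e]
  ring

/-- Only the single point `0` is lost, so the Kelvin transform is again an integral solution and
regularity applies to it across the origin. -/
lemma IsRegularSolution.kelvin_eq (hn : 2 ≤ n) (hσ : IsCliffordFamily σ) (hH : IsAdmissible σ H)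
    {v : Space n → Spinor m} (hv : IsRegularSolution σ H v) {x : Space n} (hx : x ≠ 0) :
    kelvin σ v x = potentialConst n • potential σ (fun y => nonlin n H (kelvin σ v y)) x := by
  have hx0 : 0 < ‖x‖ := norm_pos_iff.2 hx
  rw [kelvin, hv.eq (unitInversion x), potential_kelvin hn hσ hH v hx, act_smul, act_real_smul,
    act_inversion_act_inversion hσ hx, smul_comm, smul_smul, ← Real.rpow_add hx0]
  simp

end CriticalDirac

end

/-! ### From weak solutions to the expansion at infinity. -/

noncomputable section

namespace CriticalDirac

open Set Metric Filter Topology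
open scoped ENNReal

variable {n m : ℕ} {σ : Fin n → Matrix (Fin m) (Fin m) ℂ} {H : Spinor m → SpinorMatrix m}

lemma IsWeakSolution.exists_isIntegralSolution (hn : 2 ≤ n) (hσ : IsCliffordFamily σ)
    (hH : IsAdmissible σ H) {ψ : Space n → Spinor m}
    (hψ : IsWeakSolution σ (fun _ z => homogeneousNonlinearity n H z) ψ) :
    ∃ u : Space n → Spinor m, u =ᵐ[volume] ψ ∧ IsIntegralSolution σ H u := by
  have hpp := critExp_sub_two_pos hn
  obtain ⟨hmem, hweak⟩ := hψ
  obtain ⟨u, hu, hψu⟩ : ∃ u : Space n → Spinor m, Measurable u ∧ ψ =ᵐ[volume] u :=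
    ⟨_, hmem.aestronglyMeasurable.stronglyMeasurable_mk.measurable,
      hmem.aestronglyMeasurable.ae_eq_mk⟩
  have humem : MemLp u (ENNReal.ofReal (critExp n)) := hmem.ae_eq hψu
  have hup := lintegral_norm_rpow_ne_top (by linarith) humem
  refine ⟨u, hψu.symm, hu, hup, ?_⟩
  refine ae_eq_potential hn hσ hu ((continuous_nonlin hn hH).measurable.comp hu) humem
    (lintegral_nonlin_ne_top hn hH hup) fun φ hφ hφc => ?_
  have h := hweak φ hφ hφc
  have e1 : ∫ x, inner ℂ (diracOp σ φ x) (ψ x) = ∫ x, inner ℂ (diracOp σ φ x) (u x) :=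
    integral_congr_ae (hψu.mono fun x hx => by simp only [hx])
  have e2 : ∫ x, inner ℂ (φ x) (act (homogeneousNonlinearity n H (ψ x)) (ψ x)) =
      ∫ x, inner ℂ (φ x) (nonlin n H (u x)) :=
    integral_congr_ae (hψu.mono fun x hx => by simp only [hx, nonlin])
  rw [← e1, ← e2]
  exact h

/-- A regular solution is the Kelvin transform of a regular solution. -/
lemma IsRegularSolution.exists_kelvin (hn : 2 ≤ n) (hσ : IsCliffordFamily σ)
    (hH : IsAdmissible σ H) {v : Space n → Spinor m} (hv : IsRegularSolution σ H v)
    (hvp : ∫⁻ x, ‖v x‖ₑ ^ critExp n ≠ ⊤) :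
    ∃ w : Space n → Spinor m, IsRegularSolution σ H w ∧ ∀ x, x ≠ 0 → v x = kelvin σ w x := by
  have hk : IsIntegralSolution σ H (kelvin σ v) :=
    { measurable := measurable_kelvin σ hv.continuous.measurable
      lintegral := by rwa [lintegral_kelvin hn hσ]
      ae_eq := by
        filter_upwards [ae_ne_zero (n := n) (by omega)] with x hx
        exact hv.kelvin_eq hn hσ hH hx }
  obtain ⟨w, -, hw, hwk⟩ := hk.exists_regular hn hσ hH
  refine ⟨w, hw, fun x hx => ?_⟩
  -- Both sides are given by the same potential at this point, so the identity is pointwise and not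
  -- merely almost everywhere.
  have e : w (unitInversion x) = kelvin σ v (unitInversion x) := by
    rw [hwk, hv.kelvin_eq hn hσ hH (unitInversion_ne_zero hx)]
  rw [kelvin, e, ← kelvin, kelvin_kelvin hσ v hx]

/-- Pulling out `|x|^{1-n}` and the unitary `𝒰(x)` identifies the remainder at infinity with the
Taylor remainder at `x / |x|²`. The minus sign at `Φ` matches the sign convention of the asymptotic
formula. -/
lemma expansion_kelvin_eq (hσ : IsCliffordFamily σ) (w : Space n → Spinor m) (Ψ : Spinor m)
    (Φ : Fin n → Spinor m) {x : Space n} (hx : x ≠ 0) :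
    ‖kelvin σ w x - ‖x‖ ^ (-(n : ℝ) + 1) • act (inversionMatrix σ x) Ψ
      + ‖x‖ ^ (-(n : ℝ)) • ∑ j, (x j / ‖x‖) • act (inversionMatrix σ x) (-Φ j)‖ =
    ‖x‖ ^ (1 - (n : ℝ)) *
      ‖w (unitInversion x) - Ψ - ∑ j, unitInversion x j • Φ j‖ := by
  have hx0 : 0 < ‖x‖ := norm_pos_iff.2 hx
  rw [← norm_act_inversion hσ hx (w (unitInversion x) - Ψ - ∑ j, unitInversion x j • Φ j)]
  conv_rhs => rw [← Real.norm_of_nonneg (Real.rpow_nonneg hx0.le (1 - (n : ℝ))), ← norm_smul]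
  have hs : act (inversionMatrix σ x) (∑ j, unitInversion x j • Φ j) =
      ∑ j, unitInversion x j • act (inversionMatrix σ x) (Φ j) := by
    simp only [← act_real_smul]
    simp only [act_eq, map_sum]
  have hneg : ∀ z : Spinor m, act (inversionMatrix σ x) (-z) = -act (inversionMatrix σ x) z :=
    fun z => by simp [act_eq]
  rw [act_sub, act_sub, hs, kelvin, smul_sub, smul_sub, Finset.smul_sum, Finset.smul_sum,
    sub_eq_add_neg _ (∑ j, _), ← Finset.sum_neg_distrib, neg_add_eq_sub]
  congr 2
  refine Finset.sum_congr rfl fun j _ => ?_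
  rw [hneg, smul_neg, smul_neg, smul_smul, smul_smul, unitInversion_eq, PiLp.smul_apply, smul_eq_mul,
    Real.rpow_sub hx0, Real.rpow_neg hx0.le, Real.rpow_one]
  congr 2
  field_simp

end CriticalDirac

end

theorem corollary5p2 (n m : ℕ) (hn : 2 ≤ n)
    (σ : Fin n → Matrix (Fin m) (Fin m) ℂ) (hσ : CriticalDirac.IsCliffordFamily σ)
    (H : CriticalDirac.Spinor m → CriticalDirac.SpinorMatrix m)
    (hH : CriticalDirac.IsAdmissible σ H)
    (ψ : CriticalDirac.Space n → CriticalDirac.Spinor m)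
    (hψ : CriticalDirac.IsWeakSolution σ
      (fun _ z => CriticalDirac.homogeneousNonlinearity n H z) ψ) :
    ∃ ψ' : CriticalDirac.Space n → CriticalDirac.Spinor m,
      Continuous ψ' ∧ ψ' =ᵐ[volume] ψ ∧
      ∃ (Ψ : CriticalDirac.Spinor m) (Φ : Fin n → CriticalDirac.Spinor m),
        ∀ α : ℝ, α < min (2 / ((n : ℝ) - 1)) 1 →
          ∃ C : ℝ, ∀ x : CriticalDirac.Space n, 1 ≤ ‖x‖ →
            ‖ψ' x - ‖x‖ ^ (-(n : ℝ) + 1) •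
                  CriticalDirac.act (CriticalDirac.inversionMatrix σ x) Ψ
                + ‖x‖ ^ (-(n : ℝ)) • ∑ j, (x j / ‖x‖) •
                  CriticalDirac.act (CriticalDirac.inversionMatrix σ x) (Φ j)‖
              ≤ C * ‖x‖ ^ (-(n : ℝ) - α) := by
  obtain ⟨u, huψ, hu⟩ := hψ.exists_isIntegralSolution hn hσ hH
  obtain ⟨v, hvu, hv, -⟩ := hu.exists_regular hn hσ hH
  have hvp : ∫⁻ x, ‖v x‖ₑ ^ CriticalDirac.critExp n ≠ ⊤ := by
    have e : ∫⁻ x, ‖v x‖ₑ ^ CriticalDirac.critExp n = ∫⁻ x, ‖u x‖ₑ ^ CriticalDirac.critExp n :=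
      lintegral_congr_ae (hvu.mono fun x hx => by simp only [hx])
    rw [e]
    exact hu.lintegral
  obtain ⟨w, hw, hvw⟩ := hv.exists_kelvin hn hσ hH hvp
  obtain ⟨Ψ, Φ, hexp⟩ := hw.expansion hn hσ hH
  refine ⟨v, hv.continuous, hvu.trans huψ, Ψ, fun j => -Φ j, fun α hα => ?_⟩
  have hγ := CriticalDirac.holderExp_pos hn
  have hα' : α < CriticalDirac.holderExp n := hα
  -- The expansion needs a positive order, whereas `α` is an arbitrary real below the threshold; a
  -- larger order only improves the decay for `|x| ≥ 1`.
  obtain ⟨C, hC⟩ := hexp (max α (CriticalDirac.holderExp n / 2))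
    (lt_max_of_lt_right (by linarith)) (max_lt hα' (by linarith))
  refine ⟨|C|, fun x hx => ?_⟩
  have hx0 : 0 < ‖x‖ := zero_lt_one.trans_le hx
  have hxne : x ≠ 0 := norm_pos_iff.1 hx0
  rw [hvw x hxne, CriticalDirac.expansion_kelvin_eq hσ w Ψ Φ hxne]
  have h1 := hC (CriticalDirac.unitInversion x) (by
    rw [CriticalDirac.norm_unitInversion]; exact inv_le_one_of_one_le₀ hx)
  calc _ ≤ ‖x‖ ^ (1 - (n : ℝ)) *
        (|C| * ‖x‖⁻¹ ^ (1 + max α (CriticalDirac.holderExp n / 2))) := by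
        rw [← CriticalDirac.norm_unitInversion x]
        gcongr
        exact h1.trans (by gcongr; exact le_abs_self C)
    _ = |C| * ‖x‖ ^ (-(n : ℝ) - max α (CriticalDirac.holderExp n / 2)) := by
        rw [Real.inv_rpow hx0.le, ← Real.rpow_neg hx0.le, mul_left_comm, ← Real.rpow_add hx0]
        congr 2
        ring
    _ ≤ |C| * ‖x‖ ^ (-(n : ℝ) - α) := by
        gcongr
        exact le_max_left _ _
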